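/- All graphs are finite directed graphs $\Gamma=(V,E,o,t)$ (loops and multiple edges allowed). A graph map $\gamma:\Gamma\to\Delta$ is a \emph{forwards immersion} if for every vertex $v$ it is injective on the set of edges with origin $v$. Let $\beta_1$ be the first Betti number and $\partial\Gamma$ the set of vertices of indegree $0$ or outdegree $0$. A \emph{circle} is a directed circle with $k\ge 1$ edges, a \emph{cycle} in $\Gamma$ is a graph map $f:S^1\to\Gamma$ from a circle; $\deg(f)$ is the largest degree of a covering map $S^1\to S^1$ through which $f$ factors, and $f$ is \emph{primitive} if it does not factor properly through another cycle. For a forwards immersion $\gamma:\Gamma\to\Delta$ the \emph{long cycles} of $\Gamma$ are the graph map $s_\Gamma:\mathbb S_\Gamma\to\Gamma$, unique up to isomorphism over $\Gamma$, such that $\mathbb S_\Gamma$ is a disjoint union of at most $\beta_1(\Gamma)$ circles, the restrictions of $s_\Gamma$ to these circles are pairwise non-isomorphic primitive cycles $g$ with $\deg(\gamma\circ g)\ge 12\,\beta_1(\Gamma)$, and every cycle $f:S^1\to\Gamma$ with $$\frac{\deg(\gamma\circ f)}{\deg(f)}\ \ge\ 12\,\beta_1(\Gamma)$$ factors through $s_\Gamma$.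 \textbf{Theorem.} There are an algorithm and a constant $C$ such that, given as input any two forwards immersions $\gamma:\Gamma\to\Delta$ and $\lambda:\Lambda\to\Delta$ of finite graphs, the algorithm computes the graph $\mathbb S_\Gamma$ and the graph map $s_\Gamma:\mathbb S_\Gamma\to\Gamma$ in at most $C\,(m^2 n+1)$ steps, where $$m=(\beta_1(\Gamma)+|\partial\Gamma|)+(\beta_1(\Lambda)+|\partial\Lambda|),\qquad n=|E(\Gamma)|+|E(\Lambda)|.$$ Here an algorithm is a program of a random access machine with unit cost instructions (constants, copying, addition, truncated subtraction, indirect reading and writing of array entries, comparison of registers) and words of $O(\log N)$ bits, where $N$ is the total number of vertices and edges of $\Gamma,\Lambda,\Delta$; graphs and graph maps are given and returned as tables of their origin, target, vertex and edge maps. -/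

import Mathlib

namespace LongCycles

/-! ## Directed graphs and graph maps -/

/-- A directed graph (loops and multiple edges allowed) with vertex set `V` and edge set `E`. -/
structure DGraph (V E : Type*) where
  /-- origin map -/
  o : E → V
  /-- target map -/
  t : E → V

namespace DGraph

variable {V E : Type*}

/-- The forwards star of `v`: the edges with origin `v`. -/
def fstar (G : DGraph V E) (v : V) : Set E := {e | G.o e = v}

/-- The backwards star of `v`: the edges with target `v`. -/
def bstar (G : DGraph V E) (v : V) : Set E := {e | G.t e = v}

/-- The boundary `∂G`: the vertices of indegree `0` or of outdegree `0`. -/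
def boundary (G : DGraph V E) : Set V := {v | G.bstar v = ∅ ∨ G.fstar v = ∅}

/-- The boundary map `C₁(G; ℚ) → C₀(G; ℚ)`, `e ↦ t(e) - o(e)`, of the cellular chain complex. -/
noncomputable def chainBoundary (G : DGraph V E) : (E →₀ ℚ) →ₗ[ℚ] (V →₀ ℚ) :=
  Finsupp.linearCombination ℚ fun e => Finsupp.single (G.t e) 1 - Finsupp.single (G.o e) 1

/-- The first Betti number of (the geometric realisation of) `G`: the dimension of
`H₁(G; ℚ)`, which is the kernel of the boundary map as `G` has no 2-cells. -/
noncomputable def betti (G : DGraph V E) : ℕ :=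
  Module.finrank ℚ (LinearMap.ker G.chainBoundary)

end DGraph

/-- A graph map. -/
@[ext]
structure Hom {V E V' E' : Type*} (G : DGraph V E) (H : DGraph V' E') where
  /-- the map on vertices -/
  onV : V → V'
  /-- the map on edges -/
  onE : E → E'
  map_o : ∀ e, onV (G.o e) = H.o (onE e)
  map_t : ∀ e, onV (G.t e) = H.t (onE e)

namespace Hom

variable {V₁ E₁ V₂ E₂ V₃ E₃ : Type*}
  {G : DGraph V₁ E₁} {H : DGraph V₂ E₂} {K : DGraph V₃ E₃}

/-- Composition of graph maps, `f.comp g = f ∘ g`. -/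
def comp (f : Hom H K) (g : Hom G H) : Hom G K where
  onV := f.onV ∘ g.onV
  onE := f.onE ∘ g.onE
  map_o e := by simp [g.map_o, f.map_o]
  map_t e := by simp [g.map_t, f.map_t]

/-- A graph map is a forwards immersion if it is injective on each forwards star. -/
def IsForwardsImmersion (f : Hom G H) : Prop := ∀ v, Set.InjOn f.onE (G.fstar v)

/-- A graph map is an isomorphism if it is bijective on vertices and on edges. -/
def IsIso (f : Hom G H) : Prop := Function.Bijective f.onV ∧ Function.Bijective f.onE

/-- A covering map of degree `d`: bijective on forwards and on backwards stars, with all vertex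
fibres of size `d`. -/
def IsCoveringOfDegree (f : Hom G H) (d : ℕ) : Prop :=
  (∀ v, Set.BijOn f.onE (G.fstar v) (H.fstar (f.onV v))) ∧
  (∀ v, Set.BijOn f.onE (G.bstar v) (H.bstar (f.onV v))) ∧
  ∀ v, (f.onV ⁻¹' {v}).ncard = d

end Hom

/-! ## Circles and cycles -/

/-- The circle with `k` vertices and `k` edges, used for `k ≥ 1` only: the edge `i` goes from the
vertex `i` to the vertex `i + 1`, indices mod `k`. -/
def circle (k : ℕ) : DGraph (ZMod k) (ZMod k) where
  o i := i
  t i := i + 1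

/-- The disjoint union of the circles of lengths `len i`. -/
def circles {ι : Type*} (len : ι → ℕ) : DGraph (Σ i, ZMod (len i)) (Σ i, ZMod (len i)) where
  o x := x
  t x := ⟨x.1, x.2 + 1⟩

/-- The inclusion of the `i`-th circle in a disjoint union of circles. -/
def circleIncl {ι : Type*} (len : ι → ℕ) (i : ι) : Hom (circle (len i)) (circles len) where
  onV x := ⟨i, x⟩
  onE x := ⟨i, x⟩
  map_o _ := rfl
  map_t _ := rfl

section Cycles

variable {V E : Type*} {G : DGraph V E}

/-- The degree of a cycle `f : S¹ → G`: the largest degree of a covering map `S¹ → S¹` that `f`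
factors through. (For `k ≥ 1` the set of these degrees contains `1` and is bounded by `k`.) -/
noncomputable def degree {k : ℕ} (f : Hom (circle k) G) : ℕ :=
  sSup {d | ∃ l, 0 < l ∧ ∃ (p : Hom (circle k) (circle l)) (g : Hom (circle l) G),
    p.IsCoveringOfDegree d ∧ g.comp p = f}

/-- A cycle is primitive if it does not factor properly through any other cycle. -/
def IsPrimitive {k : ℕ} (f : Hom (circle k) G) : Prop :=
  ∀ l, 0 < l → ∀ (p : Hom (circle k) (circle l)) (g : Hom (circle l) G), g.comp p = f → p.IsIso

end Cycles

/-- `s : S → Γ` is the graph of long cycles of the map `γ : Γ → Δ`: `S` is a disjoint union of at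
most `β₁(Γ)` circles, the restrictions of `s` to these circles are primitive cycles
`g : S¹ → Γ` with `deg (γ ∘ g) ≥ 12 β₁(Γ)`, no two of them the same cycle (up to an isomorphism of
circles), and every cycle `f : S¹ → Γ` with `deg (γ ∘ f) / deg f ≥ 12 β₁(Γ)` factors through `s`.
This determines `s` up to an isomorphism of graphs over `Γ`. -/
def IsLongCycles {V E V' E' W F : Type*} {Γ : DGraph V E} {Δ : DGraph V' E'} {S : DGraph W F}
    (γ : Hom Γ Δ) (s : Hom S Γ) : Prop :=
  ∃ (r : ℕ) (len : Fin r → ℕ) (φ : Hom (circles len) S),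
    r ≤ Γ.betti ∧ (∀ i, 0 < len i) ∧ φ.IsIso ∧
    (∀ i, IsPrimitive ((s.comp φ).comp (circleIncl len i)) ∧
      12 * Γ.betti ≤ degree (γ.comp ((s.comp φ).comp (circleIncl len i)))) ∧
    (∀ i j, (∃ ψ : Hom (circle (len i)) (circle (len j)), ψ.IsIso ∧
      ((s.comp φ).comp (circleIncl len j)).comp ψ = (s.comp φ).comp (circleIncl len i)) → i = j) ∧
    ∀ k, 0 < k → ∀ f : Hom (circle k) Γ, 12 * Γ.betti * degree f ≤ degree (γ.comp f) →
      ∃ h : Hom (circle k) S, s.comp h = f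

/-! ## Random access machines

A random access machine with unit cost instructions, given by structured programs. A machine has
registers and arrays, all of whose entries are natural numbers; a program mentions only finitely
many registers and finitely many arrays. -/

/-- The memory of a machine: register `x` holds `reg x`, entry `i` of array `a` is `arr a i`. -/
structure Mem where
  /-- registers -/
  reg : ℕ → ℕ
  /-- arrays -/
  arr : ℕ → ℕ → ℕ

/-- Write `n` to register `x`. -/
def Mem.setReg (σ : Mem) (x n : ℕ) : Mem := ⟨Function.update σ.reg x n, σ.arr⟩

/-- Write `n` to entry `i` of array `a`. -/
def Mem.setArr (σ : Mem) (a i n : ℕ) : Mem :=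
  ⟨σ.reg, Function.update σ.arr a (Function.update (σ.arr a) i n)⟩

/-- Tests: comparisons of two registers. -/
inductive Test where
  /-- is the content of `x` less than that of `y`? -/
  | lt (x y : ℕ)
  /-- is the content of `x` equal to that of `y`? -/
  | eq (x y : ℕ)

/-- The outcome of a test. -/
def Test.Holds (σ : Mem) : Test → Prop
  | .lt x y => σ.reg x < σ.reg y
  | .eq x y => σ.reg x = σ.reg y

/-- Programs. -/
inductive Prog where
  /-- do nothing -/
  | skip
  /-- `x := n` for a constant `n` -/
  | const (x n : ℕ)
  /-- `x := y` -/
  | copy (x y : ℕ)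
  /-- `x := y + z` -/
  | add (x y z : ℕ)
  /-- `x := y - z`, which is `0` if `y ≤ z` -/
  | sub (x y z : ℕ)
  /-- `x := a[y]` -/
  | load (x a y : ℕ)
  /-- `a[x] := y` -/
  | store (a x y : ℕ)
  /-- `p; q` -/
  | seq (p q : Prog)
  /-- `if b then p else q` -/
  | ite (b : Test) (p q : Prog)
  /-- `while b do p` -/
  | loop (b : Test) (p : Prog)

/-- `Exec W p σ T σ'`: started on the memory `σ`, the program `p` halts after exactly `T` steps with
memory `σ'`, on a machine whose words hold the numbers up to `W`. Every elementary instruction and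
every evaluation of a test is one step. A constant or a sum that exceeds `W` cannot be
written (the machine is stuck); no other instruction creates larger numbers. -/
inductive Exec (W : ℕ) : Prog → Mem → ℕ → Mem → Prop where
  | skip (σ : Mem) : Exec W .skip σ 1 σ
  | const (σ : Mem) (x n : ℕ) (h : n ≤ W) : Exec W (.const x n) σ 1 (σ.setReg x n)
  | copy (σ : Mem) (x y : ℕ) : Exec W (.copy x y) σ 1 (σ.setReg x (σ.reg y))
  | add (σ : Mem) (x y z : ℕ) (h : σ.reg y + σ.reg z ≤ W) :
      Exec W (.add x y z) σ 1 (σ.setReg x (σ.reg y + σ.reg z))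
  | sub (σ : Mem) (x y z : ℕ) : Exec W (.sub x y z) σ 1 (σ.setReg x (σ.reg y - σ.reg z))
  | load (σ : Mem) (x a y : ℕ) : Exec W (.load x a y) σ 1 (σ.setReg x (σ.arr a (σ.reg y)))
  | store (σ : Mem) (a x y : ℕ) :
      Exec W (.store a x y) σ 1 (σ.setArr a (σ.reg x) (σ.reg y))
  | seq {p q : Prog} {σ₁ σ₂ σ₃ : Mem} {T₁ T₂ : ℕ}
      (hp : Exec W p σ₁ T₁ σ₂) (hq : Exec W q σ₂ T₂ σ₃) : Exec W (.seq p q) σ₁ (T₁ + T₂) σ₃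
  | iteTrue {b : Test} {p q : Prog} {σ σ' : Mem} {T : ℕ} (hb : b.Holds σ)
      (hp : Exec W p σ T σ') : Exec W (.ite b p q) σ (1 + T) σ'
  | iteFalse {b : Test} {p q : Prog} {σ σ' : Mem} {T : ℕ} (hb : ¬ b.Holds σ)
      (hq : Exec W q σ T σ') : Exec W (.ite b p q) σ (1 + T) σ'
  | loopFalse {b : Test} {p : Prog} {σ : Mem} (hb : ¬ b.Holds σ) : Exec W (.loop b p) σ 1 σ
  | loopTrue {b : Test} {p : Prog} {σ₁ σ₂ σ₃ : Mem} {T₁ T₂ : ℕ} (hb : b.Holds σ₁)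
      (hp : Exec W p σ₁ T₁ σ₂) (hl : Exec W (.loop b p) σ₂ T₂ σ₃) :
      Exec W (.loop b p) σ₁ (1 + T₁ + T₂) σ₃

/-! ## Input and output -/

/-- A map `Fin p → Fin q` as an array: the table of its values, followed by zeros. -/
def table {p q : ℕ} (f : Fin p → Fin q) : ℕ → ℕ :=
  fun i => if h : i < p then (f ⟨i, h⟩ : ℕ) else 0

/-- The input memory for graph maps `γ : Γ → Δ` and `lam : Λ → Δ`: the numbers of vertices and edges
of the three graphs are in the registers, the tables of their origin and target maps and of the two
graph maps are in the arrays. All other registers and array entries are `0`. -/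
def input {v e v' e' v'' e'' : ℕ} {Γ : DGraph (Fin v) (Fin e)} {Λ : DGraph (Fin v') (Fin e')}
    {Δ : DGraph (Fin v'') (Fin e'')} (γ : Hom Γ Δ) (lam : Hom Λ Δ) : Mem where
  reg
    | 0 => v
    | 1 => e
    | 2 => v'
    | 3 => e'
    | 4 => v''
    | 5 => e''
    | _ => 0
  arr
    | 0 => table Γ.o
    | 1 => table Γ.t
    | 2 => table γ.onV
    | 3 => table γ.onE
    | 4 => table Λ.o
    | 5 => table Λ.t
    | 6 => table lam.onV
    | 7 => table lam.onE
    | 8 => table Δ.o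
    | 9 => table Δ.t
    | _ => fun _ => 0

/-- The memory `σ` contains the graph `S` and the graph map `s : S → Γ` as output: the numbers of
vertices and edges of `S` are in registers `6` and `7`, the tables of the origin and target maps of
`S` and of the maps of `s` on vertices and edges are in the arrays `10`, `11`, `12`, `13`. -/
def Outputs {v e p q : ℕ} {Γ : DGraph (Fin v) (Fin e)} {S : DGraph (Fin p) (Fin q)}
    (σ : Mem) (s : Hom S Γ) : Prop :=
  σ.reg 6 = p ∧ σ.reg 7 = q ∧
  (∀ i : Fin q, σ.arr 10 i = S.o i) ∧ (∀ i : Fin q, σ.arr 11 i = S.t i) ∧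
  (∀ i : Fin p, σ.arr 12 i = s.onV i) ∧ (∀ i : Fin q, σ.arr 13 i = s.onE i)

end LongCycles

/-! Up to rotation and iteration a cycle in `Γ` is a periodic path `F : ℕ → E`. Call `γ.onE ∘ F` its
labels; the long cycles are the paths with `12 β * per labels ≤ per F` (`isLong_seq`,
`exists_isLongCycles`). Since `γ` is injective on forwards stars, a path is determined by its first
vertex and its labels, so a long cycle can be recovered from one vertex and one period of its
labels. The task is to find this period quickly.

Discard all edges that lie on no infinite path. Of the remaining edges at most `2 β` leave a
branching vertex. Together with one edge on every circle that never branches these are the start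
edges, at most `3 β` in number (`card_start_le`). Between start edges a path has no choice. The
combinatorial heart is `exists_long_run`: every long cycle contains a start edge that is followed by
no start edge for two periods of the labels, so the forced segment behind that edge displays the
period twice.

To see this, let `q` be the period of the labels and cut the cycle at its start edges and at the
vertices where it merges with itself; there are at most `4 β` cut edges. A periodic word has a
position that is not the centre of a square of a word shorter than the period (`exists_critical`).
The `per F / q ≥ 12 β` occurrences of this position along the cycle carry different edges. If two of
them lay behind the same cut edge at distances differing by less than `q`, the forced labels would
form such a square. Hence at most `8 β` occurrences lie less than `2 q` behind a cut. The same
count, with `q` in place of `2 q`, shows `2 * per F ≤ 3 * |E|`, so that walks may be stopped after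
`2 * |E|` steps.

The algorithm takes every start edge, reads the labels of its segment, computes their minimal period
`p` by longest borders, and follows these labels periodically. A walk is accepted if it closes up
after at least `12 β` periods, its segment has at least `2 p` letters, and it does not meet the
first edge of an accepted cycle with the same `p`. For a start edge supplied by `exists_long_run`
the walk traces exactly the long cycle (`LongStart.follow`). If an accepted cycle runs through the
first edge of an accepted cycle of the same or a larger period, the two are equal
(`Found.independent`). So the accepted cycles, ordered by period, are in triangular position in
homology, and there are at most `β` of them (`DGraph.card_le_betti`).

Outdegrees are at most `β + |∂Γ| + 1`, hence a walk costs `O((β + |∂Γ|) * |E|)`, and there are at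
most `3 β` walks. All preparations are linear in the graph: adjacency lists, components (which give
`β` by Euler's formula), removal of sinks, and the search for circles. Correctness and running time
are proved together: `Run` asserts termination with a property of both time and memory, and
`Run.loop` takes an invariant with a potential. -/

namespace LongCycles

/-! ## Periodic sequences -/

section Sequences

variable {A B : Type*}

/-- The shift of a sequence. -/
def shift (a : ℕ → A) : ℕ → A := fun i => a (i + 1)

theorem shift_iterate (n : ℕ) (a : ℕ → A) : shift^[n] a = fun i => a (i + n) := by
  induction n generalizing a with
  | zero => rfl
  | succ n ih =>
    rw [Function.iterate_succ_apply, ih]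
    funext i
    simp only [shift]
    congr 1

theorem isPeriodicPt_shift {n : ℕ} {a : ℕ → A} :
    Function.IsPeriodicPt shift n a ↔ ∀ i, a (i + n) = a i := by
  rw [Function.IsPeriodicPt, Function.IsFixedPt, shift_iterate]
  exact funext_iff

/-- The minimal period of a sequence (`0` if it is not periodic). -/
noncomputable def per (a : ℕ → A) : ℕ := Function.minimalPeriod shift a

theorem per_spec (a : ℕ → A) (i : ℕ) : a (i + per a) = a i :=
  isPeriodicPt_shift.1 (Function.isPeriodicPt_minimalPeriod shift a) i

theorem per_dvd {a : ℕ → A} {n : ℕ} (h : ∀ i, a (i + n) = a i) : per a ∣ n :=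
  (isPeriodicPt_shift.2 h).minimalPeriod_dvd

theorem per_pos {a : ℕ → A} {n : ℕ} (hn : 0 < n) (h : ∀ i, a (i + n) = a i) : 0 < per a :=
  (isPeriodicPt_shift.2 h).minimalPeriod_pos hn

theorem apply_add_mul {a : ℕ → A} {n : ℕ} (h : ∀ i, a (i + n) = a i) (i j : ℕ) :
    a (i + j * n) = a i := by
  induction j with
  | zero => simp
  | succ j ih => rw [Nat.succ_mul, ← add_assoc, h, ih]

theorem periodic_of_dvd {a : ℕ → A} {n m : ℕ} (h : ∀ i, a (i + n) = a i) (hd : n ∣ m) (i : ℕ) :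
    a (i + m) = a i := by
  obtain ⟨j, rfl⟩ := hd
  rw [mul_comm]
  exact apply_add_mul h i j

theorem apply_mod {a : ℕ → A} {n : ℕ} (h : ∀ i, a (i + n) = a i) (i : ℕ) : a (i % n) = a i := by
  conv_rhs => rw [← Nat.mod_add_div i n, mul_comm n]
  rw [apply_add_mul h]

/-- An identity `a (i + n) = a i` for all `i` in one period window holds everywhere. -/
theorem periodic_of_window {a : ℕ → A} {k n c : ℕ} (hk : 0 < k) (h : ∀ i, a (i + k) = a i)
    (hw : ∀ i < k, a (c + i + n) = a (c + i)) (i : ℕ) : a (i + n) = a i := by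
  have hi : ∀ i, a (c + i + n) = a (c + i) := by
    intro i
    have h1 := hw (i % k) (Nat.mod_lt _ hk)
    have e1 : a (c + i % k + n) = a (c + i + n) := by
      have := apply_add_mul h (c + i % k + n) (i / k)
      rw [← this]; congr 1
      have := Nat.mod_add_div i k
      rw [mul_comm] at this; omega
    have e2 : a (c + i % k) = a (c + i) := by
      have := apply_add_mul h (c + i % k) (i / k)
      rw [← this]; congr 1
      have := Nat.mod_add_div i k
      rw [mul_comm] at this; omega
    rw [← e1, ← e2, h1]
  have hc : c ≤ c * k := Nat.le_mul_of_pos_right _ hk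
  have h1 := hi (c * k - c + i)
  have e1 : c + (c * k - c + i) = i + c * k := by omega
  rw [e1, apply_add_mul h] at h1
  rw [← h1, add_right_comm, apply_add_mul h]

/-- A tail of a periodic sequence contains a full window, so each of the two minimal periods is a
period of the other sequence. -/
theorem per_shift_eq {a : ℕ → A} {k : ℕ} (hk : 0 < k) (h : ∀ i, a (i + k) = a i) (c : ℕ) :
    per (fun i => a (c + i)) = per a := by
  apply Nat.dvd_antisymm
  · apply per_dvd
    intro i
    show a (c + (i + per a)) = a (c + i)
    rw [← add_assoc]; exact per_spec a _
  · apply per_dvd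
    apply periodic_of_window (c := c) hk h
    intro i _
    have := per_spec (fun i => a (c + i)) i
    rw [add_assoc]; exact this

/-- A periodic sequence in a linear order has a position that is not the centre of a square `u u`
with `u` shorter than the minimal period. -/
theorem exists_critical [LinearOrder A] {a : ℕ → A} (hq : 0 < per a) :
    ∃ r < per a, ∀ i ℓ, i % per a = r → 0 < ℓ → ℓ < per a → ℓ ≤ i →
      ∃ t < ℓ, a (i + t) ≠ a (i - ℓ + t) := by
  set q := per a with hqdef
  -- The critical position is the start of the lexicographically largest tail.
  let f : ℕ → Lex (ℕ → A) := fun r => toLex fun i => a (r + i)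
  have hf : ∀ r, f (r % q) = f r := by
    intro r
    simp only [f]
    congr 1
    funext i
    have e := apply_add_mul (per_spec a) (r % q + i) (r / q)
    rw [← hqdef] at e
    rw [← e]; congr 1
    have := Nat.mod_add_div r q
    rw [mul_comm] at this; omega
  obtain ⟨r, hr, hmax⟩ := Finset.exists_max_image (Finset.range q) f ⟨0, by simpa using hq⟩
  have hmax' : ∀ i, f i ≤ f r := fun i => by
    rw [← hf]; exact hmax _ (Finset.mem_range.2 (Nat.mod_lt _ hq))
  refine ⟨r, Finset.mem_range.1 hr, ?_⟩
  intro i ℓ hi hℓ hℓq hℓi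
  by_contra! hsq
  have hir : f i = f r := by rw [← hf i, hi]
  -- compare the sequences starting at `i - ℓ`, `i` and `i + ℓ`
  have hle : f i ≤ f (i - ℓ) := by
    by_contra hlt
    push Not at hlt
    obtain ⟨j, hj, hlt⟩ := hlt
    replace hj : ∀ t < j, a (i - ℓ + t) = a (i + t) := hj
    replace hlt : a (i - ℓ + j) < a (i + j) := hlt
    by_cases hjl : j < ℓ
    · have := hsq j hjl
      simp [this] at hlt
    -- The tails at `i - ℓ` and `i` share their first `ℓ` letters because of the square. Deleting
    -- these letters moves the strict inequality to the tails at `i` and `i + ℓ`, against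
    -- maximality.
    · have : f i < f (i + ℓ) := by
        refine ⟨j - ℓ, ?_, ?_⟩
        · intro t ht
          have h1 := hj (ℓ + t) (by omega)
          change a (i + t) = a (i + ℓ + t)
          have e1 : i - ℓ + (ℓ + t) = i + t := by omega
          have e2 : i + (ℓ + t) = i + ℓ + t := by omega
          rw [e1, e2] at h1; exact h1
        · change a (i + (j - ℓ)) < a (i + ℓ + (j - ℓ))
          have e1 : i - ℓ + j = i + (j - ℓ) := by omega
          have e2 : i + j = i + ℓ + (j - ℓ) := by omega
          rw [e1, e2] at hlt; exact hlt
      exact absurd (hmax' (i + ℓ)) (by rw [← hir]; exact not_le.2 this)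
  have heq : f (i - ℓ) = f i := le_antisymm (hir ▸ hmax' _) hle
  -- Equal tails at distance `ℓ` make `ℓ` a period, which is too short.
  have hper : ∀ t, a (t + ℓ) = a t := by
    apply periodic_of_window (c := i - ℓ) hq (per_spec a)
    intro t _
    have h1 := congrFun (congrArg ofLex heq) t
    simp only [f, ofLex_toLex] at h1
    rw [h1]; congr 1; omega
  have := Nat.le_of_dvd hℓ (per_dvd hper)
  omega

theorem per_comp_dvd {a : ℕ → A} (g : A → B) : per (fun i => g (a i)) ∣ per a :=
  per_dvd fun i => by rw [per_spec a]

end Sequences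

/-! ## Paths -/

section Paths

variable {V E V' E' : Type*} {Γ : DGraph V E} {Δ : DGraph V' E'}

/-- An infinite path. -/
def IsPath (Γ : DGraph V E) (F : ℕ → E) : Prop := ∀ i, Γ.t (F i) = Γ.o (F (i + 1))

theorem IsPath.shift {F : ℕ → E} (h : IsPath Γ F) (c : ℕ) : IsPath Γ fun i => F (c + i) :=
  fun i => h (c + i)

/-- Paths are determined by their labels. -/
theorem Hom.IsForwardsImmersion.path_eq {γ : Hom Γ Δ} (hγ : γ.IsForwardsImmersion) {F G : ℕ → E}
    (hF : IsPath Γ F) (hG : IsPath Γ G) (h0 : Γ.o (F 0) = Γ.o (G 0)) {n : ℕ}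
    (h : ∀ i < n, γ.onE (F i) = γ.onE (G i)) : ∀ i < n, F i = G i := by
  intro i
  induction i with
  | zero => intro hi; exact hγ _ rfl h0.symm (h 0 hi)
  | succ i ih =>
    intro hi
    have h1 := ih (by omega)
    refine hγ (Γ.o (F (i + 1))) rfl ?_ (h _ hi)
    change Γ.o (G (i + 1)) = _
    rw [← hG i, ← hF i, h1]

theorem Hom.IsForwardsImmersion.path_eq' {γ : Hom Γ Δ} (hγ : γ.IsForwardsImmersion) {F G : ℕ → E}
    (hF : IsPath Γ F) (hG : IsPath Γ G) (h0 : Γ.o (F 0) = Γ.o (G 0))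
    (h : ∀ i, γ.onE (F i) = γ.onE (G i)) : F = G := by
  funext i
  exact hγ.path_eq hF hG h0 (n := i + 1) (fun j _ => h j) i (by omega)

/-- In a periodic path with labels of period `q`, two positions that carry the same edge and are
congruent mod `q` are congruent modulo the period of the path. -/
theorem Hom.IsForwardsImmersion.per_dvd_sub {γ : Hom Γ Δ} (hγ : γ.IsForwardsImmersion) {F : ℕ → E}
    (hF : IsPath Γ F) (hper : 0 < per F) {q i j : ℕ} (hq : ∀ i, γ.onE (F (i + q)) = γ.onE (F i))
    (hij : Γ.o (F i) = Γ.o (F (i + j))) (hj : q ∣ j) : per F ∣ j := by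
  apply per_dvd
  have h := hγ.path_eq' (hF.shift i) (hF.shift (i + j)) (by simpa using hij) (fun t => by
    have := periodic_of_dvd (a := fun i => γ.onE (F i)) hq hj (i + t)
    rw [← this]; congr 2; omega)
  apply periodic_of_window (c := i) hper (per_spec F)
  intro t _
  have := congrFun h t
  rw [this]; congr 1; omega

end Paths

/-! ## Bounds by the Betti number -/

section Betti

variable {V E : Type*} (G : DGraph V E)

theorem DGraph.chainBoundary_single (e : E) (c : ℚ) :
    G.chainBoundary (Finsupp.single e c) =
      Finsupp.single (G.t e) c - Finsupp.single (G.o e) c := by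
  simp [DGraph.chainBoundary, smul_sub]

/-- The boundary of a path telescopes to its end minus its beginning. -/
theorem DGraph.chainBoundary_closed {F : ℕ → E} (hF : IsPath G F) {k : ℕ}
    (hk : ∀ i, F (i + k) = F i) :
    G.chainBoundary (∑ i ∈ Finset.range k, Finsupp.single (F i) 1) = 0 := by
  rw [map_sum]
  simp only [G.chainBoundary_single, hF _]
  rw [Finset.sum_range_sub fun i => (Finsupp.single (G.o (F i)) (1 : ℚ))]
  have := hk 0
  rw [zero_add] at this
  rw [this, sub_self]

/-- Closed paths `F i` with marked edges `F i 0` such that `F i` misses the marked edge of `F j` for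
`i ≠ j` with `p i ≤ p j` are linearly independent in homology. -/
theorem DGraph.card_le_betti [Finite E] {ι : Type*} [Fintype ι] (F : ι → ℕ → E) (k p : ι → ℕ)
    (hF : ∀ i, IsPath G (F i)) (hk : ∀ i t, F i (t + k i) = F i t) (hk0 : ∀ i, 0 < k i)
    (hmiss : ∀ i j t, p i ≤ p j → F i t = F j 0 → i = j) : Fintype.card ι ≤ G.betti := by
  classical
  let c : ι → LinearMap.ker G.chainBoundary := fun i =>
    ⟨∑ t ∈ Finset.range (k i), Finsupp.single (F i t) 1, G.chainBoundary_closed (hF i) (hk i)⟩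
  have hc : ∀ i e, ((c i : E →₀ ℚ) e) = ∑ t ∈ Finset.range (k i), if F i t = e then 1 else 0 := by
    intro i e
    simp [c, Finsupp.finsetSum_apply, Finsupp.single_apply]
  have hli : LinearIndependent ℚ c := by
    rw [Fintype.linearIndependent_iff]
    intro g hg
    by_contra! hne
    obtain ⟨i0, hi0⟩ := hne
    -- Among the cycles in a linear relation take one with `p` maximal. No other cycle in the
    -- relation uses its marked edge, while it uses this edge a positive number of times itself, so
    -- the coefficient of the marked edge gives a contradiction.
    obtain ⟨j, hj, hmax⟩ := Finset.exists_max_image (Finset.univ.filter fun i => g i ≠ 0) p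
      ⟨i0, by simpa using hi0⟩
    have hj0 : g j ≠ 0 := by simpa using hj
    have h1 := congrArg (fun x : LinearMap.ker G.chainBoundary => (x : E →₀ ℚ) (F j 0)) hg
    simp only [Submodule.coe_sum, Submodule.coe_smul, Finsupp.finsetSum_apply, Finsupp.smul_apply,
      ZeroMemClass.coe_zero, Finsupp.zero_apply, smul_eq_mul] at h1
    rw [Finset.sum_eq_single j] at h1
    · rcases mul_eq_zero.1 h1 with h | h
      · exact hj0 h
      · rw [hc] at h
        have h2 : (1 : ℚ) ≤ ∑ t ∈ Finset.range (k j), if F j t = F j 0 then 1 else 0 := by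
          have := Finset.single_le_sum (f := fun t => if F j t = F j 0 then (1 : ℚ) else 0)
            (s := Finset.range (k j)) (fun t _ => by positivity) (Finset.mem_range.2 (hk0 j))
          simpa using this
        linarith
    · intro i _ hij
      by_cases hgi : g i = 0
      · simp [hgi]
      · rw [hc, Finset.sum_eq_zero, mul_zero]
        intro t _
        rw [if_neg]
        intro h
        exact hij (hmiss i j t (hmax i (by simpa using hgi)) h)
    · simp
  have : Finite E := inferInstance
  exact hli.fintype_card_le_finrank

/-- A subgraph with vertices `U` and edges `L` satisfies `|L| ≤ |U| + β₁`. -/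
theorem DGraph.card_edges_le [Finite E] (L : Finset E) (U : Finset V)
    (ho : ∀ e ∈ L, G.o e ∈ U) (ht : ∀ e ∈ L, G.t e ∈ U) : L.card ≤ U.card + G.betti := by
  classical
  let S := Finsupp.supported ℚ ℚ (L : Set E)
  -- Rank and nullity of the boundary map on chains supported on `L`: the rank is bounded by `|U|`,
  -- and the kernel embeds in the cycles of `G`.
  let g : S →ₗ[ℚ] (V →₀ ℚ) := G.chainBoundary ∘ₗ S.subtype
  have hS : Module.finrank ℚ S = L.card := by
    rw [(Finsupp.supportedEquivFinsupp (M := ℚ) (R := ℚ) (L : Set E)).finrank_eq]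
    simp
  have hrange : LinearMap.range g ≤ Finsupp.supported ℚ ℚ (U : Set V) := by
    have : S ≤ (Finsupp.supported ℚ ℚ (U : Set V)).comap G.chainBoundary := by
      simp only [S]
      rw [Finsupp.supported_eq_span_single, Submodule.span_le]
      rintro _ ⟨e, he, rfl⟩
      simp only [Submodule.comap_coe, Set.mem_preimage, SetLike.mem_coe, G.chainBoundary_single]
      exact Submodule.sub_mem _ (Finsupp.single_mem_supported _ _ (ht e he))
        (Finsupp.single_mem_supported _ _ (ho e he))
    rintro _ ⟨x, rfl⟩
    exact this x.2
  have hUfin : Module.finrank ℚ (Finsupp.supported ℚ ℚ (U : Set V)) = U.card := by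
    rw [(Finsupp.supportedEquivFinsupp (M := ℚ) (R := ℚ) (U : Set V)).finrank_eq]
    simp
  have : Module.Finite ℚ (Finsupp.supported ℚ ℚ (U : Set V)) :=
    Module.Finite.equiv (Finsupp.supportedEquivFinsupp (M := ℚ) (R := ℚ) (U : Set V)).symm
  have h1 := LinearMap.finrank_range_add_finrank_ker g
  have h2 : Module.finrank ℚ (LinearMap.range g) ≤ U.card := by
    rw [← hUfin]
    exact Submodule.finrank_mono hrange
  have h3 : Module.finrank ℚ (LinearMap.ker g) ≤ G.betti := by
    let i : LinearMap.ker g →ₗ[ℚ] LinearMap.ker G.chainBoundary :=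
      { toFun := fun x => ⟨x.1.1, x.2⟩
        map_add' := fun _ _ => rfl
        map_smul' := fun _ _ => rfl }
    apply LinearMap.finrank_le_finrank_of_injective (f := i)
    intro x y h
    exact Subtype.ext (Subtype.ext (congrArg (fun z : LinearMap.ker G.chainBoundary => (z : E →₀ ℚ)) h))
  omega

/-- The Betti number by Euler's formula, from a labelling of the connected components. -/
theorem DGraph.betti_eq [Fintype V] [Fintype E] {c : ℕ} (lab : V → Fin c)
    (hsurj : Function.Surjective lab) (hedge : ∀ e, lab (G.o e) = lab (G.t e))
    (hconn : ∀ v w, lab v = lab w →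
      Finsupp.single v (1 : ℚ) - Finsupp.single w 1 ∈ LinearMap.range G.chainBoundary) :
    G.betti + Fintype.card V = Fintype.card E + c := by
  classical
  let ρ : (V →₀ ℚ) →ₗ[ℚ] (Fin c →₀ ℚ) := Finsupp.lmapDomain ℚ ℚ lab
  have hρs : Function.Surjective ρ := Finsupp.mapDomain_surjective hsurj
  have hker : LinearMap.ker ρ = LinearMap.range G.chainBoundary := by
    apply le_antisymm
    · obtain ⟨rep, hrep⟩ := hsurj.hasRightInverse
      intro x hx
      have hx' : Finsupp.mapDomain (rep ∘ lab) x = 0 := by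
        have : Finsupp.mapDomain lab x = 0 := hx
        rw [Finsupp.mapDomain_comp, this, Finsupp.mapDomain_zero]
      -- Modulo boundaries a vertex equals the chosen representative of its label, so a chain killed
      -- by `ρ` is a boundary.
      have key : ∀ x : V →₀ ℚ,
          x - Finsupp.mapDomain (rep ∘ lab) x ∈ LinearMap.range G.chainBoundary := by
        intro x
        induction x using Finsupp.induction_linear with
        | zero => simp
        | add f g hf hg =>
          rw [Finsupp.mapDomain_add, add_sub_add_comm]
          exact Submodule.add_mem _ hf hg
        | single v b =>
          rw [Finsupp.mapDomain_single]
          have := Submodule.smul_mem _ b (hconn v (rep (lab v)) (hrep _).symm)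
          simpa [smul_sub] using this
      have := key x
      rwa [hx', sub_zero] at this
    · rintro _ ⟨y, rfl⟩
      induction y using Finsupp.induction_linear with
      | zero => simp
      | add f g hf hg => rw [map_add]; exact Submodule.add_mem _ hf hg
      | single e b =>
        rw [LinearMap.mem_ker, G.chainBoundary_single, map_sub]
        simp [ρ, Finsupp.mapDomain_single, hedge]
  have h1 := LinearMap.finrank_range_add_finrank_ker G.chainBoundary
  have h2 := LinearMap.finrank_range_add_finrank_ker ρ
  rw [LinearMap.range_eq_top.2 hρs, finrank_top, hker] at h2
  simp only [Module.finrank_finsupp_self, Fintype.card_fin] at h1 h2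
  change _ + G.betti = _ at h1
  omega

/-- `|E| + 1 ≤ |V| + β₁` for a nonempty graph. -/
theorem DGraph.card_edges_lt [Fintype V] [Fintype E] [Nonempty V] :
    Fintype.card E + 1 ≤ Fintype.card V + G.betti := by
  -- The augmentation kills all boundaries and is onto, so the boundary map has rank less than
  -- `|V|`.
  let s : (V →₀ ℚ) →ₗ[ℚ] ℚ := Finsupp.linearCombination ℚ fun _ => 1
  have hs : Function.Surjective s := fun q => ⟨Finsupp.single (Classical.arbitrary V) q, by
    simp [s]⟩
  have hle : LinearMap.range G.chainBoundary ≤ LinearMap.ker s := by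
    rintro _ ⟨y, rfl⟩
    induction y using Finsupp.induction_linear with
    | zero => simp
    | add f g hf hg => rw [map_add]; exact Submodule.add_mem _ hf hg
    | single e b =>
      rw [LinearMap.mem_ker, G.chainBoundary_single, map_sub]
      simp [s]
  have h1 := LinearMap.finrank_range_add_finrank_ker G.chainBoundary
  have h2 := LinearMap.finrank_range_add_finrank_ker s
  have h3 := Submodule.finrank_mono hle
  rw [LinearMap.range_eq_top.2 hs, finrank_top] at h2
  simp only [Module.finrank_finsupp_self, Module.finrank_self] at h1 h2
  change _ + G.betti = _ at h1
  omega

/-- A vertex that is not the origin of an edge has outdegree `0` and lies in the boundary. -/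
theorem DGraph.card_le_card_add_boundary [Fintype V] [Fintype E] [DecidableEq V] :
    Fintype.card V ≤ (Finset.univ.image G.o).card + G.boundary.ncard := by
  classical
  rw [← Nat.card_eq_fintype_card, ← Set.ncard_univ, ← Set.ncard_coe_finset]
  refine le_trans (Set.ncard_le_ncard ?_ (Set.toFinite _)) (Set.ncard_union_le _ _)
  intro v _
  by_cases h : G.fstar v = ∅
  · exact Or.inr (Or.inr h)
  · obtain ⟨e, he⟩ := Set.nonempty_iff_ne_empty.2 h
    left
    simp only [Finset.coe_image, Finset.coe_univ, Set.image_univ, Set.mem_range]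
    exact ⟨e, he⟩

theorem DGraph.card_vertices_le [Fintype V] [Fintype E] :
    Fintype.card V ≤ Fintype.card E + G.boundary.ncard := by
  classical
  have : (Finset.univ.image G.o).card ≤ Fintype.card E := Finset.card_image_le
  have := G.card_le_card_add_boundary
  omega

/-- This makes the parameter `m` of the time bound positive, so that costs linear in the number of
edges are absorbed by `m ^ 2 * n`. -/
theorem DGraph.betti_add_boundary_pos [Fintype V] [Fintype E] [Nonempty V] :
    0 < G.betti + G.boundary.ncard := by
  have := G.card_edges_lt
  have := G.card_vertices_le
  omega

/-- Splitting a set of edges by their origins. -/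
theorem DGraph.sum_card_fibre [DecidableEq V] (L : Finset E) (f : E → V) :
    ∑ u ∈ L.image f, (L.filter fun e => f e = u).card = L.card :=
  (Finset.card_eq_sum_card_image f L).symm

/-- There are at most `β₁ + |∂G|` more edges than origins of edges, and every origin other than `v`
accounts for at least one edge. What remains for `v` is the bound, which controls the cost of one
step of a walk. -/
theorem DGraph.outdegree_le [Fintype V] [Fintype E] [DecidableEq V] (v : V) :
    (Finset.univ.filter fun e => G.o e = v).card ≤ G.betti + G.boundary.ncard + 1 := by
  classical
  have h1 := G.card_edges_le Finset.univ Finset.univ (by simp) (by simp)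
  have h2 := G.card_le_card_add_boundary
  have h3 := DGraph.sum_card_fibre (Finset.univ : Finset E) G.o
  by_cases hv : v ∈ (Finset.univ : Finset E).image G.o
  · rw [← Finset.add_sum_erase _ _ hv] at h3
    have h4 : ((Finset.univ : Finset E).image G.o |>.erase v).card ≤
        ∑ u ∈ ((Finset.univ : Finset E).image G.o).erase v,
          (Finset.univ.filter fun e => G.o e = u).card := by
      rw [Finset.card_eq_sum_ones]
      apply Finset.sum_le_sum
      intro u hu
      obtain ⟨e, _, rfl⟩ := Finset.mem_image.1 (Finset.mem_of_mem_erase hu)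
      exact Finset.card_pos.2 ⟨e, by simp⟩
    rw [Finset.card_erase_of_mem hv] at h4
    simp only [Finset.card_univ] at h1 h3
    have := Finset.card_pos.2 ⟨v, hv⟩
    omega
  · rw [Finset.card_eq_zero.2]
    · omega
    · ext e
      simp only [Finset.mem_filter, Finset.mem_univ, true_and, Finset.notMem_empty, iff_false]
      rintro rfl
      exact hv (by simp)

/-- In a subgraph without sinks at most `2 β₁` edges leave branching vertices. -/
theorem DGraph.card_branch_le [Finite E] [DecidableEq V] (L : Finset E)
    (ht : ∀ e ∈ L, ∃ e' ∈ L, G.o e' = G.t e) :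
    (L.filter fun e => 2 ≤ (L.filter fun e' => G.o e' = G.o e).card).card ≤ 2 * G.betti := by
  classical
  have h1 := G.card_edges_le L (L.image G.o) (fun e he => Finset.mem_image_of_mem _ he)
    (fun e he => by obtain ⟨e', h, h'⟩ := ht e he; exact Finset.mem_image.2 ⟨e', h, h'⟩)
  have h2 := DGraph.sum_card_fibre L G.o
  set d : V → ℕ := fun u => (L.filter fun e' => G.o e' = u).card with hd
  have hd1 : ∀ u ∈ L.image G.o, 1 ≤ d u := by
    intro u hu
    obtain ⟨e, he, rfl⟩ := Finset.mem_image.1 hu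
    exact Finset.card_pos.2 ⟨e, by simp [he]⟩
  -- The factor `2` comes from `d ≤ 2 * (d - 1)` for `d ≥ 2`. The excesses `d - 1` add up to `|L|`
  -- minus the number of origins, which is at most `β₁` as all ends of edges of `L` are origins.
  have h3 : (L.filter fun e => 2 ≤ d (G.o e)).card ≤ ∑ u ∈ L.image G.o, 2 * (d u - 1) := by
    rw [Finset.card_eq_sum_card_fiberwise (f := G.o) (t := L.image G.o)
      (fun e he => by
        simp only [Finset.coe_filter, Set.mem_ofPred_eq] at he
        exact Finset.mem_coe.2 (Finset.mem_image_of_mem _ he.1))]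
    apply Finset.sum_le_sum
    intro u hu
    by_cases h : 2 ≤ d u
    · have : (Finset.filter (fun e => G.o e = u) (L.filter fun e => 2 ≤ d (G.o e))).card ≤ d u := by
        apply Finset.card_le_card
        intro e
        simp only [Finset.mem_filter]
        tauto
      omega
    · rw [Finset.card_eq_zero.2]
      · omega
      · ext e
        simp only [Finset.mem_filter, Finset.notMem_empty, iff_false]
        rintro ⟨⟨_, h'⟩, rfl⟩
        exact h h'
  have h4 : ∑ u ∈ L.image G.o, (d u - 1) + (L.image G.o).card = L.card := by
    rw [← h2, Finset.card_eq_sum_ones, ← Finset.sum_add_distrib]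
    apply Finset.sum_congr rfl
    intro u hu
    have := hd1 u hu
    simp only [hd] at this ⊢
    omega
  rw [← Finset.mul_sum] at h3
  simp only [hd] at h3 h4 ⊢
  omega

/-- In a subgraph without sinks and sources at most `β₁` vertices have two incoming edges. -/
theorem DGraph.card_inbranch_le [Finite E] [DecidableEq V] (L : Finset E)
    (ht : ∀ e ∈ L, ∃ e' ∈ L, G.t e' = G.o e) (M : Finset V)
    (hM : ∀ u ∈ M, ∃ e ∈ L, ∃ e' ∈ L, e ≠ e' ∧ G.t e = u ∧ G.t e' = u) :
    M.card ≤ G.betti := by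
  classical
  have h1 := G.card_edges_le L (L.image G.t)
    (fun e he => by obtain ⟨e', h, h'⟩ := ht e he; exact Finset.mem_image.2 ⟨e', h, h'⟩)
    (fun e he => Finset.mem_image_of_mem _ he)
  have h2 := DGraph.sum_card_fibre L G.t
  -- Count `L` by targets: every target receives one edge, and those in `M` at least one more.
  have h3 : (L.image G.t).card + M.card ≤ L.card := by
    have hsub : M ⊆ L.image G.t := by
      intro u hu
      obtain ⟨e, he, _, _, _, h, _⟩ := hM u hu
      exact Finset.mem_image.2 ⟨e, he, h⟩
    have h5 : M.card = ∑ u ∈ L.image G.t, if u ∈ M then 1 else 0 := by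
      rw [Finset.sum_ite_mem, Finset.inter_eq_right.2 hsub, Finset.card_eq_sum_ones]
    rw [← h2, h5, Finset.card_eq_sum_ones, ← Finset.sum_add_distrib]
    apply Finset.sum_le_sum
    intro u hu
    split_ifs with h
    · obtain ⟨e, he, e', he', hne, rfl, h'⟩ := hM u h
      have : ({e, e'} : Finset E) ⊆ L.filter fun x => G.t x = G.t e := by
        intro x hx
        rcases Finset.mem_insert.1 hx with rfl | hx
        · simp [he]
        · rw [Finset.mem_singleton.1 hx]; simp [he', h']
      have := Finset.card_le_card this
      rwa [Finset.card_pair hne] at this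
    · obtain ⟨e, he, rfl⟩ := Finset.mem_image.1 hu
      exact Finset.card_pos.2 ⟨e, by simp [he]⟩
  omega

end Betti

/-! ## Long cycles run through long segments -/

section Segments

variable {V E V' E' : Type*} {Γ : DGraph V E} {Δ : DGraph V' E'}

/-- `c` is the last position up to `P` with property `C`. -/
def IsLast (C : ℕ → Prop) (P c : ℕ) : Prop := c ≤ P ∧ C c ∧ ∀ x, c < x → x ≤ P → ¬ C x

theorem IsLast.exists {C : ℕ → Prop} {P i : ℕ} (hi : C i) (hiP : i ≤ P) : ∃ c, IsLast C P c := by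
  classical
  refine ⟨Nat.findGreatest C P, Nat.findGreatest_le P, Nat.findGreatest_spec hiP hi, ?_⟩
  intro x hx hxP
  exact Nat.findGreatest_is_greatest hx hxP

/-- Paths that carry the same edge agree until the next edge at which they can branch. -/
theorem IsPath.eq_of_run {F : ℕ → E} (hF : IsPath Γ F) {S : Set E}
    (huniq : ∀ i j, F i ∉ S → Γ.o (F j) = Γ.o (F i) → F j = F i) {c c' : ℕ} (h0 : F c' = F c) :
    ∀ n, (∀ t, 0 < t → t ≤ n → F (c + t) ∉ S) → F (c' + n) = F (c + n) := by
  intro n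
  induction n with
  | zero => intro _; exact h0
  | succ n ih =>
    intro h
    have h1 := ih fun t ht htn => h t ht (by omega)
    refine huniq _ _ (h (n + 1) (by omega) le_rfl) ?_
    rw [← add_assoc, ← add_assoc, ← hF, ← hF, h1]

/-- A long cycle contains a start edge that is followed by no other start edge for two periods. -/
theorem exists_long_run [Fintype E] [LinearOrder E'] {γ : Hom Γ Δ} (hγ : γ.IsForwardsImmersion)
    {F : ℕ → E} (hF : IsPath Γ F) (hper : 0 < per F) (S : Finset E)
    (huniq : ∀ i j, F i ∉ S → Γ.o (F j) = Γ.o (F i) → F j = F i)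
    (hcard : S.card ≤ 3 * Γ.betti) (hmeet : ∃ i, F i ∈ S)
    (hlong : 12 * Γ.betti * per (fun i => γ.onE (F i)) ≤ per F) :
    (∃ c, F c ∈ S ∧ ∀ t, 0 < t → t < 2 * per (fun i => γ.onE (F i)) → F (c + t) ∉ S) ∧
      2 * per F ≤ 3 * Fintype.card E := by
  classical
  set a : ℕ → E' := fun i => γ.onE (F i) with ha
  set k := per F with hk
  set q := per a with hq
  have hF' : ∀ i, F (i + k) = F i := per_spec F
  have hqk : q ∣ k := per_comp_dvd γ.onE
  have hq0 : 0 < q := Nat.pos_of_dvd_of_pos hqk hper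
  obtain ⟨d, hd⟩ := hqk
  have hβ : 1 ≤ Γ.betti := by
    obtain ⟨i, hi⟩ := hmeet
    have := Finset.card_pos.2 ⟨_, hi⟩
    omega
  have hd12 : 12 * Γ.betti ≤ d := by
    have : q * (12 * Γ.betti) ≤ q * d := by rw [← hd, mul_comm]; exact hlong
    exact Nat.le_of_mul_le_mul_left this hq0
  -- cut edges
  let inb : E → Prop := fun x => ∃ i j, F i ≠ F j ∧ Γ.t (F i) = Γ.o x ∧ Γ.t (F j) = Γ.o x
  let C : E → Prop := fun x => x ∈ S ∨ inb x
  let K : Finset E := Finset.univ.filter fun x => C x ∧ ∃ i, F i = x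
  -- There are at most `3 β₁` start edges. A cut edge that is not a start edge is determined by its
  -- origin, where two edges of the cycle merge, and there are at most `β₁` such vertices.
  have hK : K.card ≤ 4 * Γ.betti := by
    let L : Finset E := Finset.univ.filter fun x => ∃ i, F i = x
    let I : Finset E := Finset.univ.filter fun x => (inb x ∧ x ∉ S) ∧ ∃ i, F i = x
    have hI : (I.image Γ.o).card ≤ Γ.betti := by
      apply Γ.card_inbranch_le L
      · intro e he
        obtain ⟨i, rfl⟩ := (Finset.mem_filter.1 he).2
        refine ⟨F (i + (k - 1)), by simp [L], ?_⟩
        rw [hF, ← hF' i]; congr 2; omega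
      · intro u hu
        obtain ⟨x, hx, rfl⟩ := Finset.mem_image.1 hu
        obtain ⟨⟨⟨i, j, hij, h1, h2⟩, _⟩, _⟩ := (Finset.mem_filter.1 hx).2
        exact ⟨F i, by simp [L], F j, by simp [L], hij, h1, h2⟩
    rw [Finset.card_image_of_injOn] at hI
    · have : K ⊆ S ∪ I := by
        intro x hx
        obtain ⟨hC, hr⟩ := (Finset.mem_filter.1 hx).2
        by_cases hxS : x ∈ S
        · exact Finset.mem_union_left _ hxS
        · exact Finset.mem_union_right _
            (by simpa [I] using ⟨⟨hC.resolve_left hxS, hxS⟩, hr⟩)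
      have := Finset.card_le_card this
      have := Finset.card_union_le S I
      omega
    · intro x hx y hy hxy
      obtain ⟨⟨_, hxS⟩, i, rfl⟩ := (Finset.mem_filter.1 (Finset.mem_coe.1 hx)).2
      obtain ⟨⟨_, hyS⟩, j, rfl⟩ := (Finset.mem_filter.1 (Finset.mem_coe.1 hy)).2
      exact (huniq i j hxS hxy.symm).symm
  have hCmod : ∃ i < k, C (F i) := by
    obtain ⟨i, hi⟩ := hmeet
    exact ⟨i % k, Nat.mod_lt _ hper, Or.inl (by rwa [apply_mod hF'])⟩
  have hlast : ∀ P, k ≤ P → ∃ c, IsLast (fun x => C (F x)) P c := by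
    obtain ⟨i, hi, hC⟩ := hCmod
    intro P hP
    exact IsLast.exists hC (by omega)
  choose! lc hlc using hlast
  -- going back from equal edges
  have hback : ∀ n P P', n ≤ P → n ≤ P' → (∀ t < n, ¬ C (F (P - t))) → F P = F P' →
      F (P - n) = F (P' - n) := by
    intro n
    induction n with
    | zero => intro P P' _ _ _ h; exact h
    | succ n ih =>
      intro P P' hP hP' hn h
      have h1 := ih P P' (by omega) (by omega) (fun t ht => hn t (by omega)) h
      have h2 := hn n (by omega)
      by_contra hne
      apply h2
      refine Or.inr ⟨P - (n + 1), P' - (n + 1), hne, ?_, ?_⟩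
      · rw [hF]; congr 2; omega
      · rw [hF, h1]; congr 2; omega
  -- Going backwards from an edge the cycle is forced until a cut edge is reached. So an edge alone
  -- determines the last cut edge before it and the distance to it.
  have hparse : ∀ P P', k ≤ P → k ≤ P' → F P = F P' →
      P - lc P = P' - lc P' ∧ F (lc P) = F (lc P') := by
    have main : ∀ P P', k ≤ P → k ≤ P' → F P = F P' → P - lc P ≤ P' - lc P' →
        P - lc P = P' - lc P' ∧ F (lc P) = F (lc P') := by
      intro P P' hP hP' h hle
      obtain ⟨h1, h2, h3⟩ := hlc P hP
      obtain ⟨h1', h2', h3'⟩ := hlc P' hP'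
      have h4 := hback (P - lc P) P P' (by omega) (by omega)
        (fun t ht => h3 _ (by omega) (by omega)) h
      have e1 : P - (P - lc P) = lc P := by omega
      rw [e1] at h4
      have e2 : P - lc P = P' - lc P' := by
        by_contra hne
        apply h3' (P' - (P - lc P)) (by omega) (by omega)
        rw [← h4]; exact h2
      refine ⟨e2, ?_⟩
      rw [h4, e2]; congr 1; omega
    intro P P' hP hP' h
    rcases le_total (P - lc P) (P' - lc P') with hle | hle
    · exact main P P' hP hP' h hle
    · have := main P' P hP' hP h.symm hle
      exact ⟨this.1.symm, this.2.symm⟩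
  -- a critical residue
  obtain ⟨r, hr, hcrit⟩ := exists_critical (a := a) hq0
  -- Behind a common cut edge the two runs agree, as no start edge intervenes. If the distances `i -
  -- lc i` and `j - lc j` differ by `ℓ` with `0 < ℓ < q`, the labels around `j` form a square of a
  -- word of length `ℓ`, which is excluded at the critical residue. So the distances are equal, and
  -- so are the edges.
  have hsep : ∀ i j, k ≤ i → k ≤ j → i % q = r → j % q = r → F (lc i) = F (lc j) →
      i - lc i ≤ j - lc j → j - lc j < i - lc i + q → F i = F j := by
    intro i j hi hj hir hjr hkey hle hlt
    obtain ⟨h1, h2, h3⟩ := hlc i hi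
    obtain ⟨h1', h2', h3'⟩ := hlc j hj
    have hrun : ∀ n, n ≤ j - lc j → F (lc i + n) = F (lc j + n) := fun n hn =>
      hF.eq_of_run (S := S) huniq hkey n fun t ht htn hS =>
        h3' (lc j + t) (by omega) (by omega) (Or.inl hS)
    by_cases heq : i - lc i = j - lc j
    · have h4 := hrun (i - lc i) hle
      have e1 : lc i + (i - lc i) = i := by omega
      have e2 : lc j + (i - lc i) = j := by omega
      rwa [e1, e2] at h4
    · exfalso
      obtain ⟨t, ht, hne⟩ := hcrit j (j - lc j - (i - lc i)) hjr (by omega) (by omega) (by omega)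
      apply hne
      have h4 := hrun (i - lc i + t) (by omega)
      have e1 : lc i + (i - lc i + t) = i + t := by omega
      have e2 : lc j + (i - lc i + t) = j - (j - lc j - (i - lc i)) + t := by omega
      rw [e1, e2] at h4
      have h5 : a (i + t) = a (j + t) := by
        rw [← apply_mod (per_spec a) (i + t), ← apply_mod (per_spec a) (j + t)]
        congr 1
        change (i + t) ≡ (j + t) [MOD q]
        exact Nat.ModEq.add_right t (hir.trans hjr.symm)
      rw [← h5, ha]
      simp only [h4]
  -- The critical positions in one turn of the cycle. The shift by `2 * k` leaves room to step back
  -- fewer than `q ≤ k` positions and still have a cut position before.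
  let P : ℕ → ℕ := fun i => 2 * k + r + i * q
  have hPk : ∀ i, k ≤ P i := fun i => by simp only [P]; omega
  have hPr : ∀ i, P i % q = r := by
    intro i
    have : P i = r + q * (2 * d + i) := by simp only [P, hd]; ring
    rw [this, Nat.add_mul_mod_self_left, Nat.mod_eq_of_lt hr]
  -- Equal edges at positions congruent modulo `q` are a full turn of length `d * q` apart.
  have hPinj : ∀ i j, i < d → j < d → F (P i) = F (P j) → i = j := by
    have main : ∀ i j, i ≤ j → j < d → F (P i) = F (P j) → i = j := by
      intro i j hij hj h
      by_contra hne
      have e : P j = P i + (j - i) * q := by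
        obtain ⟨s, rfl⟩ := Nat.exists_eq_add_of_le hij
        simp only [P, Nat.add_sub_cancel_left]; ring
      rw [e] at h
      have h1 : k ∣ (j - i) * q := hγ.per_dvd_sub hF hper (q := q) (per_spec a) (by rw [h])
        (Dvd.intro_left _ rfl)
      have h2 := Nat.le_of_dvd (Nat.mul_pos (by omega) hq0) h1
      rw [hd, mul_comm] at h2
      have := Nat.le_of_mul_le_mul_right h2 hq0
      omega
    intro i j hi hj h
    rcases le_total i j with hle | hle
    · exact main i j hle hj h
    · exact (main j i hle hi h.symm).symm
  have hinj : ∀ i j, i < d → j < d → F (lc (P i)) = F (lc (P j)) →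
      (P i - lc (P i)) / q = (P j - lc (P j)) / q → i = j := by
    intro i j hi hj hkey hoff
    apply hPinj i j hi hj
    have m1 := Nat.div_add_mod (P i - lc (P i)) q
    have m2 := Nat.div_add_mod (P j - lc (P j)) q
    have l1 := Nat.mod_lt (P i - lc (P i)) hq0
    have l2 := Nat.mod_lt (P j - lc (P j)) hq0
    rw [hoff] at m1
    rcases le_total (P i - lc (P i)) (P j - lc (P j)) with hle | hle
    · exact hsep _ _ (hPk i) (hPk j) (hPr i) (hPr j) hkey hle (by omega)
    · exact (hsep _ _ (hPk j) (hPk i) (hPr j) (hPr i) hkey.symm hle (by omega)).symm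
  have hkeyK : ∀ i, F (lc (P i)) ∈ K := fun i => by
    simp only [K, Finset.mem_filter, Finset.mem_univ, true_and]
    exact ⟨(hlc _ (hPk i)).2.1, _, rfl⟩
  constructor
  · have : ∃ i < d, 2 * q ≤ P i - lc (P i) := by
      by_contra! hno
      have hle : (Finset.range d).card ≤ (K ×ˢ Finset.range 2).card := by
        apply Finset.card_le_card_of_injOn (fun i => (F (lc (P i)), (P i - lc (P i)) / q))
        · intro i hi
          have hi' : i < d := by simpa using hi
          have := hno i hi'
          simp only [Finset.coe_product, Set.mem_prod, Finset.mem_coe, hkeyK, true_and,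
            Finset.mem_range]
          rw [Nat.div_lt_iff_lt_mul hq0]; exact this
        · intro i hi j hj hij
          have hi' : i < d := by simpa using hi
          have hj' : j < d := by simpa using hj
          simp only [Prod.mk.injEq] at hij
          exact hinj i j hi' hj' hij.1 hij.2
      simp only [Finset.card_range, Finset.card_product] at hle
      omega
    obtain ⟨i, hi, hoff⟩ := this
    obtain ⟨i0, hi0⟩ := hmeet
    obtain ⟨c, hc1, hc2, hc3⟩ := IsLast.exists (C := fun x => F x ∈ S) (P := P i) (i := i0 % k)
      (by simp only [apply_mod hF']; exact hi0)
      (by have := Nat.mod_lt i0 hper; have := hPk i; omega)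
    obtain ⟨h1, h2, h3⟩ := hlc _ (hPk i)
    -- Start edges are cut edges, so passing from the last cut to the last start edge only lengthens
    -- the run.
    have hcl : c ≤ lc (P i) := by
      by_contra hlt
      exact h3 c (by omega) hc1 (Or.inl hc2)
    exact ⟨c, hc2, fun t ht ht2 => hc3 (c + t) (by omega) (by omega)⟩
  · let S1 := (Finset.range d).filter fun i => P i - lc (P i) < q
    let S2 := (Finset.range d).filter fun i => ¬ (P i - lc (P i) < q)
    have hS12 : S1.card + S2.card = d :=
      (Finset.card_filter_add_card_filter_not (s := Finset.range d)
        (fun i => P i - lc (P i) < q)).trans (Finset.card_range d)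
    have hS1 : S1.card ≤ K.card := by
      apply Finset.card_le_card_of_injOn (fun i => F (lc (P i)))
      · intro i _; exact hkeyK i
      · intro i hi j hj hij
        have hi' := Finset.mem_filter.1 (Finset.mem_coe.1 hi)
        have hj' := Finset.mem_filter.1 (Finset.mem_coe.1 hj)
        apply hinj i j (by simpa using hi'.1) (by simpa using hj'.1) hij
        rw [Nat.div_eq_of_lt hi'.2, Nat.div_eq_of_lt hj'.2]
    -- A critical position at distance at least `q` from its cut owns the `q` edges that end there.
    -- These are different for different positions and steps, because an edge determines its cut
    -- edge and its distance.
    have hS2 : (S2 ×ˢ Finset.range q).card ≤ (Finset.univ : Finset E).card := by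
      apply Finset.card_le_card_of_injOn (fun x => F (P x.1 - x.2))
      · intro _ _; exact Finset.mem_coe.2 (Finset.mem_univ _)
      · have hsub : ∀ i t, q ≤ P i - lc (P i) → t < q → k ≤ P i - t ∧ lc (P i - t) = lc (P i) := by
          intro i t hi ht
          have hkt : k ≤ P i - t := by
            have : q ≤ k := Nat.le_of_dvd hper ⟨d, hd⟩
            simp only [P]; omega
          refine ⟨hkt, ?_⟩
          obtain ⟨h1, h2, h3⟩ := hlc _ (hPk i)
          obtain ⟨h1', h2', h3'⟩ := hlc _ hkt
          rcases lt_trichotomy (lc (P i - t)) (lc (P i)) with h | h | h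
          · exact absurd h2 (h3' _ h (by omega))
          · exact h
          · exact absurd h2' (h3 _ h (by omega))
        rintro ⟨i, t⟩ hi ⟨j, t'⟩ hj hij
        have hi' := Finset.mem_product.1 (Finset.mem_coe.1 hi)
        have hj' := Finset.mem_product.1 (Finset.mem_coe.1 hj)
        simp only [S2, Finset.mem_filter, Finset.mem_range, not_lt] at hi' hj' hij
        obtain ⟨a1, a2⟩ := hsub i t hi'.1.2 hi'.2
        obtain ⟨b1, b2⟩ := hsub j t' hj'.1.2 hj'.2
        obtain ⟨c1, c2⟩ := hparse _ _ a1 b1 hij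
        rw [a2, b2] at c1 c2
        have hij' : i = j := by
          apply hPinj i j hi'.1.1 hj'.1.1
          rcases le_total (P i - lc (P i)) (P j - lc (P j)) with hle | hle
          · exact hsep _ _ (hPk i) (hPk j) (hPr i) (hPr j) c2 hle (by omega)
          · exact (hsep _ _ (hPk j) (hPk i) (hPr j) (hPr i) c2.symm hle (by omega)).symm
        subst hij'
        congr 1
        have := hi'.1.2
        omega
    rw [Finset.card_product, Finset.card_range, Finset.card_univ] at hS2
    -- At most `4 β₁ ≤ d / 3` critical positions are closer than `q` to their cut; here the constant
    -- `12` is used in full.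
    have h6 : 2 * d ≤ 3 * S2.card := by omega
    calc 2 * k = 2 * d * q := by rw [hd]; ring
      _ ≤ 3 * S2.card * q := Nat.mul_le_mul_right _ h6
      _ = 3 * (S2.card * q) := by ring
      _ ≤ _ := Nat.mul_le_mul_left _ hS2

end Segments

/-! ## Cycles as periodic paths -/

section Circle

variable {V E V' E' : Type*} {Γ : DGraph V E} {Δ : DGraph V' E'}

theorem Hom.ext_onE {k : ℕ} {f g : Hom (circle k) Γ} (h : ∀ x, f.onE x = g.onE x) : f = g := by
  have h1 : f.onE = g.onE := funext h
  have h2 : f.onV = g.onV := by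
    funext x
    have a := f.map_o x
    have b := g.map_o x
    simp only [circle] at a b
    rw [a, b, h]
  exact Hom.ext h2 h1

/-- The closed path of a cycle. -/
def Hom.seq {k : ℕ} (f : Hom (circle k) Γ) : ℕ → E := fun i => f.onE (i : ZMod k)

theorem Hom.seq_isPath {k : ℕ} (f : Hom (circle k) Γ) : IsPath Γ f.seq := by
  intro i
  simp only [Hom.seq]
  rw [← f.map_t, ← f.map_o]
  simp [circle]

theorem Hom.seq_add {k : ℕ} (f : Hom (circle k) Γ) (i : ℕ) : f.seq (i + k) = f.seq i := by
  simp [Hom.seq]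

theorem Hom.seq_val {k : ℕ} [NeZero k] (f : Hom (circle k) Γ) (x : ZMod k) :
    f.seq x.val = f.onE x := by
  simp [Hom.seq]

/-- The cycle of a closed path. -/
def cycleOf (F : ℕ → E) (hF : IsPath Γ F) (k : ℕ) [NeZero k] (hk : ∀ i, F (i + k) = F i) :
    Hom (circle k) Γ where
  onV x := Γ.o (F x.val)
  onE x := F x.val
  map_o _ := rfl
  map_t x := by
    simp only [circle]
    rw [hF, ZMod.val_add, ← apply_mod hk (x.val + 1)]
    congr 2
    rw [ZMod.val_one_eq_one_mod]
    simp

theorem circle_onE_eq_onV {k l : ℕ} (p : Hom (circle k) (circle l)) (x : ZMod k) :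
    p.onE x = p.onV x := (p.map_o x).symm

theorem circle_onV_natCast {k l : ℕ} (p : Hom (circle k) (circle l)) (n : ℕ) :
    p.onV (n : ZMod k) = p.onV 0 + n := by
  induction n with
  | zero => simp
  | succ n ih =>
    have h := p.map_t (n : ZMod k)
    simp only [circle, circle_onE_eq_onV] at h
    push_cast
    rw [h, ih, add_assoc]

/-- Graph maps of circles commute with the step to the next vertex, and `k` steps lead back to the
beginning. -/
theorem circle_dvd {k l : ℕ} (p : Hom (circle k) (circle l)) : l ∣ k := by
  have h := circle_onV_natCast p k
  rw [ZMod.natCast_self] at h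
  exact (ZMod.natCast_eq_zero_iff k l).1 (by simpa using h.symm)

theorem seq_comp_circle {k l : ℕ} (p : Hom (circle k) (circle l)) (g : Hom (circle l) Γ) (i : ℕ) :
    (g.comp p).seq i = g.onE (p.onV 0 + i) := by
  simp only [Hom.seq, Hom.comp, Function.comp_apply, circle_onE_eq_onV, circle_onV_natCast]

theorem seq_comp_circle_period {k l : ℕ} (p : Hom (circle k) (circle l)) (g : Hom (circle l) Γ)
    (i : ℕ) : (g.comp p).seq (i + l) = (g.comp p).seq i := by
  simp [seq_comp_circle]

theorem circle_fibres {k l d : ℕ} [NeZero k] [NeZero l] (q : ZMod k → ZMod l)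
    (hd : ∀ v, (q ⁻¹' {v}).ncard = d) : d * l = k := by
  classical
  have h := Finset.card_eq_sum_card_fiberwise (f := q) (s := Finset.univ)
    (t := Finset.univ) (fun _ _ => Finset.mem_coe.2 (Finset.mem_univ _))
  have h2 : ∀ v, (Finset.univ.filter fun x => q x = v).card = d := by
    intro v
    rw [← hd v, ← Set.ncard_coe_finset]
    congr 1
    ext x; simp
  simp only [h2, Finset.sum_const, Finset.card_univ, ZMod.card, smul_eq_mul] at h
  rw [mul_comm]; exact h.symm

/-- The covering map of circles of lengths `l ∣ k`. -/
def circleCover {k l : ℕ} (h : l ∣ k) : Hom (circle k) (circle l) where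
  onV := ZMod.castHom h (ZMod l)
  onE := ZMod.castHom h (ZMod l)
  map_o _ := rfl
  map_t x := by
    change ZMod.castHom h (ZMod l) (x + 1) = ZMod.castHom h (ZMod l) x + 1
    rw [map_add, map_one]

theorem circleCover_isCovering {k l : ℕ} [NeZero k] [NeZero l] (h : l ∣ k) :
    (circleCover h).IsCoveringOfDegree (k / l) := by
  have hf : ∀ (n : ℕ) (v : ZMod n), (circle n).fstar v = {v} := by
    intro n v; ext x; simp [DGraph.fstar, circle]
  have hb : ∀ (n : ℕ) (v : ZMod n), (circle n).bstar v = {v - 1} := by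
    intro n v; ext x; simp [DGraph.bstar, circle, eq_sub_iff_add_eq]
  refine ⟨fun v => ?_, fun v => ?_, fun v => ?_⟩
  · rw [hf, hf, Set.bijOn_singleton]; rfl
  · rw [hb, hb, Set.bijOn_singleton]
    change ZMod.castHom h (ZMod l) (v - 1) = ZMod.castHom h (ZMod l) v - 1
    rw [map_sub, map_one]
  · have hs : Function.Surjective (ZMod.castHom h (ZMod l)) := ZMod.castHom_surjective h
    -- The fibres are translates of each other, so their common size follows by counting.
    have hc : ∀ w, ((circleCover h).onV ⁻¹' {w}).ncard = ((circleCover h).onV ⁻¹' {v}).ncard := by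
      intro w
      obtain ⟨x, hx⟩ := hs (w - v)
      rw [← Set.ncard_image_of_injective ((circleCover h).onV ⁻¹' {v}) (add_right_injective x)]
      congr 1
      ext z
      simp only [circleCover, Set.mem_preimage, Set.mem_singleton_iff, Set.mem_image]
      constructor
      · intro hz
        exact ⟨z - x, by rw [map_sub, hz, hx]; ring, by ring⟩
      · rintro ⟨z, hz, rfl⟩
        rw [map_add, hz, hx]; ring
    have := circle_fibres _ hc
    exact (Nat.div_eq_of_eq_mul_left (Nat.pos_of_ne_zero (NeZero.ne l)) this.symm).symm

theorem bddAbove_degree {k : ℕ} (hk : 0 < k) (f : Hom (circle k) Γ) :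
    BddAbove {d | ∃ l, 0 < l ∧ ∃ (p : Hom (circle k) (circle l)) (g : Hom (circle l) Γ),
      p.IsCoveringOfDegree d ∧ g.comp p = f} := by
  refine ⟨k, ?_⟩
  rintro d ⟨l, hl, p, g, hp, -⟩
  have : NeZero k := ⟨hk.ne'⟩
  have : NeZero l := ⟨hl.ne'⟩
  have := circle_fibres p.onV hp.2.2
  exact Nat.le_of_dvd hk (Dvd.intro _ this)

/-- A period `l` dividing `k` lets the cycle descend to the circle of length `l`. -/
theorem le_degree {k : ℕ} (hk : 0 < k) (f : Hom (circle k) Γ) {l : ℕ} (hl : l ∣ k)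
    (h : ∀ i, f.seq (i + l) = f.seq i) : k / l ≤ degree f := by
  have : NeZero k := ⟨hk.ne'⟩
  have hl0 : 0 < l := Nat.pos_of_dvd_of_pos hl hk
  have : NeZero l := ⟨hl0.ne'⟩
  apply le_csSup (bddAbove_degree hk f)
  refine ⟨l, hl0, circleCover hl, cycleOf f.seq f.seq_isPath l h, circleCover_isCovering hl, ?_⟩
  apply Hom.ext_onE
  intro x
  simp only [Hom.comp, Function.comp_apply, cycleOf, circleCover]
  rw [← f.seq_val x, ZMod.castHom_apply, ZMod.cast_eq_val, ZMod.val_natCast, apply_mod h]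

/-- The supremum is attained, the set of degrees being nonempty and bounded, and a factorisation
through a circle of length `l` makes `l` a period. -/
theorem degree_spec {k : ℕ} (hk : 0 < k) (f : Hom (circle k) Γ) :
    ∃ l, 0 < l ∧ degree f * l = k ∧ ∀ i, f.seq (i + l) = f.seq i := by
  have : NeZero k := ⟨hk.ne'⟩
  have hne : {d | ∃ l, 0 < l ∧ ∃ (p : Hom (circle k) (circle l)) (g : Hom (circle l) Γ),
      p.IsCoveringOfDegree d ∧ g.comp p = f}.Nonempty := by
    refine ⟨k / k, k, hk, circleCover dvd_rfl, f, circleCover_isCovering dvd_rfl, ?_⟩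
    apply Hom.ext_onE
    intro x
    simp [Hom.comp, circleCover]
  obtain ⟨l, hl, p, g, hp, hf⟩ := Nat.sSup_mem hne (bddAbove_degree hk f)
  have : NeZero l := ⟨hl.ne'⟩
  refine ⟨l, hl, circle_fibres p.onV hp.2.2, fun i => ?_⟩
  rw [← hf, seq_comp_circle_period]

/-- The length of a circle through which `f` factors is a divisor of `k` and a period, hence equals
`k`; and maps between circles of the same length are rotations. -/
theorem isPrimitive_of_per {k : ℕ} (hk : 0 < k) (f : Hom (circle k) Γ) (h : per f.seq = k) :
    IsPrimitive f := by
  intro l hl p g hf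
  have h1 := circle_dvd p
  have h2 : k ∣ l := by
    rw [← h]
    apply per_dvd
    intro i
    rw [← hf, seq_comp_circle_period]
  obtain rfl := Nat.dvd_antisymm h1 h2
  have : NeZero l := ⟨hk.ne'⟩
  have hV : p.onV = fun x => p.onV 0 + x := by
    funext x
    have := circle_onV_natCast p x.val
    simpa using this
  have hb : Function.Bijective p.onV := by
    rw [hV]; exact (Equiv.addLeft (p.onV 0)).bijective
  have hE : p.onE = p.onV := funext (circle_onE_eq_onV p)
  exact ⟨hb, hE ▸ hb⟩

/-- A closed path that is a long cycle of `γ`, up to rotation and iteration. -/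
structure IsLong (γ : Hom Γ Δ) (F : ℕ → E) : Prop where
  isPath : IsPath Γ F
  per_pos : 0 < per F
  long : 12 * Γ.betti * per (fun i => γ.onE (F i)) ≤ per F

/-- If `f` runs `a` times through its minimal period, then `degree f` is at least `a`, while `degree
(γ.comp f)` is `k` divided by some period of the labels. Cancelling `a` turns the condition on
degrees into one on minimal periods. -/
theorem isLong_seq (γ : Hom Γ Δ) {k : ℕ} (hk : 0 < k) (f : Hom (circle k) Γ)
    (h : 12 * Γ.betti * degree f ≤ degree (γ.comp f)) : IsLong γ f.seq := by
  have hp := LongCycles.per_pos hk f.seq_add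
  refine ⟨f.seq_isPath, hp, ?_⟩
  obtain ⟨l, hl, hlk, hper⟩ := degree_spec hk (γ.comp f)
  obtain ⟨a, ha⟩ := per_dvd f.seq_add
  have h1 := le_degree hk f (per_dvd f.seq_add) (per_spec _)
  have h2 : per (fun i => γ.onE (f.seq i)) ≤ l := Nat.le_of_dvd hl (per_dvd hper)
  have ha0 : 0 < a := by
    rcases Nat.eq_zero_or_pos a with rfl | h0
    · simp at ha; omega
    · exact h0
  have h3 : k / per f.seq = a := Nat.div_eq_of_eq_mul_right hp ha
  rw [h3] at h1
  have h4 : a * (12 * Γ.betti * l) ≤ a * per f.seq := by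
    calc a * (12 * Γ.betti * l) = 12 * Γ.betti * a * l := by ring
      _ ≤ 12 * Γ.betti * degree f * l := by gcongr
      _ ≤ degree (γ.comp f) * l := by gcongr
      _ = a * per f.seq := by rw [hlk, mul_comm]; exact ha
  exact le_trans (Nat.mul_le_mul_left _ h2) (Nat.le_of_mul_le_mul_left h4 ha0)

end Circle

/-! ## The graph of long cycles -/

section Assemble

variable {V E V' E' : Type*} {Γ : DGraph V E} {Δ : DGraph V' E'}

/-- Consecutive intervals of lengths `len i` partition `{0, …, off r - 1}`. -/
theorem exists_interval {r : ℕ} (off len : ℕ → ℕ) (h0 : off 0 = 0)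
    (hs : ∀ j, j < r → off (j + 1) = off j + len j) (i : ℕ) (hi : i < off r) :
    ∃ j u, j < r ∧ u < len j ∧ i = off j + u := by
  induction r with
  | zero => omega
  | succ r ih =>
    by_cases h : i < off r
    · obtain ⟨j, u, hj, hu⟩ := ih (fun j hj => hs j (by omega)) h
      exact ⟨j, u, by omega, hu⟩
    · have := hs r (by omega)
      exact ⟨r, i - off r, by omega, by omega, by omega⟩

theorem off_le {r : ℕ} (off len : ℕ → ℕ)
    (hs : ∀ j, j < r → off (j + 1) = off j + len j) {i j : ℕ} (hij : i < j) (hj : j ≤ r) :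
    off i + len i ≤ off j := by
  induction j with
  | zero => omega
  | succ j ih =>
    have := hs j (by omega)
    rcases Nat.lt_succ_iff_lt_or_eq.1 hij with h | rfl
    · have := ih h (by omega)
      omega
    · omega

theorem interval_unique {r : ℕ} (off len : ℕ → ℕ)
    (hs : ∀ j, j < r → off (j + 1) = off j + len j) {i j u w : ℕ} (hi : i < r) (hj : j < r)
    (hu : u < len i) (hw : w < len j) (h : off i + u = off j + w) : i = j := by
  rcases lt_trichotomy i j with hij | hij | hij
  · have := off_le off len hs hij hj.le
    omega
  · exact hij
  · have := off_le off len hs hij hi.le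
    omega

/-- The disjoint union of the pairwise different long cycles `y 0, …, y (r - 1)` on an interval of
numbers is the graph of long cycles. -/
theorem exists_isLongCycles (γ : Hom Γ Δ) {r : ℕ} (y : ℕ → ℕ → E) (off len : ℕ → ℕ)
    (h0 : off 0 = 0) (hs : ∀ j, j < r → off (j + 1) = off j + len j)
    (hlen : ∀ j < r, per (y j) = len j) (hr : r ≤ Γ.betti) (hlong : ∀ j < r, IsLong γ (y j))
    (hdist : ∀ i < r, ∀ j < r, ∀ c, (∀ t, y i t = y j (c + t)) → i = j)
    (hcompl : ∀ F, IsLong γ F → ∃ j < r, ∃ c, ∀ t, F t = y j (c + t)) :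
    ∃ (S : DGraph (Fin (off r)) (Fin (off r))) (s : Hom S Γ), IsLongCycles γ s ∧
      ∀ i : Fin (off r), ∃ j u, j < r ∧ u < len j ∧ (i : ℕ) = off j + u ∧ (S.o i : ℕ) = i ∧
        (S.t i : ℕ) = off j + (u + 1) % len j ∧ s.onV i = Γ.o (y j u) ∧ s.onE i = y j u := by
  have hpos : ∀ j < r, 0 < len j := fun j hj => hlen j hj ▸ (hlong j hj).per_pos
  let ℓ : Fin r → ℕ := fun j => len j
  have hne : ∀ j, NeZero (ℓ j) := fun j => ⟨(hpos j j.2).ne'⟩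
  let φ : (Σ j, ZMod (ℓ j)) → Fin (off r) := fun x => ⟨off x.1 + x.2.val, by
    have h1 := ZMod.val_lt x.2
    have h2 := off_le off len hs x.1.2 le_rfl
    simp only [ℓ] at h1
    omega⟩
  have hφ : Function.Bijective φ := by
    constructor
    · rintro ⟨i, u⟩ ⟨j, w⟩ h
      have h' : off i + u.val = off j + w.val := congrArg Fin.val h
      have hij : i = j := Fin.ext
        (interval_unique off len hs i.2 j.2 (ZMod.val_lt u) (ZMod.val_lt w) h')
      subst hij
      have : u = w := ZMod.val_injective _ (by omega)
      rw [this]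
    · intro i
      obtain ⟨j, u, hj, hu, hi⟩ := exists_interval off len h0 hs i i.2
      refine ⟨⟨⟨j, hj⟩, (u : ZMod _)⟩, Fin.ext ?_⟩
      simp only [φ, ZMod.val_natCast]
      rw [Nat.mod_eq_of_lt (show u < ℓ ⟨j, hj⟩ from hu)]
      exact hi.symm
  let e := Equiv.ofBijective φ hφ
  let ye : (Σ j, ZMod (ℓ j)) → E := fun x => y x.1 x.2.val
  have hper : ∀ j : Fin r, ∀ i, y j (i + ℓ j) = y j i := by
    intro j i
    have := per_spec (y j) i
    rwa [hlen j j.2] at this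
  -- The disjoint union of circles, transported along the numbering `e` of its vertices by
  -- consecutive intervals. Vertices and edges carry the same numbers, an edge being named after its
  -- origin.
  let S : DGraph (Fin (off r)) (Fin (off r)) :=
    ⟨fun i => i, fun i => e ⟨(e.symm i).1, (e.symm i).2 + 1⟩⟩
  have hstep : ∀ x : Σ j, ZMod (ℓ j), Γ.t (ye x) = Γ.o (ye ⟨x.1, x.2 + 1⟩) := by
    rintro ⟨j, u⟩
    simp only [ye]
    rw [(hlong j j.2).isPath, ZMod.val_add, apply_mod (hper j), ZMod.val_one_eq_one_mod,
      ← apply_mod (hper j) (u.val + 1 % _), ← apply_mod (hper j) (u.val + 1)]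
    simp
  let s : Hom S Γ :=
    { onV := fun i => Γ.o (ye (e.symm i))
      onE := fun i => ye (e.symm i)
      map_o := fun _ => rfl
      map_t := fun i => by
        simp only [S, Equiv.symm_apply_apply]
        exact (hstep _).symm }
  let ψ : Hom (circles ℓ) S :=
    { onV := e
      onE := e
      map_o := fun _ => rfl
      map_t := fun x => by
        change e _ = e ⟨(e.symm (e x)).1, (e.symm (e x)).2 + 1⟩
        rw [Equiv.symm_apply_apply]
        rfl }
  have hcyc : ∀ j, ((s.comp ψ).comp (circleIncl ℓ j)).seq = y j := by
    intro j
    funext i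
    change ye (e.symm (e ⟨j, (i : ZMod (ℓ j))⟩)) = _
    rw [Equiv.symm_apply_apply]
    change y j (i : ZMod (ℓ j)).val = _
    rw [ZMod.val_natCast, apply_mod (hper j)]
  refine ⟨S, s, ⟨r, ℓ, ψ, hr, fun j => hpos j j.2, ⟨e.bijective, e.bijective⟩, ?_, ?_, ?_⟩, ?_⟩
  · intro j
    have hj := hlong j j.2
    refine ⟨isPrimitive_of_per (hpos j j.2) _ (by rw [hcyc]; exact hlen j j.2), ?_⟩
    have hd : per (fun i => γ.onE (y j i)) ∣ len j := by
      rw [← hlen j j.2]; exact per_comp_dvd _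
    refine le_trans ?_ (le_degree (hpos j j.2) _ hd ?_)
    · rw [Nat.le_div_iff_mul_le (Nat.pos_of_dvd_of_pos hd (hpos j j.2)), ← hlen j j.2]
      exact hj.long
    · intro i
      change γ.onE (((s.comp ψ).comp (circleIncl ℓ j)).seq (i + _)) =
        γ.onE (((s.comp ψ).comp (circleIncl ℓ j)).seq i)
      rw [hcyc]
      exact per_spec (fun i => γ.onE (y j i)) i
  · rintro i j ⟨θ, _, hθ⟩
    apply Fin.ext
    apply hdist i i.2 j j.2 (θ.onV 0).val
    intro t
    rw [← hcyc i, ← hθ, seq_comp_circle, ← hcyc j, Hom.seq]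
    simp
  · intro k hk f hf
    have : NeZero k := ⟨hk.ne'⟩
    have hl := isLong_seq γ hk f hf
    obtain ⟨j, hj, c, hc⟩ := hcompl _ hl
    -- A rotation of `y j` has the same minimal period, and `k` is a period of `f`, so `f` winds
    -- around the `j`-th circle a whole number of times.
    have hdvd : len j ∣ k := by
      have h1 : per f.seq = per (y j) := by
        rw [show f.seq = fun t => y j (c + t) from funext hc]
        exact per_shift_eq (hlong j hj).per_pos (per_spec _) c
      rw [← hlen j hj, ← h1]
      exact per_dvd f.seq_add
    let h' : Hom (circle k) (circles ℓ) :=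
      { onV := fun x => ⟨⟨j, hj⟩, ((c + x.val : ℕ) : ZMod _)⟩
        onE := fun x => ⟨⟨j, hj⟩, ((c + x.val : ℕ) : ZMod _)⟩
        map_o := fun _ => rfl
        map_t := fun x => by
          simp only [circle, circles]
          congr 1
          rw [ZMod.val_add, ZMod.val_one_eq_one_mod, ← Nat.cast_succ,
            ZMod.natCast_eq_natCast_iff, Nat.succ_eq_add_one, add_assoc]
          apply Nat.ModEq.add_left
          have : (x.val + 1 % k) % k ≡ x.val + 1 [MOD k] := by
            rw [Nat.ModEq]; simp
          exact this.of_dvd hdvd }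
    refine ⟨ψ.comp h', Hom.ext_onE fun x => ?_⟩
    have : (s.comp (ψ.comp h')).onE x = y j (((c + x.val : ℕ) : ZMod (ℓ ⟨j, hj⟩))).val := by
      change ye (e.symm (e ⟨⟨j, hj⟩, ((c + x.val : ℕ) : ZMod _)⟩)) = _
      rw [Equiv.symm_apply_apply]
    rw [this, ZMod.val_natCast, apply_mod (hper ⟨j, hj⟩), ← hc, f.seq_val]
  · intro i
    obtain ⟨⟨j, u⟩, rfl⟩ := e.surjective i
    refine ⟨j, u.val, j.2, ZMod.val_lt u, rfl, rfl, ?_, ?_, ?_⟩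
    · have : S.t (e ⟨j, u⟩) = e ⟨j, u + 1⟩ := by
        change e _ = _
        rw [Equiv.symm_apply_apply]
      rw [this]
      change off j + (u + 1).val = _
      rw [ZMod.val_add, ZMod.val_one_eq_one_mod, Nat.add_mod_mod]
    · change Γ.o (ye (e.symm (e ⟨j, u⟩))) = _
      rw [Equiv.symm_apply_apply]
    · change ye (e.symm (e ⟨j, u⟩)) = _
      rw [Equiv.symm_apply_apply]

end Assemble

/-! ## Reasoning about programs -/

section Hoare

/-- The program `p` halts on `σ`, and `Q` holds of its running time and its final memory. -/
def Run (W : ℕ) (p : Prog) (σ : Mem) (Q : ℕ → Mem → Prop) : Prop :=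
  ∃ T σ', Exec W p σ T σ' ∧ Q T σ'

/-- A sequence of programs. -/
def Prog.block : List Prog → Prog
  | [] => .skip
  | p :: l => .seq p (Prog.block l)

variable {W : ℕ} {σ : Mem} {Q : ℕ → Mem → Prop}

theorem Run.mono {p : Prog} {Q' : ℕ → Mem → Prop} (h : Run W p σ Q)
    (hQ : ∀ T σ', Q T σ' → Q' T σ') : Run W p σ Q' := by
  obtain ⟨T, σ', h, hq⟩ := h
  exact ⟨T, σ', h, hQ _ _ hq⟩

-- The rules for instructions are equivalences, so that rewriting turns straight-line code into the
-- condition it has to satisfy on the initial memory.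
@[simp]
theorem run_skip : Run W .skip σ Q ↔ Q 1 σ :=
  ⟨fun ⟨_, _, h, hq⟩ => by cases h; exact hq, fun h => ⟨_, _, .skip _, h⟩⟩

@[simp]
theorem run_const {x n : ℕ} : Run W (.const x n) σ Q ↔ n ≤ W ∧ Q 1 (σ.setReg x n) :=
  ⟨fun ⟨_, _, h, hq⟩ => by cases h; exact ⟨‹_›, hq⟩, fun h => ⟨_, _, .const _ _ _ h.1, h.2⟩⟩

@[simp]
theorem run_copy {x y : ℕ} : Run W (.copy x y) σ Q ↔ Q 1 (σ.setReg x (σ.reg y)) :=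
  ⟨fun ⟨_, _, h, hq⟩ => by cases h; exact hq, fun h => ⟨_, _, .copy _ _ _, h⟩⟩

@[simp]
theorem run_add {x y z : ℕ} : Run W (.add x y z) σ Q ↔
    σ.reg y + σ.reg z ≤ W ∧ Q 1 (σ.setReg x (σ.reg y + σ.reg z)) :=
  ⟨fun ⟨_, _, h, hq⟩ => by cases h; exact ⟨‹_›, hq⟩, fun h => ⟨_, _, .add _ _ _ _ h.1, h.2⟩⟩

@[simp]
theorem run_sub {x y z : ℕ} : Run W (.sub x y z) σ Q ↔ Q 1 (σ.setReg x (σ.reg y - σ.reg z)) :=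
  ⟨fun ⟨_, _, h, hq⟩ => by cases h; exact hq, fun h => ⟨_, _, .sub _ _ _ _, h⟩⟩

@[simp]
theorem run_load {x a y : ℕ} : Run W (.load x a y) σ Q ↔
    Q 1 (σ.setReg x (σ.arr a (σ.reg y))) :=
  ⟨fun ⟨_, _, h, hq⟩ => by cases h; exact hq, fun h => ⟨_, _, .load _ _ _ _, h⟩⟩

@[simp]
theorem run_store {a x y : ℕ} : Run W (.store a x y) σ Q ↔
    Q 1 (σ.setArr a (σ.reg x) (σ.reg y)) :=
  ⟨fun ⟨_, _, h, hq⟩ => by cases h; exact hq, fun h => ⟨_, _, .store _ _ _ _, h⟩⟩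

@[simp]
theorem run_seq {p q : Prog} : Run W (.seq p q) σ Q ↔
    Run W p σ fun T₁ σ₁ => Run W q σ₁ fun T₂ => Q (T₁ + T₂) := by
  constructor
  · rintro ⟨_, _, h, hq⟩
    cases h with
    | seq hp hq' => exact ⟨_, _, hp, _, _, hq', hq⟩
  · rintro ⟨_, _, hp, _, _, hq', hq⟩
    exact ⟨_, _, .seq hp hq', hq⟩

-- A block ends with `skip` and thus costs one step beyond its instructions.
@[simp]
theorem run_block_nil : Run W (.block []) σ Q ↔ Q 1 σ := run_skip

@[simp]
theorem run_block_cons {p : Prog} {l : List Prog} : Run W (.block (p :: l)) σ Q ↔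
    Run W p σ fun T₁ σ₁ => Run W (.block l) σ₁ fun T₂ => Q (T₁ + T₂) := run_seq

@[simp]
theorem run_ite {b : Test} {p q : Prog} : Run W (.ite b p q) σ Q ↔
    (b.Holds σ → Run W p σ fun T => Q (1 + T)) ∧ (¬ b.Holds σ → Run W q σ fun T => Q (1 + T)) := by
  constructor
  · rintro ⟨_, _, h, hq⟩
    cases h with
    | iteTrue hb hp => exact ⟨fun _ => ⟨_, _, hp, hq⟩, fun h => absurd hb h⟩
    | iteFalse hb hp => exact ⟨fun h => absurd h hb, fun _ => ⟨_, _, hp, hq⟩⟩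
  · rintro ⟨h1, h2⟩
    by_cases hb : b.Holds σ
    · obtain ⟨_, _, hp, hq⟩ := h1 hb
      exact ⟨_, _, .iteTrue hb hp, hq⟩
    · obtain ⟨_, _, hp, hq⟩ := h2 hb
      exact ⟨_, _, .iteFalse hb hp, hq⟩

@[simp]
theorem Test.holds_lt {x y : ℕ} : (Test.lt x y).Holds σ ↔ σ.reg x < σ.reg y := Iff.rfl

@[simp]
theorem Test.holds_eq {x y : ℕ} : (Test.eq x y).Holds σ ↔ σ.reg x = σ.reg y := Iff.rfl

@[simp]
theorem Mem.reg_setReg (σ : Mem) (x n y : ℕ) :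
    (σ.setReg x n).reg y = if y = x then n else σ.reg y := by
  simp [Mem.setReg, Function.update_apply]

@[simp]
theorem Mem.arr_setReg (σ : Mem) (x n : ℕ) : (σ.setReg x n).arr = σ.arr := rfl

@[simp]
theorem Mem.reg_setArr (σ : Mem) (a i n : ℕ) : (σ.setArr a i n).reg = σ.reg := rfl

@[simp]
theorem Mem.arr_setArr (σ : Mem) (a i n b : ℕ) :
    (σ.setArr a i n).arr b = if b = a then Function.update (σ.arr a) i n else σ.arr b := by
  simp [Mem.setArr, Function.update_apply]

/-- Loops, with an invariant `I` that depends on ghost data and an amortised cost `Φ`. -/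
theorem Run.loop {α : Type*} {b : Test} {p : Prog} (I : α → Mem → Prop) (Φ : α → ℕ)
    (hstep : ∀ a σ, I a σ → b.Holds σ →
      Run W p σ fun T σ' => ∃ a', I a' σ' ∧ T + 1 + Φ a' ≤ Φ a)
    {a : α} (h : I a σ) :
    Run W (.loop b p) σ fun T σ' => ∃ a', I a' σ' ∧ ¬ b.Holds σ' ∧ T + Φ a' ≤ Φ a + 1 := by
  -- Each round lowers the potential by its cost plus one for the test, in particular strictly; so
  -- the potential proves termination along with the time bound.
  induction hn : Φ a using Nat.strong_induction_on generalizing a σ with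
  | _ n ih =>
    by_cases hb : b.Holds σ
    · obtain ⟨T₁, σ₁, h₁, a₁, hI, hT⟩ := hstep a σ h hb
      obtain ⟨T₂, σ₂, h₂, a₂, hI₂, hb₂, hT₂⟩ := ih (Φ a₁) (by omega) hI rfl
      exact ⟨_, _, .loopTrue hb h₁ h₂, a₂, hI₂, hb₂, by omega⟩
    · exact ⟨_, _, .loopFalse hb, a, h, hb, by omega⟩

/-! ### Frame conditions -/

/-- The registers that a program writes. -/
def Prog.wr : Prog → List ℕ
  | .skip => []
  | .const x _ => [x]
  | .copy x _ => [x]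
  | .add x _ _ => [x]
  | .sub x _ _ => [x]
  | .load x _ _ => [x]
  | .store _ _ _ => []
  | .seq p q => p.wr ++ q.wr
  | .ite _ p q => p.wr ++ q.wr
  | .loop _ p => p.wr

/-- The arrays that a program writes. -/
def Prog.wa : Prog → List ℕ
  | .store a _ _ => [a]
  | .seq p q => p.wa ++ q.wa
  | .ite _ p q => p.wa ++ q.wa
  | .loop _ p => p.wa
  | _ => []

/-- `σ'` agrees with `σ` outside of the registers and arrays that `p` writes. -/
def Frame (p : Prog) (σ σ' : Mem) : Prop :=
  (∀ x, x ∉ p.wr → σ'.reg x = σ.reg x) ∧ ∀ a, a ∉ p.wa → σ'.arr a = σ.arr a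

/-- What a program preserves is read off from its syntax; for concrete programs the side conditions
are closed by `decide`. -/
theorem Exec.frame {p : Prog} {σ σ' : Mem} {T : ℕ} (h : Exec W p σ T σ') : Frame p σ σ' := by
  induction h with
  | skip => exact ⟨fun _ _ => rfl, fun _ _ => rfl⟩
  | const σ x n _ => exact ⟨fun y hy => by
      simp only [Prog.wr, List.mem_singleton] at hy; simp [Mem.reg_setReg, hy], fun _ _ => rfl⟩
  | copy σ x y => exact ⟨fun y hy => by
      simp only [Prog.wr, List.mem_singleton] at hy; simp [Mem.reg_setReg, hy], fun _ _ => rfl⟩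
  | add σ x y z _ => exact ⟨fun y hy => by
      simp only [Prog.wr, List.mem_singleton] at hy; simp [Mem.reg_setReg, hy], fun _ _ => rfl⟩
  | sub σ x y z => exact ⟨fun y hy => by
      simp only [Prog.wr, List.mem_singleton] at hy; simp [Mem.reg_setReg, hy], fun _ _ => rfl⟩
  | load σ x a y => exact ⟨fun y hy => by
      simp only [Prog.wr, List.mem_singleton] at hy; simp [Mem.reg_setReg, hy], fun _ _ => rfl⟩
  | store σ a x y => exact ⟨fun _ _ => rfl, fun b hb => by
      simp only [Prog.wa, List.mem_singleton] at hb; simp [Mem.arr_setArr, hb]⟩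
  | seq _ _ h1 h2 =>
    constructor <;> intro x hx <;> simp only [Prog.wr, Prog.wa, List.mem_append, not_or] at hx
    · rw [h2.1 x hx.2, h1.1 x hx.1]
    · rw [h2.2 x hx.2, h1.2 x hx.1]
  | iteTrue _ _ h1 =>
    constructor <;> intro x hx <;> simp only [Prog.wr, Prog.wa, List.mem_append, not_or] at hx
    · exact h1.1 x hx.1
    · exact h1.2 x hx.1
  | iteFalse _ _ h1 =>
    constructor <;> intro x hx <;> simp only [Prog.wr, Prog.wa, List.mem_append, not_or] at hx
    · exact h1.1 x hx.2
    · exact h1.2 x hx.2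
  | loopFalse => exact ⟨fun _ _ => rfl, fun _ _ => rfl⟩
  | loopTrue _ _ _ h1 h2 =>
    constructor <;> intro x hx
    · rw [h2.1 x hx, h1.1 x hx]
    · rw [h2.2 x hx, h1.2 x hx]

theorem Run.frame {p : Prog} (h : Run W p σ Q) :
    Run W p σ fun T σ' => Q T σ' ∧ Frame p σ σ' := by
  obtain ⟨T, σ', h, hq⟩ := h
  exact ⟨T, σ', h, hq, h.frame⟩

/-- A program run from a memory known only through its predecessor. -/
theorem Run.then {p q : Prog} {Q' : ℕ → Mem → Prop} (h : Run W p σ Q')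
    (hq : ∀ T₁ σ₁, Q' T₁ σ₁ → Frame p σ σ₁ → Run W q σ₁ fun T₂ => Q (T₁ + T₂)) :
    Run W (.seq p q) σ Q := by
  rw [run_seq]
  exact h.frame.mono fun T₁ σ₁ h => hq T₁ σ₁ h.1 h.2

theorem Run.block_cons {p : Prog} {l : List Prog} {Q' : ℕ → Mem → Prop} (h : Run W p σ Q')
    (hq : ∀ T₁ σ₁, Q' T₁ σ₁ → Frame p σ σ₁ → Run W (.block l) σ₁ fun T₂ => Q (T₁ + T₂)) :
    Run W (.block (p :: l)) σ Q := Run.then h hq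

end Hoare

/-! ## Linked lists -/

/-- The list stored with head `h` and successor table `N`; entries are shifted by one, and `0` marks
the end of the list. -/
def Chain (N : ℕ → ℕ) : ℕ → List ℕ → Prop
  | h, [] => h = 0
  | h, x :: l => h = x + 1 ∧ Chain N (N x) l

theorem Chain.update {N : ℕ → ℕ} {h : ℕ} {l : List ℕ} (hl : Chain N h l) {i : ℕ} (hi : i ∉ l)
    (n : ℕ) : Chain (Function.update N i n) h l := by
  induction l generalizing h with
  | nil => exact hl
  | cons x l ih =>
    simp only [List.mem_cons, not_or] at hi
    refine ⟨hl.1, ?_⟩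
    rw [Function.update_of_ne (Ne.symm hi.1)]
    exact ih hl.2 hi.2

/-- The heads `H` and the successor table `N` list the fibres of `O` on `{0, …, e - 1}`. -/
def Fibres (e : ℕ) (O H N : ℕ → ℕ) : Prop :=
  ∀ x, ∃ l, Chain N (H x) l ∧ l.Nodup ∧ ∀ j, j ∈ l ↔ j < e ∧ O j = x

/-- As `0` encodes the empty list, arrays that are initially zero need no preparation. -/
theorem Fibres.zero (O N : ℕ → ℕ) : Fibres 0 O (fun _ => 0) N :=
  fun _ => ⟨[], rfl, List.nodup_nil, by simp⟩

/-- The new element goes to the front of its list; the other lists do not contain `i` and do not see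
the change of `N` there. -/
theorem Fibres.succ {i : ℕ} {O H N : ℕ → ℕ} (h : Fibres i O H N) :
    Fibres (i + 1) O (Function.update H (O i) (i + 1)) (Function.update N i (H (O i))) := by
  intro x
  obtain ⟨l, hl, hn, hm⟩ := h x
  have hi : i ∉ l := fun h => by have := ((hm i).1 h).1; omega
  by_cases hx : x = O i
  · subst hx
    refine ⟨i :: l, ⟨by simp, by simpa using hl.update hi _⟩, List.nodup_cons.2 ⟨hi, hn⟩, ?_⟩
    intro j
    rw [List.mem_cons, hm]
    constructor
    · rintro (rfl | h)
      · exact ⟨by omega, rfl⟩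
      · exact ⟨by omega, h.2⟩
    · rintro ⟨h1, h2⟩
      rcases Nat.lt_succ_iff_lt_or_eq.1 h1 with h | h
      · exact Or.inr ⟨h, h2⟩
      · exact Or.inl h
  · refine ⟨l, by rw [Function.update_of_ne hx]; exact hl.update hi _, hn, ?_⟩
    intro j
    rw [hm]
    constructor
    · rintro ⟨h1, h2⟩; exact ⟨by omega, h2⟩
    · rintro ⟨h1, h2⟩
      refine ⟨?_, h2⟩
      rcases Nat.lt_succ_iff_lt_or_eq.1 h1 with h | h
      · exact h
      · rw [h] at h2; exact absurd h2.symm hx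

/-- The number of elements of a fibre. -/
def fibreCard (e : ℕ) (O : ℕ → ℕ) (x : ℕ) : ℕ := ((Finset.range e).filter fun j => O j = x).card

theorem length_eq_fibreCard {e : ℕ} {O : ℕ → ℕ} {x : ℕ} {l : List ℕ} (hn : l.Nodup)
    (hm : ∀ j, j ∈ l ↔ j < e ∧ O j = x) : l.length = fibreCard e O x := by
  rw [fibreCard, ← List.toFinset_card_of_nodup hn]
  congr 1
  ext j
  simp [hm]

theorem sum_fibreCard {e v : ℕ} {O : ℕ → ℕ} (hO : ∀ j < e, O j < v) :
    ∑ x ∈ Finset.range v, fibreCard e O x = e := by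
  have := Finset.card_eq_sum_card_fiberwise (f := O) (s := Finset.range e) (t := Finset.range v)
    (fun j hj => by simpa using hO j (by simpa using hj))
  rw [Finset.card_range] at this
  exact this.symm

/-- Build the lists of outgoing and of incoming edges of all vertices, and the outdegrees. -/
def buildLists : Prog :=
  .loop (.lt 10 1) (.block [
    .load 11 0 10, .load 12 14 11, .store 15 10 12, .add 13 10 9, .store 14 11 13,
    .load 12 18 11, .add 12 12 9, .store 18 11 12,
    .load 11 1 10, .load 12 16 11, .store 17 10 12, .store 16 11 13, .copy 10 13])

theorem fibreCard_succ (i : ℕ) (O : ℕ → ℕ) :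
    fibreCard (i + 1) O = Function.update (fibreCard i O) (O i) (fibreCard i O (O i) + 1) := by
  funext x
  simp only [fibreCard, Finset.range_add_one, Finset.filter_insert, Function.update_apply]
  by_cases h : O i = x
  · subst h
    simp
  · rw [if_neg h, if_neg (Ne.symm h)]

theorem fibreCard_le (e : ℕ) (O : ℕ → ℕ) (x : ℕ) : fibreCard e O x ≤ e := by
  unfold fibreCard
  exact (Finset.card_filter_le _ _).trans (Finset.card_range e).le

theorem buildLists_run {W e : ℕ} {O T : ℕ → ℕ} {σ : Mem} (hW : e + 1 ≤ W)
    (h1 : σ.reg 1 = e) (h9 : σ.reg 9 = 1) (h10 : σ.reg 10 = 0) (hO : σ.arr 0 = O)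
    (hT : σ.arr 1 = T) (h14 : σ.arr 14 = fun _ => 0) (h16 : σ.arr 16 = fun _ => 0)
    (h18 : σ.arr 18 = fun _ => 0) :
    Run W buildLists σ fun t σ' => t ≤ 15 * e + 1 ∧ Fibres e O (σ'.arr 14) (σ'.arr 15) ∧
      Fibres e T (σ'.arr 16) (σ'.arr 17) ∧ σ'.arr 18 = fibreCard e O := by
  have key := Run.loop (W := W) (σ := σ) (b := .lt 10 1) (p := .block [
    .load 11 0 10, .load 12 14 11, .store 15 10 12, .add 13 10 9, .store 14 11 13,
    .load 12 18 11, .add 12 12 9, .store 18 11 12,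
    .load 11 1 10, .load 12 16 11, .store 17 10 12, .store 16 11 13, .copy 10 13])
    (fun i σ => i ≤ e ∧ σ.reg 10 = i ∧ σ.reg 1 = e ∧ σ.reg 9 = 1 ∧ σ.arr 0 = O ∧ σ.arr 1 = T ∧
      Fibres i O (σ.arr 14) (σ.arr 15) ∧ Fibres i T (σ.arr 16) (σ.arr 17) ∧
      -- Thirteen instructions, the end of the block and the test make `15` steps per edge.
      σ.arr 18 = fibreCard i O) (fun i => 15 * (e - i)) ?_ (a := 0) ?_
  · refine key.mono ?_
    rintro t σ' ⟨i, ⟨hi, h10, h1, h9, hO, hT, hF, hF', hd⟩, hb, ht⟩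
    simp only [Test.holds_lt, h10, h1] at hb
    obtain rfl : i = e := by omega
    exact ⟨by omega, hF, hF', hd⟩
  · rintro i σ ⟨hi, h10, h1, h9, hO, hT, hF, hF', hd⟩ hb
    simp only [Test.holds_lt, h10, h1] at hb
    have hle := fibreCard_le i O (O i)
    simp [h10, h1, h9, hO, hT, hd]
    exact ⟨by omega, by omega, ⟨by omega, hF.succ, hF'.succ, (fibreCard_succ i O).symm⟩, by omega⟩
  · refine ⟨by omega, h10, h1, h9, hO, hT, ?_, ?_, ?_⟩
    · rw [h14]; exact Fibres.zero _ _
    · rw [h16]; exact Fibres.zero _ _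
    · rw [h18]; funext x; simp [fibreCard]

/-! ## Connected components -/

/-- The invariant of a search through the components: the vertices `Q 0, …, Q (qt - 1)` have been
found, the first `qh` of them have been processed, `lab` is the number of their component. -/
structure Search (v e : ℕ) (O T : ℕ → ℕ) (c qh qt : ℕ) (lab Q : ℕ → ℕ) : Prop where
  le : qh ≤ qt
  lt : ∀ i < qt, Q i < v
  inj : ∀ i < qt, ∀ j < qt, Q i = Q j → i = j
  found : ∀ x, lab x ≠ 0 ↔ ∃ i < qt, Q i = x
  lab_le : ∀ x, lab x ≤ c
  open_lab : ∀ i, qh ≤ i → i < qt → lab (Q i) = c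
  edge : ∀ j < e, ∀ i < qh, Q i = O j ∨ Q i = T j → lab (O j) = lab (T j)
  conn : ∀ x w, lab x ≠ 0 → lab x = lab w →
    Relation.EqvGen (fun a b => ∃ j < e, a = O j ∧ b = T j) x w
  surj : ∀ k, 0 < k → k ≤ c → ∃ x < v, lab x = k

variable {v e : ℕ} {O T : ℕ → ℕ} {c qh qt : ℕ} {lab Q : ℕ → ℕ}

theorem Search.zero (v e : ℕ) (O T Q : ℕ → ℕ) : Search v e O T 0 0 0 (fun _ => 0) Q where
  le := le_rfl
  lt := by simp
  inj := by simp
  found := by simp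
  lab_le := by simp
  open_lab := by simp
  edge := by simp
  conn := by simp
  surj := by intro k h1 h2; omega

theorem Search.qt_le (h : Search v e O T c qh qt lab Q) : qt ≤ v := by
  have := Finset.card_le_card_of_injOn (s := Finset.range qt) (t := Finset.range v) Q
    (fun i hi => by simpa using h.lt i (by simpa using hi))
    (fun i hi j hj hij => h.inj i (by simpa using hi) j (by simpa using hj) hij)
  simpa using this

theorem Search.c_pos (h : Search v e O T c qh qt lab Q) (hlt : qh < qt) : 0 < c := by
  have h1 := h.open_lab qh le_rfl hlt
  have h2 := (h.found (Q qh)).2 ⟨qh, hlt, rfl⟩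
  omega

/-- A new vertex is found, and given the label of the current component. -/
theorem Search.push (h : Search v e O T c qh qt lab Q) {y c' : ℕ} (hc : 0 < c') (hy : y < v)
    (h0 : lab y = 0)
    (hc' : (c' = c ∧ ∃ x, lab x = c ∧
        Relation.EqvGen (fun a b => ∃ j < e, a = O j ∧ b = T j) x y) ∨
      (c' = c + 1 ∧ qh = qt)) :
    Search v e O T c' qh (qt + 1) (Function.update lab y c') (Function.update Q qt y) := by
  have hyQ : ∀ i < qt, Q i ≠ y := fun i hi he => (h.found y).2 ⟨i, hi, he⟩ h0
  have hQ : ∀ i < qt, Function.update Q qt y i = Q i := fun i hi =>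
    Function.update_of_ne (by omega) _ _
  have hlab : ∀ i < qt, Function.update lab y c' (Q i) = lab (Q i) := fun i hi =>
    Function.update_of_ne (hyQ i hi) _ _
  have hle := h.le
  have hcc : c ≤ c' := by omega
  have hsplit : ∀ i, i < qt + 1 → i < qt ∨ i = qt := fun i hi => by omega
  -- If a new component is opened, its label `c + 1` exceeds all labels in use, and there is nothing
  -- to connect.
  have hconn : ∀ w, lab w = c' →
      Relation.EqvGen (fun a b => ∃ j < e, a = O j ∧ b = T j) y w := by
    intro w hw
    have hw' := h.lab_le w
    rcases hc' with ⟨hc1, x, hx, hxy⟩ | ⟨hc1, _⟩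
    · exact .trans _ _ _ (.symm _ _ hxy) (h.conn x w (by omega) (by omega))
    · omega
  refine ⟨by omega, ?_, ?_, ?_, ?_, ?_, ?_, ?_, ?_⟩
  · intro i hi
    rcases hsplit i hi with hi | rfl
    · rw [hQ i hi]; exact h.lt i hi
    · simpa using hy
  · intro i hi j hj hij
    rcases hsplit i hi with hi | rfl <;> rcases hsplit j hj with hj | rfl
    · rw [hQ i hi, hQ j hj] at hij; exact h.inj i hi j hj hij
    · rw [hQ i hi, Function.update_self] at hij; exact absurd hij (hyQ i hi)
    · rw [hQ j hj, Function.update_self] at hij; exact absurd hij.symm (hyQ j hj)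
    · rfl
  · intro x
    by_cases hx : x = y
    · subst hx
      simp only [Function.update_self]
      exact ⟨fun _ => ⟨qt, by omega, by simp⟩, fun _ => by omega⟩
    · rw [Function.update_of_ne hx, h.found]
      constructor
      · rintro ⟨i, hi, he⟩; exact ⟨i, by omega, by rw [hQ i hi, he]⟩
      · rintro ⟨i, hi, he⟩
        rcases hsplit i hi with hi | rfl
        · exact ⟨i, hi, by rw [← he, hQ i hi]⟩
        · rw [Function.update_self] at he; exact absurd he.symm hx
  · intro x
    have := h.lab_le x
    rw [Function.update_apply]
    split_ifs <;> omega
  · intro i hi hi'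
    rcases hsplit i hi' with hi' | rfl
    · rw [hQ i hi', hlab i hi', h.open_lab i hi hi']
      rcases hc' with ⟨hc1, _⟩ | ⟨_, hc2⟩ <;> omega
    · simp
  · intro j hj i hi hor
    rw [hQ i (by omega)] at hor
    have hne : ∀ z, lab z ≠ 0 → Function.update lab y c' z = lab z := fun z hz =>
      Function.update_of_ne (by rintro rfl; exact hz h0) _ _
    have heq := h.edge j hj i hi hor
    have : lab (O j) ≠ 0 := by
      rcases hor with hor | hor
      · exact (h.found _).2 ⟨i, by omega, hor⟩
      · rw [heq]; exact (h.found _).2 ⟨i, by omega, hor⟩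
    rw [hne _ this, hne _ (heq ▸ this), heq]
  · intro x w hx hxw
    by_cases hxy : x = y
    · subst hxy
      by_cases hwy : w = x
      · subst hwy; exact .refl _
      · rw [Function.update_self, Function.update_of_ne hwy] at hxw
        exact hconn w hxw.symm
    · rw [Function.update_of_ne hxy] at hx hxw
      by_cases hwy : w = y
      · subst hwy
        rw [Function.update_self] at hxw
        exact .symm _ _ (hconn x hxw)
      · rw [Function.update_of_ne hwy] at hxw
        exact h.conn x w hx hxw
  · intro k hk hkc
    by_cases hkc' : k = c'
    · exact ⟨y, hy, by simp [hkc']⟩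
    · obtain ⟨x, hx, hxk⟩ := h.surj k hk (by omega)
      refine ⟨x, hx, ?_⟩
      rw [Function.update_of_ne, hxk]
      rintro rfl
      omega

/-- All edges at the vertex `Q qh` have been inspected. -/
theorem Search.pop (h : Search v e O T c qh qt lab Q) (hlt : qh < qt)
    (hO : ∀ j < e, O j = Q qh → lab (T j) = c) (hT : ∀ j < e, T j = Q qh → lab (O j) = c) :
    Search v e O T c (qh + 1) qt lab Q := by
  have hc := h.open_lab qh le_rfl hlt
  refine { h with le := hlt, open_lab := fun i hi => h.open_lab i (by omega), edge := ?_ }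
  intro j hj i hi hor
  rcases Nat.lt_succ_iff_lt_or_eq.1 hi with hi | rfl
  · exact h.edge j hj i hi hor
  · rcases hor with hor | hor
    · rw [hO j hj hor.symm, ← hor, hc]
    · rw [hT j hj hor.symm, ← hor, hc]

/-- Inspect the vertex in register `28`. -/
def visit : Prog :=
  .block [.load 24 19 28, .ite (.eq 24 8)
    (.block [.store 19 28 21, .store 20 23 28, .add 23 23 9]) .skip]

/-- The part of the memory that the search uses. -/
structure SearchMem (v e : ℕ) (O T HO NO HI NI : ℕ → ℕ) (c qh qt : ℕ) (lab Q : ℕ → ℕ)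
    (σ : Mem) : Prop where
  r0 : σ.reg 0 = v
  r8 : σ.reg 8 = 0
  r9 : σ.reg 9 = 1
  r21 : σ.reg 21 = c
  r22 : σ.reg 22 = qh
  r23 : σ.reg 23 = qt
  aO : σ.arr 0 = O
  aT : σ.arr 1 = T
  aHO : σ.arr 14 = HO
  aNO : σ.arr 15 = NO
  aHI : σ.arr 16 = HI
  aNI : σ.arr 17 = NI
  alab : σ.arr 19 = lab
  aQ : σ.arr 20 = Q

variable {HO NO HI NI : ℕ → ℕ} {W : ℕ} {σ : Mem}

/-- An unlabelled neighbour is pushed. A labelled neighbour already has the label `c`: if it has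
been processed, by the invariant for edges at processed vertices, and otherwise because all open
vertices carry the current label. -/
theorem visit_run (hW : v + 1 ≤ W) (hM : SearchMem v e O T HO NO HI NI c qh qt lab Q σ)
    (h : Search v e O T c qh qt lab Q) (hlt : qh < qt) {x y : ℕ} (hx : lab x = c)
    (hxy : Relation.EqvGen (fun a b => ∃ j < e, a = O j ∧ b = T j) x y)
    (hedge : (∃ j < e, x = O j ∧ y = T j) ∨ (∃ j < e, y = O j ∧ x = T j))
    (h28 : σ.reg 28 = y) (hy : y < v) :
    Run W visit σ fun t σ' => t ≤ 7 ∧ ∃ qt' lab' Q',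
      SearchMem v e O T HO NO HI NI c qh qt' lab' Q' σ' ∧ Search v e O T c qh qt' lab' Q' ∧
      qh < qt' ∧ lab' y = c ∧ (∀ z, lab z ≠ 0 → lab' z = lab z) ∧ ∀ i ≤ qh, Q' i = Q i := by
  obtain ⟨r0, r8, r9, r21, r22, r23, aO, aT, aHO, aNO, aHI, aNI, alab, aQ⟩ := hM
  have hc := h.c_pos hlt
  have hqt := h.qt_le
  simp only [visit, run_block_cons, run_load, run_ite, Test.holds_eq, Mem.reg_setReg, h28, alab]
  simp only [reduceIte, Nat.reduceEqDiff, r8]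
  constructor
  · intro h0
    simp [r9, r21, r23, h28]
    refine ⟨by omega, qt + 1, Function.update lab y c, Function.update Q qt y,
      ⟨by simp [r0], by simp [r8], by simp [r9], by simp [r21], by simp [r22], by simp,
        by simp [aO], by simp [aT], by simp [aHO], by simp [aNO], by simp [aHI], by simp [aNI],
        by simp [alab], by simp [aQ]⟩, h.push hc hy h0 (Or.inl ⟨rfl, x, hx, hxy⟩), by omega,
        by simp, ?_, fun i hi => Function.update_of_ne (by omega) _ _⟩
    intro z hz
    exact Function.update_of_ne (by rintro rfl; exact hz h0) _ _
  · intro h0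
    simp
    refine ⟨qt, lab, Q,
      ⟨by simp [r0], by simp [r8], by simp [r9], by simp [r21], by simp [r22], by simp [r23],
        by simp [aO], by simp [aT], by simp [aHO], by simp [aNO], by simp [aHI], by simp [aNI],
        by simp [alab], by simp [aQ]⟩, h, hlt, ?_, fun _ _ => rfl, fun _ _ => rfl⟩
    obtain ⟨i, hi, hiy⟩ := (h.found y).1 h0
    by_cases hiq : i < qh
    · rcases hedge with ⟨j, hj, h1, h2⟩ | ⟨j, hj, h1, h2⟩
      · have := h.edge j hj i hiq (Or.inr (by rw [hiy, h2]))
        rw [h2, ← this, ← h1, hx]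
      · have := h.edge j hj i hiq (Or.inl (by rw [hiy, h1]))
        rw [h1, this, ← h2, hx]
    · rw [← hiy]; exact h.open_lab i (by omega) hi

/-- Inspect the ends, read from the array `a`, of the edges in the list with head in register `26`
and successors in the array `n`. -/
def visitList (a n : ℕ) : Prog :=
  .loop (.lt 8 26) (.block [.sub 27 26 9, .load 28 a 27, visit, .load 26 n 27])

theorem visitList_run {a n : ℕ} {Y N : ℕ → ℕ} (hW : v + 1 ≤ W)
    (hmem : ∀ qt lab Q σ, SearchMem v e O T HO NO HI NI c qh qt lab Q σ → σ.arr a = Y ∧ σ.arr n = N)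
    (hM : SearchMem v e O T HO NO HI NI c qh qt lab Q σ)
    (h : Search v e O T c qh qt lab Q) (hlt : qh < qt) {l : List ℕ} (hl : Chain N (σ.reg 26) l)
    (hm : ∀ j ∈ l, Y j < v ∧
      Relation.EqvGen (fun a b => ∃ j < e, a = O j ∧ b = T j) (Q qh) (Y j) ∧
      ((∃ i < e, Q qh = O i ∧ Y j = T i) ∨ (∃ i < e, Y j = O i ∧ Q qh = T i))) :
    Run W (visitList a n) σ fun t σ' => t ≤ 12 * l.length + 1 ∧ ∃ qt' lab' Q',
      SearchMem v e O T HO NO HI NI c qh qt' lab' Q' σ' ∧ Search v e O T c qh qt' lab' Q' ∧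
      qh < qt' ∧ (∀ j ∈ l, lab' (Y j) = c) ∧ (∀ z, lab z ≠ 0 → lab' z = lab z) ∧
      ∀ i ≤ qh, Q' i = Q i := by
  have key := Run.loop (W := W) (σ := σ) (b := .lt 8 26)
    (p := .block [.sub 27 26 9, .load 28 a 27, visit, .load 26 n 27])
    (fun (l' : List ℕ) σ => Chain N (σ.reg 26) l' ∧ (∀ j ∈ l', j ∈ l) ∧
      ∃ qt' lab' Q',
      SearchMem v e O T HO NO HI NI c qh qt' lab' Q' σ ∧ Search v e O T c qh qt' lab' Q' ∧
      qh < qt' ∧ (∀ j ∈ l, j ∈ l' ∨ lab' (Y j) = c) ∧ (∀ z, lab z ≠ 0 → lab' z = lab z) ∧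
      ∀ i ≤ qh, Q' i = Q i) (fun l => 12 * l.length) ?_ (a := l) ?_
  · refine key.mono ?_
    rintro t σ' ⟨l', ⟨hl', _, qt', lab', Q', hM, hS, hlt, hd, hz, hQ⟩, hb, ht⟩
    rw [Test.holds_lt, hM.r8] at hb
    cases l' with
    | cons x l' => have := hl'.1; omega
    | nil => exact ⟨by simpa using ht, qt', lab', Q', hM, hS, hlt, by simpa using hd, hz, hQ⟩
  · rintro l' σ ⟨hl', hm', qt', lab', Q', hM, hS, hlt, hd, hz, hQ⟩ hb
    rw [Test.holds_lt, hM.r8] at hb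
    cases l' with
    | nil => have : σ.reg 26 = 0 := hl'; omega
    | cons x l' =>
      obtain ⟨hx, hl'⟩ := hl'
      obtain ⟨hxv, hxc, hxe⟩ := hm x (hm' x (by simp))
      have hlx : lab' (Q qh) = c := by rw [← hQ _ le_rfl]; exact hS.open_lab qh le_rfl hlt
      obtain ⟨ha, hn⟩ := hmem _ _ _ _ hM
      rw [run_block_cons, run_sub, run_block_cons, run_load]
      refine Run.block_cons (visit_run (HO := HO) (NO := NO) (HI := HI) (NI := NI) hW
        (qt := qt') (lab := lab') (Q := Q') ?_ hS hlt hlx hxc hxe ?_ hxv) ?_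
      · obtain ⟨r0, r8, r9, r21, r22, r23, aO, aT, aHO, aNO, aHI, aNI, alab, aQ⟩ := hM
        constructor <;> simp [*]
      · simp [hM.r9, hx, ha]
      · rintro t σ₁ ⟨ht, qt'', lab'', Q'', hM', hS', hlt', hy, hz', hQ'⟩ hF
        have h27 : σ₁.reg 27 = x := by
          rw [hF.1 27 (by decide)]; simp [hM.r9, hx]
        simp only [run_block_cons, run_load, run_block_nil, h27, (hmem _ _ _ _ hM').2]
        refine ⟨l', ⟨by simpa using hl', fun j hj => hm' j (by simp [hj]), qt'', lab'', Q'', ?_, hS',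
          hlt', ?_, fun z h => (hz' z (by rw [hz z h]; exact h)).trans (hz z h), fun i hi => (hQ' i hi).trans (hQ i hi)⟩, ?_⟩
        · obtain ⟨r0, r8, r9, r21, r22, r23, aO, aT, aHO, aNO, aHI, aNI, alab, aQ⟩ := hM'
          constructor <;> simp [*]
        · intro j hj
          rcases hd j hj with h | h
          · rcases List.mem_cons.1 h with rfl | h
            · exact Or.inr hy
            · exact Or.inl h
          · have := hS.c_pos hlt
            exact Or.inr ((hz' _ (by omega)).trans h)
        · simp only [List.length_cons]; omega
  · exact ⟨hl, fun _ h => h, qt, lab, Q, hM, h, hlt, fun j hj => Or.inl hj, fun _ _ => rfl,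
      fun _ _ => rfl⟩

/-- Inspect all neighbours of the first unprocessed vertex. -/
def processVertex : Prog :=
  .block [.load 25 20 22, .load 26 14 25, visitList 1 15, .load 26 16 25, visitList 0 17,
    .add 22 22 9]

theorem processVertex_run (hW : v + 1 ≤ W) (hO : ∀ j < e, O j < v) (hT : ∀ j < e, T j < v)
    (hFO : Fibres e O HO NO) (hFI : Fibres e T HI NI)
    (hM : SearchMem v e O T HO NO HI NI c qh qt lab Q σ)
    (h : Search v e O T c qh qt lab Q) (hlt : qh < qt) :
    Run W processVertex σ fun t σ' =>
      t ≤ 12 * (fibreCard e O (Q qh) + fibreCard e T (Q qh)) + 10 ∧ ∃ qt' lab' Q',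
      SearchMem v e O T HO NO HI NI c (qh + 1) qt' lab' Q' σ' ∧
      Search v e O T c (qh + 1) qt' lab' Q' ∧ (∀ z, lab z ≠ 0 → lab' z = lab z) ∧ ∀ i ≤ qh, Q' i = Q i := by
  obtain ⟨l, hl, hln, hlm⟩ := hFO (Q qh)
  obtain ⟨l', hl', hln', hlm'⟩ := hFI (Q qh)
  rw [← length_eq_fibreCard hln hlm, ← length_eq_fibreCard hln' hlm']
  rw [processVertex, run_block_cons, run_load, run_block_cons, run_load]
  have hM₁ : SearchMem v e O T HO NO HI NI c qh qt lab Q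
      ((σ.setReg 25 (σ.arr 20 (σ.reg 22))).setReg 26
        ((σ.setReg 25 (σ.arr 20 (σ.reg 22))).arr 14
          ((σ.setReg 25 (σ.arr 20 (σ.reg 22))).reg 25))) := by
    obtain ⟨r0, r8, r9, r21, r22, r23, aO, aT, aHO, aNO, aHI, aNI, alab, aQ⟩ := hM
    constructor <;> simp [*]
  refine Run.block_cons (visitList_run (a := 1) (n := 15) (Y := T) (N := NO) hW
    (fun _ _ _ _ h => ⟨h.aT, h.aNO⟩) hM₁ h hlt (l := l) ?_ ?_) ?_
  · simpa [hM.r22, hM.aQ, hM.aHO] using hl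
  · intro j hj
    obtain ⟨hje, hjO⟩ := (hlm j).1 hj
    exact ⟨hT j hje, .rel _ _ ⟨j, hje, hjO.symm, rfl⟩, Or.inl ⟨j, hje, hjO.symm, rfl⟩⟩
  rintro t₁ σ₁ ⟨ht₁, qt₁, lab₁, Q₁, hM₁, hS₁, hlt₁, hy₁, hz₁, hQ₁⟩ hF₁
  have h25 : σ₁.reg 25 = Q qh := by
    rw [hF₁.1 25 (by decide)]; simp [hM.r22, hM.aQ]
  rw [run_block_cons, run_load]
  have hM₂ : SearchMem v e O T HO NO HI NI c qh qt₁ lab₁ Q₁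
      (σ₁.setReg 26 (σ₁.arr 16 (σ₁.reg 25))) := by
    obtain ⟨r0, r8, r9, r21, r22, r23, aO, aT, aHO, aNO, aHI, aNI, alab, aQ⟩ := hM₁
    constructor <;> simp [*]
  refine Run.block_cons (visitList_run (a := 0) (n := 17) (Y := O) (N := NI) hW
    (fun _ _ _ _ h => ⟨h.aO, h.aNI⟩) hM₂ hS₁ hlt₁ (l := l') ?_ ?_) ?_
  · simpa [h25, hM₁.aHI] using hl'
  · intro j hj
    obtain ⟨hje, hjT⟩ := (hlm' j).1 hj
    rw [hQ₁ _ le_rfl]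
    exact ⟨hO j hje, .symm _ _ (.rel _ _ ⟨j, hje, rfl, hjT.symm⟩),
      Or.inr ⟨j, hje, rfl, hjT.symm⟩⟩
  rintro t₂ σ₂ ⟨ht₂, qt₂, lab₂, Q₂, hM₂, hS₂, hlt₂, hy₂, hz₂, hQ₂⟩ hF₂
  have hQ : ∀ i ≤ qh, Q₂ i = Q i := fun i hi => (hQ₂ i hi).trans (hQ₁ i hi)
  have hle := hS₂.qt_le
  rw [run_block_cons, run_add, run_block_nil, hM₂.r22, hM₂.r9]
  refine ⟨by omega, by omega, qt₂, lab₂, Q₂, ?_, hS₂.pop hlt₂ ?_ ?_,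
    fun z h => (hz₂ z (by rw [hz₁ z h]; exact h)).trans (hz₁ z h), hQ⟩
  · obtain ⟨r0, r8, r9, r21, r22, r23, aO, aT, aHO, aNO, aHI, aNI, alab, aQ⟩ := hM₂
    constructor <;> simp [*]
  · intro j hj hjO
    rw [hQ _ le_rfl] at hjO
    have h1 := hy₁ j ((hlm j).2 ⟨hj, hjO⟩)
    have h2 := hS₁.c_pos hlt₁
    exact (hz₂ _ (by omega)).trans h1
  · intro j hj hjT
    rw [hQ _ le_rfl] at hjT
    exact hy₂ j ((hlm' j).2 ⟨hj, hjT⟩)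

/-- The cost of processing the vertices that are not among `Q 0, …, Q (qh - 1)`. -/
def pending (v e : ℕ) (O T : ℕ → ℕ) (qh : ℕ) (Q : ℕ → ℕ) : ℕ :=
  ∑ x ∈ (Finset.range v).filter (fun x => ∀ i < qh, Q i ≠ x),
    (12 * (fibreCard e O x + fibreCard e T x) + 20)

/-- Processing a vertex releases exactly its own term; the queue may have changed meanwhile, but
only behind the position `qh`. -/
theorem pending_succ {Q' : ℕ → ℕ} (hlt : Q qh < v) (hinj : ∀ i < qh, Q i ≠ Q qh)
    (hQ : ∀ i ≤ qh, Q' i = Q i) :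
    pending v e O T (qh + 1) Q' + (12 * (fibreCard e O (Q qh) + fibreCard e T (Q qh)) + 20) =
      pending v e O T qh Q := by
  classical
  have h1 : (Finset.range v).filter (fun x => ∀ i < qh + 1, Q' i ≠ x) =
      ((Finset.range v).filter (fun x => ∀ i < qh, Q i ≠ x)).erase (Q qh) := by
    ext x
    simp only [Finset.mem_filter, Finset.mem_erase]
    constructor
    · rintro ⟨h1, h2⟩
      refine ⟨?_, h1, fun i hi => ?_⟩
      · rw [← hQ qh le_rfl]; exact (h2 qh (by omega)).symm
      · rw [← hQ i (by omega)]; exact h2 i (by omega)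
    · rintro ⟨h1, h2, h3⟩
      refine ⟨h2, fun i hi => ?_⟩
      rw [hQ i (by omega)]
      rcases Nat.lt_succ_iff_lt_or_eq.1 hi with hi | rfl
      · exact h3 i hi
      · exact h1.symm
  rw [pending, h1, add_comm, pending, Finset.add_sum_erase _ (fun x =>
    12 * (fibreCard e O x + fibreCard e T x) + 20)]
  simp only [Finset.mem_filter, Finset.mem_range]
  exact ⟨hlt, hinj⟩

/-- Every edge is paid for twice, at its origin and at its target. -/
theorem pending_zero (hO : ∀ j < e, O j < v) (hT : ∀ j < e, T j < v) :
    pending v e O T 0 Q = 24 * e + 20 * v := by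
  simp only [pending, Nat.not_lt_zero, false_implies, implies_true, Finset.filter_true]
  rw [Finset.sum_add_distrib, ← Finset.mul_sum, Finset.sum_add_distrib, sum_fibreCard hO,
    sum_fibreCard hT]
  simp; ring

/-- Handle all vertices that have been found. -/
def searchLoop : Prog := .loop (.lt 22 23) processVertex

theorem searchLoop_run (hW : v + 1 ≤ W) (hO : ∀ j < e, O j < v) (hT : ∀ j < e, T j < v)
    (hFO : Fibres e O HO NO) (hFI : Fibres e T HI NI)
    (hM : SearchMem v e O T HO NO HI NI c qh qt lab Q σ) (h : Search v e O T c qh qt lab Q) :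
    Run W searchLoop σ fun t σ' => ∃ q lab' Q',
      SearchMem v e O T HO NO HI NI c q q lab' Q' σ' ∧ Search v e O T c q q lab' Q' ∧
      t + pending v e O T q Q' ≤ pending v e O T qh Q + 1 ∧ (∀ x, lab x ≠ 0 → lab' x ≠ 0) := by
  have key := Run.loop (W := W) (σ := σ) (b := .lt 22 23) (p := processVertex)
    (fun (a : ℕ × ℕ × (ℕ → ℕ) × (ℕ → ℕ)) σ =>
      SearchMem v e O T HO NO HI NI c a.1 a.2.1 a.2.2.1 a.2.2.2 σ ∧
      Search v e O T c a.1 a.2.1 a.2.2.1 a.2.2.2 ∧ (∀ x, lab x ≠ 0 → a.2.2.1 x ≠ 0))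
    (fun a => pending v e O T a.1 a.2.2.2) ?_ (a := (qh, qt, lab, Q)) ⟨hM, h, fun _ h => h⟩
  · refine key.mono ?_
    rintro t σ' ⟨⟨qh', qt', lab', Q'⟩, ⟨hM, hS, hz⟩, hb, ht⟩
    simp only at hM hS hz ht
    rw [Test.holds_lt, hM.r22, hM.r23] at hb
    obtain rfl : qh' = qt' := le_antisymm hS.le (not_lt.1 hb)
    exact ⟨qh', lab', Q', hM, hS, ht, hz⟩
  · rintro ⟨qh', qt', lab', Q'⟩ σ ⟨hM, hS, hz⟩ hb
    simp only at hM hS hz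
    rw [Test.holds_lt, hM.r22, hM.r23] at hb
    refine (processVertex_run hW hO hT hFO hFI hM hS hb).mono ?_
    rintro t σ' ⟨ht, qt₁, lab₁, Q₁, hM₁, hS₁, hz₁, hQ⟩
    refine ⟨(qh' + 1, qt₁, lab₁, Q₁), ⟨hM₁, hS₁, ?_⟩, ?_⟩
    · intro x hx
      change lab₁ x ≠ 0
      rw [hz₁ x (hz x hx)]
      exact hz x hx
    · have := pending_succ (v := v) (e := e) (O := O) (T := T) (Q := Q') (Q' := Q₁) (qh := qh')
        (hS.lt _ hb) (fun i hi hii => by have := hS.inj i (by omega) _ hb hii; omega) hQ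
      simp only
      omega

/-- Label the connected components; their number is left in register `21`. -/
def components : Prog :=
  .loop (.lt 29 0) (.block [.load 24 19 29,
    .ite (.eq 24 8) (.block [.add 21 21 9, .store 19 29 21, .store 20 23 29, .add 23 23 9]) .skip,
    searchLoop, .add 29 29 9])

theorem components_run (hW : v + 1 ≤ W) (hO : ∀ j < e, O j < v) (hT : ∀ j < e, T j < v)
    (hFO : Fibres e O HO NO) (hFI : Fibres e T HI NI)
    (hM : SearchMem v e O T HO NO HI NI 0 0 0 (fun _ => 0) Q σ) (h29 : σ.reg 29 = 0) :
    Run W components σ fun t σ' => t ≤ 24 * e + 40 * v + 1 ∧ ∃ c q lab Q',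
      σ'.reg 21 = c ∧ c ≤ v ∧ Search v e O T c q q lab Q' ∧ ∀ x < v, lab x ≠ 0 := by
  have key := Run.loop (W := W) (σ := σ) (b := .lt 29 0) (p := .block [.load 24 19 29,
    .ite (.eq 24 8) (.block [.add 21 21 9, .store 19 29 21, .store 20 23 29, .add 23 23 9]) .skip,
    searchLoop, .add 29 29 9])
    (fun (a : ℕ × ℕ × ℕ × (ℕ → ℕ) × (ℕ → ℕ)) σ => σ.reg 29 = a.1 ∧ a.1 ≤ v ∧
      SearchMem v e O T HO NO HI NI a.2.1 a.2.2.1 a.2.2.1 a.2.2.2.1 a.2.2.2.2 σ ∧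
      Search v e O T a.2.1 a.2.2.1 a.2.2.1 a.2.2.2.1 a.2.2.2.2 ∧
      (∀ x < a.1, a.2.2.2.1 x ≠ 0))
    (fun a => 20 * (v - a.1) + pending v e O T a.2.2.1 a.2.2.2.2) ?_
    (a := (0, 0, 0, (fun _ => 0), Q))
    ⟨h29, by simp, hM, Search.zero v e O T Q, by simp⟩
  · refine key.mono ?_
    rintro t σ' ⟨⟨r, c, q, lab, Q'⟩, ⟨h29, hr, hM, hS, hx⟩, hb, ht⟩
    simp only at h29 hr hM hS hx ht
    rw [Test.holds_lt, hM.r0, h29] at hb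
    obtain rfl : r = v := by omega
    rw [pending_zero hO hT] at ht
    refine ⟨by omega, c, q, lab, Q', hM.r21, ?_, hS, hx⟩
    choose! f hf1 hf2 using hS.surj
    have := Finset.card_le_card_of_injOn (s := Finset.Icc 1 c) (t := Finset.range r) f
      (fun k hk => by
        have := Finset.mem_Icc.1 (Finset.mem_coe.1 hk)
        simpa using hf1 k (by omega) this.2)
      (fun k hk l hl hkl => by
        have h1 := Finset.mem_Icc.1 (Finset.mem_coe.1 hk)
        have h2 := Finset.mem_Icc.1 (Finset.mem_coe.1 hl)
        rw [← hf2 k (by omega) h1.2, hkl, hf2 l (by omega) h2.2])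
    simpa using this
  · rintro ⟨r, c, q, lab, Q'⟩ σ ⟨h29, hr, hM, hS, hx⟩ hb
    simp only at h29 hr hM hS hx
    rw [Test.holds_lt, hM.r0, h29] at hb
    -- The common continuation of the two branches, whether or not the vertex `r` opens a new
    -- component.
    have hfin : ∀ (c' qt' : ℕ) (lab₁ Q₁ : ℕ → ℕ) (σ₁ : Mem) (t₁ : ℕ), σ₁.reg 29 = r → t₁ ≤ 8 →
        SearchMem v e O T HO NO HI NI c' q qt' lab₁ Q₁ σ₁ →
        Search v e O T c' q qt' lab₁ Q₁ → (∀ x < r + 1, lab₁ x ≠ 0) →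
        pending v e O T q Q₁ = pending v e O T q Q' →
        Run W (.block [searchLoop, .add 29 29 9]) σ₁ fun t₂ σ' =>
          ∃ a' : ℕ × ℕ × ℕ × (ℕ → ℕ) × (ℕ → ℕ), (σ'.reg 29 = a'.1 ∧ a'.1 ≤ v ∧
            SearchMem v e O T HO NO HI NI a'.2.1 a'.2.2.1 a'.2.2.1 a'.2.2.2.1 a'.2.2.2.2 σ' ∧
            Search v e O T a'.2.1 a'.2.2.1 a'.2.2.1 a'.2.2.2.1 a'.2.2.2.2 ∧
            (∀ x < a'.1, a'.2.2.2.1 x ≠ 0)) ∧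
          1 + (t₁ + t₂) + 1 + (20 * (v - a'.1) + pending v e O T a'.2.2.1 a'.2.2.2.2) ≤
            20 * (v - r) + pending v e O T q Q' := by
      intro c' qt' lab₁ Q₁ σ₁ t₁ h29 ht hM hS hx hp
      refine Run.block_cons (searchLoop_run hW hO hT hFO hFI hM hS) ?_
      rintro t₂ σ₂ ⟨q₂, lab₂, Q₂, hM₂, hS₂, ht₂, hz₂⟩ hF
      have h29' : σ₂.reg 29 = r := by rw [hF.1 29 (by decide)]; exact h29
      rw [run_block_cons, run_add, run_block_nil, h29', hM₂.r9]
      refine ⟨by omega, (r + 1, c', q₂, lab₂, Q₂), ⟨by simp, by simp only; omega, ?_, hS₂,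
        fun x h => hz₂ x (hx x h)⟩, by simp only; omega⟩
      obtain ⟨r0, r8, r9, r21, r22, r23, aO, aT, aHO, aNO, aHI, aNI, alab, aQ⟩ := hM₂
      constructor <;> simp [*]
    obtain ⟨r0, r8, r9, r21, r22, r23, aO, aT, aHO, aNO, aHI, aNI, alab, aQ⟩ := hM
    rw [run_block_cons, run_load, run_block_cons, run_ite]
    simp only [Test.holds_eq, Mem.reg_setReg, reduceIte, Nat.reduceEqDiff, h29, alab, r8]
    constructor
    · intro h0
      have hqv : q < v := by
        have h1 := (hS.push (c' := c + 1) (by omega) hb h0 (Or.inr ⟨rfl, rfl⟩)).qt_le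
        omega
      -- Every component has a vertex in the queue; with `q < v` this keeps `c + 1` within the word
      -- size.
      have hcv : c ≤ q := by
        choose! f hf1 hf2 using hS.surj
        have hf3 : ∀ k, 0 < k → k ≤ c → ∃ i < q, Q' i = f k := fun k h1 h2 =>
          (hS.found (f k)).1 (by rw [hf2 k h1 h2]; omega)
        choose! g hg1 hg2 using hf3
        have := Finset.card_le_card_of_injOn (s := Finset.Icc 1 c) (t := Finset.range q) g
          (fun k hk => by
            have := Finset.mem_Icc.1 (Finset.mem_coe.1 hk)
            simpa using hg1 k (by omega) this.2)
          (fun k hk l hl hkl => by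
            have h1 := Finset.mem_Icc.1 (Finset.mem_coe.1 hk)
            have h2 := Finset.mem_Icc.1 (Finset.mem_coe.1 hl)
            rw [← hf2 k (by omega) h1.2, ← hg2 k (by omega) h1.2, hkl, hg2 l (by omega) h2.2,
              hf2 l (by omega) h2.2])
        simpa using this
      rw [run_block_cons, run_add]
      refine ⟨by simp [r21, r9]; omega, ?_⟩
      rw [run_block_cons, run_store, run_block_cons, run_store, run_block_cons, run_add]
      refine ⟨by simp [r23, r9]; omega, ?_⟩
      rw [run_block_nil]
      refine Run.mono (hfin (c + 1) (q + 1) (Function.update lab r (c + 1)) (Function.update Q' q r)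
        _ 7 ?_ (by omega) ?_ (hS.push (by omega) hb h0 (Or.inr ⟨rfl, rfl⟩)) ?_ ?_) ?_
      · simp [h29]
      · constructor <;> simp [*]
      · intro x hxr
        rw [Function.update_apply]
        split_ifs with h
        · omega
        · exact hx x (by omega)
      · have : ∀ i < q, Function.update Q' q r i = Q' i := fun i hi =>
          Function.update_of_ne (by omega) _ _
        simp only [pending]
        congr 1
        ext x
        simp only [Finset.mem_filter]
        constructor
        · rintro ⟨h1, h2⟩; exact ⟨h1, fun i hi => by rw [← this i hi]; exact h2 i hi⟩
        · rintro ⟨h1, h2⟩; exact ⟨h1, fun i hi => by rw [this i hi]; exact h2 i hi⟩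
      · rintro t σ' ⟨a', h1, h2⟩
        exact ⟨a', h1, by omega⟩
    · intro h0
      rw [run_skip]
      refine Run.mono (hfin c q lab Q' _ 2 ?_ (by omega) ?_ hS ?_ rfl) ?_
      · simp [h29]
      · constructor <;> simp [*]
      · intro x hxr
        rcases Nat.lt_succ_iff_lt_or_eq.1 hxr with h | rfl
        · exact hx x h
        · exact h0
      · rintro t σ' ⟨a', h1, h2⟩
        exact ⟨a', h1, by omega⟩

/-! ## Live edges -/

/-- An infinite path in the graph with edges `0, …, e - 1`, origins `O` and targets `T`. -/
def NPath (e : ℕ) (O T : ℕ → ℕ) (F : ℕ → ℕ) : Prop := ∀ i, F i < e ∧ T (F i) = O (F (i + 1))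

theorem NPath.shift {e : ℕ} {O T F : ℕ → ℕ} (h : NPath e O T F) (c : ℕ) :
    NPath e O T fun i => F (c + i) := fun i => h (c + i)

/-- The invariant of the removal of sinks: the edges `D` have been removed, `dg` counts the other
ones, `Q` lists the vertices `x < r` without remaining outgoing edges, and the first `qh` of these
have been processed. -/
structure Pruning (v e : ℕ) (O T : ℕ → ℕ) (r : ℕ) (D : Finset ℕ) (qh qt : ℕ) (dg Q : ℕ → ℕ) :
    Prop where
  le : qh ≤ qt
  r_le : r ≤ v
  inj : ∀ i < qt, ∀ j < qt, Q i = Q j → i = j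
  deg : ∀ x, dg x = ((Finset.range e).filter fun j => O j = x ∧ j ∉ D).card
  removed : ∀ j ∈ D, ∃ i < qt, Q i = T j
  zero : ∀ x, (∃ i < qt, Q i = x) ↔ x < r ∧ dg x = 0
  path : ∀ F, NPath e O T F → ∀ i < qt, Q i ≠ O (F 0)
  done : ∀ j < e, ∀ i < qh, Q i = T j → j ∈ D

section Prune

variable {v e r : ℕ} {O T : ℕ → ℕ} {D : Finset ℕ} {qh qt : ℕ} {dg Q : ℕ → ℕ}

theorem Pruning.init (v e : ℕ) (O T Q : ℕ → ℕ) :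
    Pruning v e O T 0 ∅ 0 0 (fibreCard e O) Q where
  le := le_rfl
  r_le := by omega
  inj := by simp
  deg := by simp [fibreCard]
  removed := by simp
  zero := by simp
  path := by simp
  done := by simp

theorem Pruning.qt_le (h : Pruning v e O T r D qh qt dg Q) : qt ≤ v := by
  have := Finset.card_le_card_of_injOn (s := Finset.range qt) (t := Finset.range v) Q
    (fun i hi => by
      have h1 := ((h.zero (Q i)).1 ⟨i, by simpa using hi, rfl⟩).1
      have h2 := h.r_le
      simp only [Finset.coe_range, Set.mem_Iio]
      omega)
    (fun i hi j hj hij => h.inj i (by simpa using hi) j (by simpa using hj) hij)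
  simpa using this

/-- All edges out of `x` have been removed, and a removed edge leads to a listed vertex, from which
no infinite path continues. -/
theorem Pruning.dead (h : Pruning v e O T r D qh qt dg Q) {x : ℕ} (hx : dg x = 0) {F : ℕ → ℕ}
    (hF : NPath e O T F) : x ≠ O (F 0) := by
  intro hxF
  have h1 : F 0 ∈ D := by
    by_contra hD
    rw [h.deg, Finset.card_eq_zero] at hx
    have : F 0 ∈ (Finset.range e).filter fun j => O j = x ∧ j ∉ D := by
      simp [(hF 0).1, hxF, hD]
    rw [hx] at this
    simp at this
  obtain ⟨i, hi, hiQ⟩ := h.removed _ h1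
  refine h.path _ (hF.shift 1) i hi ?_
  rw [hiQ, (hF 0).2]

/-- Append a vertex without remaining outgoing edges to the list. -/
theorem Pruning.append (h : Pruning v e O T r D qh qt dg Q) {x r' : ℕ} (hx : dg x = 0)
    (hr' : r' ≤ v) (hr : ∀ y, y < r' ∧ dg y = 0 ↔ (y < r ∧ dg y = 0) ∨ y = x)
    (hxr : ¬ x < r) : Pruning v e O T r' D qh (qt + 1) dg (Function.update Q qt x) := by
  have hxQ : ∀ i < qt, Q i ≠ x := fun i hi he => hxr ((h.zero x).1 ⟨i, hi, he⟩).1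
  have hQ : ∀ i < qt, Function.update Q qt x i = Q i := fun i hi =>
    Function.update_of_ne (by omega) _ _
  have hsplit : ∀ i, i < qt + 1 → i < qt ∨ i = qt := fun i hi => by omega
  have hle := h.le
  refine ⟨by omega, hr', ?_, h.deg, ?_, ?_, ?_, ?_⟩
  · intro i hi j hj hij
    rcases hsplit i hi with hi | rfl <;> rcases hsplit j hj with hj | rfl
    · rw [hQ i hi, hQ j hj] at hij; exact h.inj i hi j hj hij
    · rw [hQ i hi, Function.update_self] at hij; exact absurd hij (hxQ i hi)
    · rw [hQ j hj, Function.update_self] at hij; exact absurd hij.symm (hxQ j hj)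
    · rfl
  · intro j hj
    obtain ⟨i, hi, hiT⟩ := h.removed j hj
    exact ⟨i, by omega, by rw [hQ i hi, hiT]⟩
  · intro y
    rw [hr, ← h.zero]
    constructor
    · rintro ⟨i, hi, rfl⟩
      rcases hsplit i hi with hi | rfl
      · exact Or.inl ⟨i, hi, (hQ i hi).symm⟩
      · exact Or.inr (by simp)
    · rintro (⟨i, hi, rfl⟩ | rfl)
      · exact ⟨i, by omega, hQ i hi⟩
      · exact ⟨qt, by omega, by simp⟩
  · intro F hF i hi
    rcases hsplit i hi with hi | rfl
    · rw [hQ i hi]; exact h.path F hF i hi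
    · rw [Function.update_self]; exact h.dead hx hF
  · intro j hj i hi hij
    exact h.done j hj i hi (by rw [← hij, hQ i (by omega)])

theorem Pruning.next (h : Pruning v e O T r D qh qt dg Q) (hr : r < v) (hd : dg r ≠ 0) :
    Pruning v e O T (r + 1) D qh qt dg Q := by
  refine { h with r_le := hr, zero := fun x => ?_ }
  rw [h.zero]
  constructor
  · rintro ⟨h1, h2⟩; exact ⟨by omega, h2⟩
  · rintro ⟨h1, h2⟩
    refine ⟨?_, h2⟩
    rcases Nat.lt_succ_iff_lt_or_eq.1 h1 with h1 | rfl
    · exact h1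
    · exact absurd h2 hd

theorem Pruning.deg_pos (h : Pruning v e O T r D qh qt dg Q) {j : ℕ} (hj : j < e) (hD : j ∉ D) :
    0 < dg (O j) := by
  rw [h.deg]
  exact Finset.card_pos.2 ⟨j, by simp [hj, hD]⟩

/-- Remove an edge into the first unprocessed vertex. -/
theorem Pruning.kill (h : Pruning v e O T v D qh qt dg Q) (hlt : qh < qt) {j : ℕ} (hj : j < e)
    (hO : O j < v) (hD : j ∉ D) (hT : T j = Q qh) :
    (dg (O j) - 1 ≠ 0 → Pruning v e O T v (insert j D) qh qt
      (Function.update dg (O j) (dg (O j) - 1)) Q) ∧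
    (dg (O j) - 1 = 0 → Pruning v e O T v (insert j D) qh (qt + 1)
      (Function.update dg (O j) (dg (O j) - 1)) (Function.update Q qt (O j))) := by
  have hdeg : ∀ x, Function.update dg (O j) (dg (O j) - 1) x =
      ((Finset.range e).filter fun i => O i = x ∧ i ∉ insert j D).card := by
    intro x
    by_cases hx : x = O j
    · subst hx
      have : ((Finset.range e).filter fun i => O i = O j ∧ i ∉ insert j D) =
          ((Finset.range e).filter fun i => O i = O j ∧ i ∉ D).erase j := by
        ext i
        simp only [Finset.mem_filter, Finset.mem_erase, Finset.mem_insert]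
        tauto
      rw [Function.update_self, this, Finset.card_erase_of_mem (by simp [hj, hD]), h.deg]
    · rw [Function.update_of_ne hx, h.deg]
      congr 1
      ext i
      simp only [Finset.mem_filter, Finset.mem_insert]
      constructor
      · rintro ⟨h1, h2, h3⟩
        exact ⟨h1, h2, by rintro (rfl | h4); exacts [hx h2.symm, h3 h4]⟩
      · rintro ⟨h1, h2, h3⟩
        exact ⟨h1, h2, fun h4 => h3 (Or.inr h4)⟩
  have hpos := h.deg_pos hj hD
  have hjQ : ¬ ∃ i < qt, Q i = O j := by
    rw [h.zero]; rintro ⟨_, h2⟩; omega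
  have hrem : ∀ i ∈ insert j D, ∃ k < qt, Q k = T i := by
    intro i hi
    rcases Finset.mem_insert.1 hi with rfl | hi
    · exact ⟨qh, hlt, hT.symm⟩
    · exact h.removed i hi
  -- The argument of `Pruning.dead`, with `j` already counted among the removed edges.
  have hdead : dg (O j) - 1 = 0 → ∀ F, NPath e O T F → O j ≠ O (F 0) := by
    intro h0 F hF hjF
    have h1 : F 0 ∈ insert j D := by
      by_contra hD'
      have h2 := hdeg (O j)
      rw [Function.update_self, h0] at h2
      have : F 0 ∈ (Finset.range e).filter fun i => O i = O j ∧ i ∉ insert j D := by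
        simp only [Finset.mem_filter, Finset.mem_range]
        exact ⟨(hF 0).1, hjF.symm, hD'⟩
      rw [Finset.card_eq_zero.1 h2.symm] at this
      simp at this
    obtain ⟨i, hi, hiQ⟩ := hrem _ h1
    refine h.path _ (hF.shift 1) i hi ?_
    rw [hiQ, (hF 0).2]
  have hdone : ∀ i < e, ∀ k < qh, Q k = T i → i ∈ insert j D := fun i hi k hk hki =>
    Finset.mem_insert_of_mem (h.done i hi k hk hki)
  constructor
  · intro h0
    refine ⟨h.le, le_rfl, h.inj, hdeg, hrem, ?_, h.path, hdone⟩
    intro x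
    rw [h.zero]
    by_cases hx : x = O j
    · subst hx
      rw [Function.update_self]
      constructor
      · rintro ⟨_, h2⟩; omega
      · rintro ⟨_, h2⟩; omega
    · rw [Function.update_of_ne hx]
  · intro h0
    have hQ : ∀ i < qt, Function.update Q qt (O j) i = Q i := fun i hi =>
      Function.update_of_ne (by omega) _ _
    have hsplit : ∀ i, i < qt + 1 → i < qt ∨ i = qt := fun i hi => by omega
    have hle := h.le
    refine ⟨by omega, le_rfl, ?_, hdeg, ?_, ?_, ?_, ?_⟩
    · intro i hi k hk hik
      rcases hsplit i hi with hi | rfl <;> rcases hsplit k hk with hk | rfl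
      · rw [hQ i hi, hQ k hk] at hik; exact h.inj i hi k hk hik
      · rw [hQ i hi, Function.update_self] at hik; exact absurd ⟨i, hi, hik⟩ hjQ
      · rw [hQ k hk, Function.update_self] at hik; exact absurd ⟨k, hk, hik.symm⟩ hjQ
      · rfl
    · intro i hi
      obtain ⟨k, hk, hkT⟩ := hrem i hi
      exact ⟨k, by omega, by rw [hQ k hk, hkT]⟩
    · intro x
      by_cases hx : x = O j
      · subst hx
        rw [Function.update_self]
        exact ⟨fun _ => ⟨hO, h0⟩, fun _ => ⟨qt, by omega, by simp⟩⟩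
      · rw [Function.update_of_ne hx, ← h.zero]
        constructor
        · rintro ⟨i, hi, rfl⟩
          rcases hsplit i hi with hi | rfl
          · exact ⟨i, hi, (hQ i hi).symm⟩
          · simp at hx
        · rintro ⟨i, hi, rfl⟩
          exact ⟨i, by omega, hQ i hi⟩
    · intro F hF i hi
      rcases hsplit i hi with hi | rfl
      · rw [hQ i hi]; exact h.path F hF i hi
      · rw [Function.update_self]; exact hdead h0 F hF
    · intro i hi k hk hki
      exact hdone i hi k hk (by rw [← hki, hQ k (by omega)])

/-- `dg x` counts the outgoing edges of `x` that lead to vertices `y` with `dg y ≠ 0`, and no vertex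
`x` on an infinite path has `dg x = 0`. -/
structure LiveDeg (e : ℕ) (O T dg : ℕ → ℕ) : Prop where
  deg : ∀ x, dg x = ((Finset.range e).filter fun j => O j = x ∧ dg (T j) ≠ 0).card
  path : ∀ F, NPath e O T F → dg (O (F 0)) ≠ 0

/-- Once the queue is exhausted, the removed edges are exactly those into vertices `y` with `dg y =
0`. -/
theorem Pruning.liveDeg (h : Pruning v e O T v D qt qt dg Q) (hO : ∀ j < e, O j < v)
    (hT : ∀ j < e, T j < v) : LiveDeg e O T dg := by
  constructor
  · intro x
    rw [h.deg]
    congr 1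
    ext j
    simp only [Finset.mem_filter, Finset.mem_range, and_congr_right_iff]
    intro hj _
    rw [not_iff_not]
    constructor
    · intro hD
      exact ((h.zero _).1 (h.removed j hD)).2
    · intro h0
      obtain ⟨i, hi, hiQ⟩ := (h.zero (T j)).2 ⟨hT j hj, h0⟩
      exact h.done j hj i hi hiQ
  · intro F hF h0
    obtain ⟨i, hi, hiQ⟩ := (h.zero (O (F 0))).2 ⟨hO _ (hF 0).1, h0⟩
    exact h.path F hF i hi hiQ

/-- The part of the memory that the removal of sinks uses. -/
structure PruneMem (v : ℕ) (O HI NI : ℕ → ℕ) (qh qt : ℕ) (dg Q : ℕ → ℕ) (σ : Mem) : Prop where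
  r0 : σ.reg 0 = v
  r8 : σ.reg 8 = 0
  r9 : σ.reg 9 = 1
  r32 : σ.reg 32 = qh
  r33 : σ.reg 33 = qt
  aO : σ.arr 0 = O
  aHI : σ.arr 16 = HI
  aNI : σ.arr 17 = NI
  adg : σ.arr 18 = dg
  aQ : σ.arr 21 = Q

variable {HI NI : ℕ → ℕ} {W : ℕ} {σ : Mem}

/-- List the sinks. -/
def listSinks : Prog :=
  .loop (.lt 30 0) (.block [.load 34 18 30,
    .ite (.eq 34 8) (.block [.store 21 33 30, .add 33 33 9]) .skip, .add 30 30 9])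

theorem listSinks_run (hW : v + 1 ≤ W) (hM : PruneMem v O HI NI 0 0 (fibreCard e O) Q σ)
    (h30 : σ.reg 30 = 0) :
    Run W listSinks σ fun t σ' => t ≤ 10 * v + 1 ∧ ∃ qt Q',
      PruneMem v O HI NI 0 qt (fibreCard e O) Q' σ' ∧
      Pruning v e O T v ∅ 0 qt (fibreCard e O) Q' := by
  have key := Run.loop (W := W) (σ := σ) (b := .lt 30 0) (p := .block [.load 34 18 30,
    .ite (.eq 34 8) (.block [.store 21 33 30, .add 33 33 9]) .skip, .add 30 30 9])
    (fun (a : ℕ × ℕ × (ℕ → ℕ)) σ => σ.reg 30 = a.1 ∧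
      PruneMem v O HI NI 0 a.2.1 (fibreCard e O) a.2.2 σ ∧
      Pruning v e O T a.1 ∅ 0 a.2.1 (fibreCard e O) a.2.2)
    (fun a => 10 * (v - a.1)) ?_ (a := (0, 0, Q)) ⟨h30, hM, Pruning.init v e O T Q⟩
  · refine key.mono ?_
    rintro t σ' ⟨⟨r, qt, Q'⟩, ⟨h30, hM, hP⟩, hb, ht⟩
    simp only at h30 hM hP ht
    rw [Test.holds_lt, h30, hM.r0] at hb
    have := hP.r_le
    obtain rfl : r = v := by omega
    exact ⟨by omega, qt, Q', hM, hP⟩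
  · rintro ⟨r, qt, Q'⟩ σ ⟨h30, hM, hP⟩ hb
    simp only at h30 hM hP
    rw [Test.holds_lt, h30, hM.r0] at hb
    obtain ⟨r0, r8, r9, r32, r33, aO, aHI, aNI, adg, aQ⟩ := hM
    rw [run_block_cons, run_load, run_block_cons, run_ite]
    constructor
    · intro h0
      simp [h30, adg, r8] at h0
      have hP' := hP.append (x := r) (r' := r + 1) h0 hb (fun y => by
        constructor
        · rintro ⟨h1, h2⟩
          by_cases hy : y = r
          · exact Or.inr hy
          · exact Or.inl ⟨by omega, h2⟩
        · rintro (⟨h1, h2⟩ | rfl)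
          · exact ⟨by omega, h2⟩
          · exact ⟨by omega, h0⟩) (lt_irrefl r)
      have := hP'.qt_le
      rw [run_block_cons, run_store, run_block_cons, run_add, run_block_nil, run_block_cons,
        run_add]
      simp only [Mem.reg_setReg, Mem.reg_setArr, reduceIte, Nat.reduceEqDiff, h30, r33, r9,
        run_block_nil]
      refine ⟨by omega, by omega, (r + 1, qt + 1, Function.update Q' qt r), ⟨by simp, ?_, hP'⟩,
        by simp only; omega⟩
      constructor <;> simp [*]
    · intro h0
      simp [h30, adg, r8] at h0
      rw [run_skip, run_block_cons, run_add, run_block_nil]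
      simp only [Mem.reg_setReg, reduceIte, Nat.reduceEqDiff, h30, r9]
      refine ⟨by omega, (r + 1, qt, Q'), ⟨by simp, ?_, hP.next hb h0⟩, by simp only; omega⟩
      constructor <;> simp [*]

/-- Remove the edges in the list with head in register `36`. -/
def killList : Prog :=
  .loop (.lt 8 36) (.block [.sub 37 36 9, .load 38 0 37, .load 34 18 38, .sub 34 34 9,
    .store 18 38 34, .ite (.eq 34 8) (.block [.store 21 33 38, .add 33 33 9]) .skip,
    .load 36 17 37])

/-- The list must consist of edges not yet removed, so that each decrement is justified. The last
conclusion, that only edges into `Q qh` are removed, preserves this condition for the vertices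
processed later. -/
theorem killList_run (hW : v + 1 ≤ W) (hO : ∀ j < e, O j < v)
    (hM : PruneMem v O HI NI qh qt dg Q σ) (h : Pruning v e O T v D qh qt dg Q) (hlt : qh < qt)
    {l : List ℕ} (hl : Chain NI (σ.reg 36) l) (hn : l.Nodup)
    (hm : ∀ j ∈ l, j < e ∧ T j = Q qh ∧ j ∉ D) :
    Run W killList σ fun t σ' => t ≤ 12 * l.length + 1 ∧ ∃ D' qt' dg' Q',
      PruneMem v O HI NI qh qt' dg' Q' σ' ∧ Pruning v e O T v D' qh qt' dg' Q' ∧ qh < qt' ∧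
      (∀ j ∈ l, j ∈ D') ∧ (∀ i ≤ qh, Q' i = Q i) ∧ (∀ j ∈ D', j ∈ D ∨ T j = Q qh) := by
  have key := Run.loop (W := W) (σ := σ) (b := .lt 8 36)
    (p := .block [.sub 37 36 9, .load 38 0 37, .load 34 18 38, .sub 34 34 9,
      .store 18 38 34, .ite (.eq 34 8) (.block [.store 21 33 38, .add 33 33 9]) .skip,
      .load 36 17 37])
    (fun (a : List ℕ × Finset ℕ × ℕ × (ℕ → ℕ) × (ℕ → ℕ)) σ =>
      Chain NI (σ.reg 36) a.1 ∧ a.1.Nodup ∧ (∀ j ∈ a.1, j < e ∧ T j = Q qh ∧ j ∉ a.2.1) ∧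
      PruneMem v O HI NI qh a.2.2.1 a.2.2.2.1 a.2.2.2.2 σ ∧
      Pruning v e O T v a.2.1 qh a.2.2.1 a.2.2.2.1 a.2.2.2.2 ∧ qh < a.2.2.1 ∧
      (∀ j ∈ l, j ∈ a.1 ∨ j ∈ a.2.1) ∧ (∀ i ≤ qh, a.2.2.2.2 i = Q i) ∧
      (∀ j ∈ a.2.1, j ∈ D ∨ T j = Q qh))
    (fun a => 12 * a.1.length) ?_ (a := (l, D, qt, dg, Q))
    ⟨hl, hn, hm, hM, h, hlt, fun _ h => Or.inl h, fun _ _ => rfl, fun _ h => Or.inl h⟩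
  · refine key.mono ?_
    rintro t σ' ⟨⟨l', D', qt', dg', Q'⟩, ⟨hl', _, _, hM, hP, hlt, hd, hQ, hD⟩, hb, ht⟩
    simp only at hl' hM hP hlt hd hQ hD ht
    rw [Test.holds_lt, hM.r8] at hb
    cases l' with
    | cons x l' => have := hl'.1; omega
    | nil => exact ⟨by simpa using ht, D', qt', dg', Q', hM, hP, hlt, by simpa using hd, hQ, hD⟩
  · rintro ⟨l', D', qt', dg', Q'⟩ σ ⟨hl', hn', hm', hM, hP, hlt, hd, hQ, hD⟩ hb
    simp only at hl' hn' hm' hM hP hlt hd hQ hD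
    rw [Test.holds_lt, hM.r8] at hb
    cases l' with
    | nil => have : σ.reg 36 = 0 := hl'; omega
    | cons x l' =>
      obtain ⟨hx, hl'⟩ := hl'
      obtain ⟨hxe, hxT, hxD⟩ := hm' x (by simp)
      rw [List.nodup_cons] at hn'
      have hk := hP.kill hlt hxe (hO x hxe) hxD (by rw [hQ qh le_rfl]; exact hxT)
      have hmem : ∀ j ∈ l', j < e ∧ T j = Q qh ∧ j ∉ insert x D' := by
        intro j hj
        obtain ⟨h1, h2, h3⟩ := hm' j (by simp [hj])
        refine ⟨h1, h2, ?_⟩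
        rw [Finset.mem_insert]
        rintro (rfl | h)
        · exact hn'.1 hj
        · exact h3 h
      have hd' : ∀ j ∈ l, j ∈ l' ∨ j ∈ insert x D' := by
        intro j hj
        rcases hd j hj with h | h
        · rcases List.mem_cons.1 h with rfl | h
          · exact Or.inr (Finset.mem_insert_self _ _)
          · exact Or.inl h
        · exact Or.inr (Finset.mem_insert_of_mem h)
      have hD' : ∀ j ∈ insert x D', j ∈ D ∨ T j = Q qh := by
        intro j hj
        rcases Finset.mem_insert.1 hj with rfl | hj
        · exact Or.inr hxT
        · exact hD j hj
      obtain ⟨r0, r8, r9, r32, r33, aO, aHI, aNI, adg, aQ⟩ := hM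
      rw [run_block_cons, run_sub, run_block_cons, run_load, run_block_cons, run_load,
        run_block_cons, run_sub, run_block_cons, run_store, run_block_cons, run_ite]
      constructor
      · intro h0
        simp [hx, r9, aO, adg, r8] at h0
        have hP' := hk.2 (by omega)
        have := hP'.qt_le
        rw [run_block_cons, run_store, run_block_cons, run_add, run_block_nil, run_block_cons,
          run_load, run_block_nil]
        refine ⟨by simp [r33, r9]; omega, (l', insert x D', qt' + 1,
          Function.update dg' (O x) (dg' (O x) - 1), Function.update Q' qt' (O x)),
          ⟨by simpa [hx, r9, aNI] using hl', hn'.2, hmem, ?_, hP', by simp only; omega, hd', ?_, hD'⟩,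
          by simp only [List.length_cons]; omega⟩
        · constructor <;> simp [*]
        · intro i hi
          exact (Function.update_of_ne (by omega) _ _).trans (hQ i hi)
      · intro h0
        simp [hx, r9, aO, adg, r8] at h0
        have hP' := hk.1 (by omega)
        rw [run_skip, run_block_cons, run_load, run_block_nil]
        refine ⟨(l', insert x D', qt', Function.update dg' (O x) (dg' (O x) - 1), Q'),
          ⟨by simpa [hx, r9, aNI] using hl', hn'.2, hmem, ?_, hP', hlt, hd', hQ, hD'⟩,
          by simp only [List.length_cons]; omega⟩
        constructor <;> simp [*]

/-- Remove all edges that lead to sinks, again and again. -/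
def prune : Prog :=
  .block [listSinks, .loop (.lt 32 33) (.block [.load 35 21 32, .load 36 16 35, killList,
    .add 32 32 9])]

theorem prune_run (hW : v + 1 ≤ W) (hO : ∀ j < e, O j < v) (hT : ∀ j < e, T j < v)
    (hFI : Fibres e T HI NI)
    (hM : PruneMem v O HI NI 0 0 (fibreCard e O) Q σ) (h30 : σ.reg 30 = 0) :
    Run W prune σ fun t σ' => t ≤ 24 * e + 30 * v + 5 ∧ LiveDeg e O T (σ'.arr 18) := by
  refine Run.block_cons (listSinks_run (T := T) hW hM h30) ?_
  rintro t₀ σ₀ ⟨ht₀, qt₀, Q₀, hM₀, hP₀⟩ -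
  have key := Run.loop (W := W) (σ := σ₀) (b := .lt 32 33)
    (p := .block [.load 35 21 32, .load 36 16 35, killList, .add 32 32 9])
    (fun (a : Finset ℕ × ℕ × ℕ × (ℕ → ℕ) × (ℕ → ℕ)) σ =>
      PruneMem v O HI NI a.2.1 a.2.2.1 a.2.2.2.1 a.2.2.2.2 σ ∧
      Pruning v e O T v a.1 a.2.1 a.2.2.1 a.2.2.2.1 a.2.2.2.2 ∧
      ∀ j ∈ a.1, ∃ i < a.2.1, a.2.2.2.2 i = T j)
    (fun a => pending v e O T a.2.1 a.2.2.2.2) ?_ (a := (∅, 0, qt₀, _, Q₀))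
    ⟨hM₀, hP₀, by simp⟩
  · refine Run.block_cons key ?_
    rintro t σ' ⟨⟨D, qh, qt, dg, Q⟩, ⟨hM, hP, -⟩, hb, ht⟩ -
    simp only at hM hP ht
    rw [Test.holds_lt, hM.r32, hM.r33] at hb
    obtain rfl : qh = qt := le_antisymm hP.le (not_lt.1 hb)
    rw [run_block_nil, hM.adg]
    rw [pending_zero hO hT] at ht
    exact ⟨by omega, hP.liveDeg hO hT⟩
  · rintro ⟨D, qh, qt, dg, Q⟩ σ ⟨hM, hP, hD⟩ hb
    simp only at hM hP hD
    rw [Test.holds_lt, hM.r32, hM.r33] at hb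
    obtain ⟨l, hl, hln, hlm⟩ := hFI (Q qh)
    have hlen := length_eq_fibreCard hln hlm
    have hlt : Q qh < v := ((hP.zero (Q qh)).1 ⟨qh, hb, rfl⟩).1
    rw [run_block_cons, run_load, run_block_cons, run_load]
    have hM₁ : PruneMem v O HI NI qh qt dg Q
        ((σ.setReg 35 (σ.arr 21 (σ.reg 32))).setReg 36
          ((σ.setReg 35 (σ.arr 21 (σ.reg 32))).arr 16
            ((σ.setReg 35 (σ.arr 21 (σ.reg 32))).reg 35))) := by
      obtain ⟨r0, r8, r9, r32, r33, aO, aHI, aNI, adg, aQ⟩ := hM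
      constructor <;> simp [*]
    refine Run.block_cons (killList_run (l := l) hW hO hM₁ hP hb ?_ hln ?_) ?_
    · simpa [hM.r32, hM.aQ, hM.aHI] using hl
    · intro j hj
      obtain ⟨h1, h2⟩ := (hlm j).1 hj
      refine ⟨h1, h2, fun hjD => ?_⟩
      -- An edge removed earlier ends at a vertex processed earlier, which is not `Q qh`.
      obtain ⟨i, hi, hiT⟩ := hD j hjD
      have := hP.inj i (by omega) qh hb (by rw [hiT, h2])
      omega
    · rintro t σ' ⟨ht, D', qt', dg', Q', hM', hP', hlt', hlD, hQ, hDD⟩ -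
      have hqt := hP'.qt_le
      rw [run_block_cons, run_add, run_block_nil]
      simp only [hM'.r32, hM'.r9]
      have hdone : ∀ j ∈ D', ∃ i < qh + 1, Q' i = T j := by
        intro j hj
        rcases hDD j hj with hj | hj
        · obtain ⟨i, hi, hiT⟩ := hD j hj
          exact ⟨i, by omega, by rw [hQ i hi.le, hiT]⟩
        · exact ⟨qh, by omega, by rw [hQ qh le_rfl, hj]⟩
      refine ⟨by omega, (D', qh + 1, qt', dg', Q'), ⟨?_, ?_, hdone⟩, ?_⟩
      · obtain ⟨r0, r8, r9, r32, r33, aO, aHI, aNI, adg, aQ⟩ := hM'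
        constructor <;> simp [*]
      · refine { hP' with le := hlt', done := ?_ }
        intro j hj i hi hij
        simp only at hi hij
        rcases Nat.lt_succ_iff_lt_or_eq.1 hi with hi | rfl
        · exact hP'.done j hj i hi hij
        · exact hlD j ((hlm j).2 ⟨hj, by rw [← hij, hQ _ le_rfl]⟩)
      · have := pending_succ (v := v) (e := e) (O := O) (T := T) (Q := Q) (Q' := Q') (qh := qh)
          hlt (fun i hi hii => by have := hP.inj i (by omega) _ hb hii; omega) hQ
        simp only
        omega

end Prune

/-! ## Start edges -/

section Starts

variable {v e : ℕ} {O T dg uo : ℕ → ℕ} {W : ℕ} {σ : Mem}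

/-- An edge that lies on an infinite path. -/
def Live (e : ℕ) (T dg : ℕ → ℕ) (j : ℕ) : Prop := j < e ∧ dg (T j) ≠ 0

theorem LiveDeg.live_path (h : LiveDeg e O T dg) {F : ℕ → ℕ} (hF : NPath e O T F) (i : ℕ) :
    Live e T dg (F i) := by
  refine ⟨(hF i).1, ?_⟩
  rw [(hF i).2]
  exact h.path _ (hF.shift (i + 1))

theorem LiveDeg.deg_pos (h : LiveDeg e O T dg) {j : ℕ} (hj : Live e T dg j) : 0 < dg (O j) := by
  rw [h.deg]
  exact Finset.card_pos.2 ⟨j, by simpa using ⟨hj.1, hj.2⟩⟩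

theorem LiveDeg.unique (h : LiveDeg e O T dg) {i j : ℕ} (hi : Live e T dg i) (hj : Live e T dg j)
    (hij : O i = O j) (h1 : dg (O j) < 2) : i = j := by
  rw [h.deg] at h1
  exact Finset.card_le_one.1 (Nat.lt_succ_iff.1 h1) i (by simpa using ⟨hi.1, hij, hi.2⟩) j
    (by simpa using ⟨hj.1, hj.2⟩)

theorem LiveDeg.exists_next (h : LiveDeg e O T dg) {j : ℕ} (hj : Live e T dg j) :
    ∃ i, Live e T dg i ∧ O i = T j := by
  have := hj.2
  rw [h.deg] at this
  obtain ⟨i, hi⟩ := Finset.card_pos.1 (Nat.pos_of_ne_zero this)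
  simp only [Finset.mem_filter, Finset.mem_range] at hi
  exact ⟨i, ⟨hi.1, hi.2.2⟩, hi.2.1⟩

/-- `uo x` is a live edge with origin `x`, if there is one. -/
def LiveOut (e : ℕ) (O T dg uo : ℕ → ℕ) : Prop :=
  ∀ j, Live e T dg j → Live e T dg (uo (O j)) ∧ O (uo (O j)) = O j

/-- Choose a live outgoing edge of every vertex. -/
def chooseOut : Prog :=
  .loop (.lt 40 1) (.block [.load 41 1 40, .load 41 18 41,
    .ite (.lt 8 41) (.block [.load 42 0 40, .store 23 42 40]) .skip, .add 40 40 9])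

theorem chooseOut_run (hW : e + 1 ≤ W) (h1 : σ.reg 1 = e) (h8 : σ.reg 8 = 0) (h9 : σ.reg 9 = 1)
    (h40 : σ.reg 40 = 0) (hO : σ.arr 0 = O) (hT : σ.arr 1 = T) (hdg : σ.arr 18 = dg) :
    Run W chooseOut σ fun t σ' => t ≤ 12 * e + 1 ∧ LiveOut e O T dg (σ'.arr 23) := by
  have key := Run.loop (W := W) (σ := σ) (b := .lt 40 1) (p := .block [.load 41 1 40,
    .load 41 18 41, .ite (.lt 8 41) (.block [.load 42 0 40, .store 23 42 40]) .skip,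
    .add 40 40 9])
    (fun i σ => i ≤ e ∧ σ.reg 40 = i ∧ σ.reg 1 = e ∧ σ.reg 8 = 0 ∧ σ.reg 9 = 1 ∧ σ.arr 0 = O ∧
      σ.arr 1 = T ∧ σ.arr 18 = dg ∧ ∀ j < i, Live e T dg j →
        Live e T dg (σ.arr 23 (O j)) ∧ O (σ.arr 23 (O j)) = O j)
    (fun i => 12 * (e - i)) ?_ (a := 0) ⟨by omega, h40, h1, h8, h9, hO, hT, hdg, by simp⟩
  · refine key.mono ?_
    rintro t σ' ⟨i, ⟨hi, h40, h1, -, -, -, -, -, h⟩, hb, ht⟩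
    rw [Test.holds_lt, h40, h1] at hb
    obtain rfl : i = e := by omega
    exact ⟨by omega, fun j hj => h j hj.1 hj⟩
  · rintro i σ ⟨hi, h40, h1, h8, h9, hO, hT, hdg, h⟩ hb
    rw [Test.holds_lt, h40, h1] at hb
    rw [run_block_cons, run_load, run_block_cons, run_load, run_block_cons, run_ite]
    constructor
    · intro h0
      simp [h40, h8, hT, hdg] at h0
      rw [run_block_cons, run_load, run_block_cons, run_store, run_block_nil, run_block_cons,
        run_add, run_block_nil]
      refine ⟨by simp [h40, h9]; omega, i + 1, ⟨hb, by simp [h40, h9], by simp [h1], by simp [h8],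
        by simp [h9], by simp [hO], by simp [hT], by simp [hdg], ?_⟩, by omega⟩
      intro j hj hjl
      simp only [Mem.arr_setReg, Mem.arr_setArr, Mem.reg_setReg, hO, h40, reduceIte,
        Nat.reduceEqDiff, Function.update_apply]
      split_ifs with hji
      · exact ⟨⟨hb, h0.ne'⟩, hji.symm⟩
      · refine h j ?_ hjl
        rcases Nat.lt_succ_iff_lt_or_eq.1 hj with hj | rfl
        · exact hj
        · exact absurd rfl hji
    · intro h0
      simp [h40, h8, hT, hdg] at h0
      rw [run_skip, run_block_cons, run_add, run_block_nil]
      refine ⟨by simp [h40, h9]; omega, i + 1, ⟨hb, by simp [h40, h9], by simp [h1], by simp [h8],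
        by simp [h9], by simp [hO], by simp [hT], by simp [hdg], ?_⟩, by omega⟩
      intro j hj hjl
      rcases Nat.lt_succ_iff_lt_or_eq.1 hj with hj | rfl
      · exact h j hj hjl
      · exact absurd h0 hjl.2

/-- Along a path whose vertices have only one live outgoing edge, the next edge is the chosen one. -/
theorem LiveOut.next (hL : LiveDeg e O T dg) (h : LiveOut e O T dg uo) {F : ℕ → ℕ}
    (hF : NPath e O T F) {i : ℕ} (h1 : dg (T (F i)) = 1) : F (i + 1) = uo (T (F i)) := by
  have hl := hL.live_path hF (i + 1)
  obtain ⟨h2, h3⟩ := h _ hl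
  rw [(hF i).2] at h1 ⊢
  exact hL.unique hl h2 h3.symm (by rw [h3]; omega)

theorem LiveOut.live_next (hL : LiveDeg e O T dg) (h : LiveOut e O T dg uo) {j : ℕ}
    (hj : Live e T dg j) : Live e T dg (uo (T j)) ∧ O (uo (T j)) = T j := by
  obtain ⟨i, hi, hij⟩ := hL.exists_next hj
  rw [← hij]
  exact h i hi

/-! ### Circles without branching vertices -/

/-- The invariant of the search for circles without branching vertices. -/
structure Circles (e : ℕ) (O T dg uo : ℕ → ℕ) (i : ℕ) (mark cand : ℕ → ℕ) : Prop where
  mark_le : ∀ j, mark j ≤ i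
  mark_live : ∀ j, mark j ≠ 0 → Live e T dg j ∧ dg (T j) = 1
  marked : ∀ j < i, Live e T dg j → dg (T j) = 1 → mark j ≠ 0
  orbit : ∀ F, NPath e O T F → (∀ t, dg (T (F t)) = 1) → (∃ t, mark (F t) ≠ 0) →
    ∃ t, cand (F t) = 1
  cand_mark : ∀ c, cand c = 1 → mark c ≠ 0
  cycle : ∀ c, cand c = 1 → ∃ k, 0 < k ∧ (fun j => uo (T j))^[k] c = c ∧
    ∀ t, mark ((fun j => uo (T j))^[t] c) = mark c
  unique : ∀ c c', cand c = 1 → cand c' = 1 → mark c = mark c' → c = c'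

theorem Circles.zero : Circles e O T dg uo 0 (fun _ => 0) (fun _ => 0) where
  mark_le := by simp
  mark_live := by simp
  marked := by simp
  orbit := by simp
  cand_mark := by simp
  cycle := by simp
  unique := by simp

variable {i : ℕ} {mark cand : ℕ → ℕ}

/-- The state of a walk from the edge `i` along `n` unmarked edges. -/
structure Walk (e : ℕ) (O T dg uo : ℕ → ℕ) (i : ℕ) (mark : ℕ → ℕ) (n : ℕ) (mark' : ℕ → ℕ) :
    Prop where
  fresh : ∀ t < n, mark ((fun j => uo (T j))^[t] i) = 0 ∧ dg (T ((fun j => uo (T j))^[t] i)) = 1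
  live : ∀ t ≤ n, Live e T dg ((fun j => uo (T j))^[t] i)
  new : ∀ t < n, mark' ((fun j => uo (T j))^[t] i) = i + 1
  old : ∀ j, (∀ t < n, (fun j => uo (T j))^[t] i ≠ j) → mark' j = mark j

theorem Walk.mark_eq {n : ℕ} {mark' : ℕ → ℕ} (h : Walk e O T dg uo i mark n mark') (j : ℕ) :
    (∃ t < n, (fun j => uo (T j))^[t] i = j ∧ mark j = 0 ∧ mark' j = i + 1) ∨
      mark' j = mark j := by
  by_cases hj : ∃ t < n, (fun j => uo (T j))^[t] i = j
  · obtain ⟨t, ht, rfl⟩ := hj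
    exact Or.inl ⟨t, ht, rfl, (h.fresh t ht).1, h.new t ht⟩
  · push Not at hj
    exact Or.inr (h.old j hj)

theorem Walk.step (hL : LiveDeg e O T dg) (hU : LiveOut e O T dg uo) {n : ℕ} {mark' : ℕ → ℕ}
    (h : Walk e O T dg uo i mark n mark')
    (h0 : mark' ((fun j => uo (T j))^[n] i) = 0) (h1 : dg (T ((fun j => uo (T j))^[n] i)) = 1) :
    Walk e O T dg uo i mark (n + 1)
      (Function.update mark' ((fun j => uo (T j))^[n] i) (i + 1)) := by
  have hne : ∀ t < n, (fun j => uo (T j))^[t] i ≠ (fun j => uo (T j))^[n] i := by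
    intro t ht heq
    have := h.new t ht
    rw [heq, h0] at this
    omega
  refine ⟨?_, ?_, ?_, ?_⟩
  · intro t ht
    rcases Nat.lt_succ_iff_lt_or_eq.1 ht with ht | rfl
    · exact h.fresh t ht
    · refine ⟨?_, h1⟩
      rw [← h.old _ fun s hs => hne s hs, h0]
  · intro t ht
    rcases Nat.le_succ_iff.1 ht with ht | rfl
    · exact h.live t ht
    · rw [Function.iterate_succ_apply']
      exact (hU.live_next hL (h.live n le_rfl)).1
  · intro t ht
    rcases Nat.lt_succ_iff_lt_or_eq.1 ht with ht | rfl
    · rw [Function.update_of_ne (hne t ht), h.new t ht]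
    · simp
  · intro j hj
    rw [Function.update_of_ne (hj n (by omega)).symm]
    exact h.old j fun t ht => hj t (by omega)

/-- The walk has ended; its last edge becomes a candidate if it has been visited by the walk. -/
theorem Circles.succ (hL : LiveDeg e O T dg) (hU : LiveOut e O T dg uo)
    (h : Circles e O T dg uo i mark cand) {n : ℕ} {mark' cand' : ℕ → ℕ}
    (hw : Walk e O T dg uo i mark n mark')
    (hend : mark' ((fun j => uo (T j))^[n] i) ≠ 0 ∨ dg (T ((fun j => uo (T j))^[n] i)) ≠ 1)
    (hc : ∀ c, cand' c = 1 ↔ cand c = 1 ∨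
      (c = (fun j => uo (T j))^[n] i ∧ mark' ((fun j => uo (T j))^[n] i) = i + 1)) :
    Circles e O T dg uo (i + 1) mark' cand' := by
  have hkeep : ∀ j, mark j ≠ 0 → mark' j = mark j := by
    intro j hj
    rcases hw.mark_eq j with ⟨t, _, _, h0, _⟩ | h
    · exact absurd h0 hj
    · exact h
  have hlast : mark' ((fun j => uo (T j))^[n] i) = i + 1 →
      ∃ s < n, (fun j => uo (T j))^[s] i = (fun j => uo (T j))^[n] i := by
    intro hm
    rcases hw.mark_eq ((fun j => uo (T j))^[n] i) with ⟨t, ht, h1, _⟩ | h'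
    · exact ⟨t, ht, h1⟩
    · have := h.mark_le ((fun j => uo (T j))^[n] i)
      omega
  refine ⟨?_, ?_, ?_, ?_, ?_, ?_, ?_⟩
  · intro j
    have := h.mark_le j
    rcases hw.mark_eq j with ⟨t, _, _, _, h1⟩ | h1 <;> omega
  · intro j hj
    rcases hw.mark_eq j with ⟨t, ht, rfl, _, _⟩ | h1
    · exact ⟨hw.live t ht.le, (hw.fresh t ht).2⟩
    · exact h.mark_live j (by rwa [← h1])
  · intro j hj hl h1
    rcases Nat.lt_succ_iff_lt_or_eq.1 hj with hj | rfl
    · have := h.marked j hj hl h1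
      rwa [hkeep j this]
    · rcases Nat.eq_zero_or_pos n with rfl | hn
      · rcases hend with h2 | h2
        · exact h2
        · exact absurd h1 h2
      · have := hw.new 0 hn
        simp only [Function.iterate_zero, id_eq] at this
        omega
  · rintro F hF hF1 ⟨t, ht⟩
    have hold : (∃ t, mark (F t) ≠ 0) → ∃ t, cand' (F t) = 1 := fun hex => by
      obtain ⟨t, ht⟩ := h.orbit F hF hF1 hex
      exact ⟨t, (hc _).2 (Or.inl ht)⟩
    rcases hw.mark_eq (F t) with ⟨s, hs, hst, _, _⟩ | h1
    -- A path without choices that meets the walk follows it to its end. There it is at a new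
    -- candidate, or at an edge marked by an earlier walk, whose candidate lies ahead on the path;
    -- an end at a vertex that is not passed in a unique way is impossible.
    · have hfol : ∀ u, F (t + u) = (fun j => uo (T j))^[s + u] i := by
        intro u
        induction u with
        | zero => exact hst.symm
        | succ u ih =>
          rw [← add_assoc, ← add_assoc, Function.iterate_succ_apply', ← ih]
          exact hU.next hL hF (hF1 _)
      have hcur := hfol (n - s)
      rw [show s + (n - s) = n by omega] at hcur
      rcases hend with h2 | h2
      · rcases hw.mark_eq ((fun j => uo (T j))^[n] i) with ⟨_, _, _, _, h3⟩ | h3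
        · exact ⟨t + (n - s), (hc _).2 (Or.inr ⟨hcur, h3⟩)⟩
        · exact hold ⟨t + (n - s), by rw [hcur, ← h3]; exact h2⟩
      · rw [← hcur] at h2
        exact absurd (hF1 _) h2
    · exact hold ⟨t, by rwa [← h1]⟩
  · intro c hcc
    rcases (hc c).1 hcc with h1 | ⟨rfl, h1⟩
    · have := h.cand_mark c h1
      rwa [hkeep c this]
    · omega
  · intro c hcc
    rcases (hc c).1 hcc with h1 | ⟨rfl, h1⟩
    · obtain ⟨k, hk, hk1, hk2⟩ := h.cycle c h1
      have h0 := h.cand_mark c h1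
      refine ⟨k, hk, hk1, fun t => ?_⟩
      rw [hkeep _ (by rw [hk2 t]; exact h0), hkeep c h0, hk2 t]
    · obtain ⟨s, hs, hs1⟩ := hlast h1
      -- The walk has returned to the edge of its step `s`, so from there on it is periodic with
      -- period `n - s`, inside the part marked by `i + 1`.
      have hcyc : (fun j => uo (T j))^[n - s] ((fun j => uo (T j))^[n] i) =
          (fun j => uo (T j))^[n] i := by
        conv_lhs => rw [← hs1]
        rw [← Function.iterate_add_apply]
        congr 1; omega
      refine ⟨n - s, by omega, hcyc, fun t => ?_⟩
      have hp : Function.IsPeriodicPt (fun j => uo (T j)) (n - s)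
        ((fun j => uo (T j))^[n] i) := hcyc
      have hmod := hp.iterate_mod_apply t
      rw [← hmod, h1]
      conv_lhs => rw [← hs1]
      rw [← Function.iterate_add_apply]
      apply hw.new
      have := Nat.mod_lt t (show 0 < n - s by omega)
      omega
  · intro c c' hcc hcc' hm
    rcases (hc c).1 hcc with h1 | ⟨rfl, h1⟩ <;> rcases (hc c').1 hcc' with h1' | ⟨rfl, h1'⟩
    · rw [hkeep c (h.cand_mark c h1), hkeep c' (h.cand_mark c' h1')] at hm
      exact h.unique c c' h1 h1' hm
    · rw [hkeep c (h.cand_mark c h1)] at hm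
      have := h.mark_le c
      omega
    · rw [hkeep c' (h.cand_mark c' h1')] at hm
      have := h.mark_le c'
      omega
    · rfl

/-- The part of the memory that the search for circles uses. -/
structure CircleMem (e : ℕ) (T dg uo : ℕ → ℕ) (i : ℕ) (mark cand : ℕ → ℕ) (σ : Mem) : Prop where
  r1 : σ.reg 1 = e
  r8 : σ.reg 8 = 0
  r9 : σ.reg 9 = 1
  r50 : σ.reg 50 = i
  aT : σ.arr 1 = T
  adg : σ.arr 18 = dg
  amark : σ.arr 22 = mark
  auo : σ.arr 23 = uo
  acand : σ.arr 24 = cand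

/-- Walk from the edge in register `51`, marking edges by the number in register `52`. -/
def walkCircle : Prog :=
  .loop (.eq 53 9) (.block [.load 54 22 51, .ite (.eq 54 8)
    (.block [.load 55 1 51, .load 56 18 55, .ite (.eq 56 9)
      (.block [.store 22 51 52, .load 51 23 55]) (.copy 53 8)]) (.copy 53 8)])

/-- Every round but the last marks a fresh edge, so all walks together are paid for by the unmarked
edges. The flag in register `53` pays for the last round. -/
theorem walkCircle_run (hL : LiveDeg e O T dg) (hU : LiveOut e O T dg uo) {mark₀ : ℕ → ℕ}
    (hM : CircleMem e T dg uo i mark₀ cand σ) (hi : Live e T dg i)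
    (h51 : σ.reg 51 = i) (h52 : σ.reg 52 = i + 1) (h53 : σ.reg 53 = 1) :
    Run W walkCircle σ fun t σ' => ∃ n mark', CircleMem e T dg uo i mark' cand σ' ∧
      σ'.reg 51 = (fun j => uo (T j))^[n] i ∧ σ'.reg 52 = i + 1 ∧
      Walk e O T dg uo i mark₀ n mark' ∧
      (mark' ((fun j => uo (T j))^[n] i) ≠ 0 ∨ dg (T ((fun j => uo (T j))^[n] i)) ≠ 1) ∧
      t + 12 * ((Finset.range e).filter fun j => mark' j = 0).card ≤
        12 * ((Finset.range e).filter fun j => mark₀ j = 0).card + 15 := by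
  have key := Run.loop (W := W) (σ := σ) (b := .eq 53 9) (p := .block [.load 54 22 51,
    .ite (.eq 54 8) (.block [.load 55 1 51, .load 56 18 55, .ite (.eq 56 9)
      (.block [.store 22 51 52, .load 51 23 55]) (.copy 53 8)]) (.copy 53 8)])
    (fun (a : ℕ × ℕ × (ℕ → ℕ)) σ => CircleMem e T dg uo i a.2.2 cand σ ∧ σ.reg 53 = a.1 ∧
      (a.1 = 0 ∨ a.1 = 1) ∧ σ.reg 51 = (fun j => uo (T j))^[a.2.1] i ∧ σ.reg 52 = i + 1 ∧
      Walk e O T dg uo i mark₀ a.2.1 a.2.2 ∧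
      (a.1 = 0 → a.2.2 ((fun j => uo (T j))^[a.2.1] i) ≠ 0 ∨
        dg (T ((fun j => uo (T j))^[a.2.1] i)) ≠ 1))
    (fun a => 12 * ((Finset.range e).filter fun j => a.2.2 j = 0).card + 12 * a.1) ?_
    (a := (1, 0, mark₀)) ⟨hM, h53, Or.inr rfl, by simpa using h51, h52,
      ⟨by simp, fun t ht => by simpa [Nat.le_zero.1 ht] using hi, by simp, fun _ _ => rfl⟩, by simp⟩
  · refine key.mono ?_
    rintro t σ' ⟨⟨g, n, mark'⟩, ⟨hM, h53, hg, h51, h52, hw, hend⟩, hb, ht⟩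
    simp only at hM h53 hg h51 h52 hw hend ht
    rw [Test.holds_eq, h53, hM.r9] at hb
    have hg0 : g = 0 := by omega
    exact ⟨n, mark', hM, h51, h52, hw, hend hg0, by omega⟩
  · rintro ⟨g, n, mark'⟩ σ ⟨hM, h53, hg, h51, h52, hw, hend⟩ hb
    simp only at hM h53 hg h51 h52 hw hend
    rw [Test.holds_eq, h53, hM.r9] at hb
    subst hb
    obtain ⟨r1, r8, r9, r50, aT, adg, amark, auo, acand⟩ := hM
    set cur := (fun j => uo (T j))^[n] i with hcur
    rw [run_block_cons, run_load, run_block_cons, run_ite]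
    constructor
    · intro h0
      simp [h51, amark, r8] at h0
      rw [run_block_cons, run_load, run_block_cons, run_load, run_block_cons, run_ite]
      constructor
      · intro h1
        simp [h51, aT, adg, r9] at h1
        rw [run_block_cons, run_store, run_block_cons, run_load, run_block_nil, run_block_nil,
          run_block_nil]
        refine ⟨(1, n + 1, Function.update mark' cur (i + 1)), ⟨?_, by simp [h53], Or.inr rfl, ?_,
          by simp [h52], hw.step hL hU h0 h1, by simp⟩, ?_⟩
        · constructor <;> simp [*]
        · simp only [Function.iterate_succ_apply']
          simp [h51, aT, auo, hcur]
        · have hlt := (hw.live n le_rfl).1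
          have : ((Finset.range e).filter fun j => Function.update mark' cur (i + 1) j = 0) =
              ((Finset.range e).filter fun j => mark' j = 0).erase cur := by
            ext j
            simp only [Finset.mem_filter, Finset.mem_erase, Function.update_apply]
            split_ifs with hj
            · simp [hj]
            · simp [hj]
          simp only
          rw [this]
          have := Finset.card_erase_add_one (s := (Finset.range e).filter fun j => mark' j = 0)
            (a := cur) (by simpa using ⟨hlt, h0⟩)
          omega
      · intro h1
        simp [h51, aT, adg, r9] at h1
        rw [run_copy, run_block_nil, run_block_nil]
        refine ⟨(0, n, mark'), ⟨?_, by simp [r8], Or.inl rfl, by simp [h51, hcur], by simp [h52],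
          hw, fun _ => Or.inr h1⟩, by simp only; omega⟩
        constructor <;> simp [*]
    · intro h0
      simp [h51, amark, r8] at h0
      rw [run_copy, run_block_nil]
      refine ⟨(0, n, mark'), ⟨?_, by simp [r8], Or.inl rfl, by simp [h51, hcur], by simp [h52],
        hw, fun _ => Or.inl h0⟩, by simp only; omega⟩
      constructor <;> simp [*]

end Starts

section Starts

variable {v e : ℕ} {O T dg uo : ℕ → ℕ} {W : ℕ} {σ : Mem} {i : ℕ} {mark cand : ℕ → ℕ}

theorem Circles.skip (h : Circles e O T dg uo i mark cand) (hi : ¬ Live e T dg i) :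
    Circles e O T dg uo (i + 1) mark cand := by
  refine { h with mark_le := fun j => (h.mark_le j).trans (by omega), marked := ?_ }
  intro j hj hl
  rcases Nat.lt_succ_iff_lt_or_eq.1 hj with hj | rfl
  · exact h.marked j hj hl
  · exact absurd hl hi

/-- Mark an edge on every circle without branching vertices. -/
def findCircles : Prog :=
  .loop (.lt 50 1) (.block [.load 44 1 50, .load 44 18 44, .ite (.lt 8 44)
    (.block [.copy 51 50, .add 52 50 9, .copy 53 9, walkCircle, .load 54 22 51,
      .ite (.eq 54 52) (.store 24 51 9) .skip]) .skip, .add 50 50 9])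

theorem findCircles_run (hW : e + 1 ≤ W) (hL : LiveDeg e O T dg) (hU : LiveOut e O T dg uo)
    (hM : CircleMem e T dg uo 0 (fun _ => 0) (fun _ => 0) σ) :
    Run W findCircles σ fun t σ' => t ≤ 62 * e + 1 ∧
      ∃ mark, Circles e O T dg uo e mark (σ'.arr 24) := by
  have key := Run.loop (W := W) (σ := σ) (b := .lt 50 1) (p := .block [.load 44 1 50,
    .load 44 18 44, .ite (.lt 8 44) (.block [.copy 51 50, .add 52 50 9, .copy 53 9, walkCircle,
      .load 54 22 51, .ite (.eq 54 52) (.store 24 51 9) .skip]) .skip, .add 50 50 9])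
    (fun (a : ℕ × (ℕ → ℕ) × (ℕ → ℕ)) σ => a.1 ≤ e ∧ CircleMem e T dg uo a.1 a.2.1 a.2.2 σ ∧
      Circles e O T dg uo a.1 a.2.1 a.2.2)
    -- A fixed cost for each starting edge, and `12` for each edge that is still to be marked.
    (fun a => 50 * (e - a.1) + 12 * ((Finset.range e).filter fun j => a.2.1 j = 0).card) ?_
    (a := (0, fun _ => 0, fun _ => 0)) ⟨by simp, hM, Circles.zero⟩
  · refine key.mono ?_
    rintro t σ' ⟨⟨i, mark, cand⟩, ⟨hi, hM, hC⟩, hb, ht⟩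
    simp only at hi hM hC ht
    rw [Test.holds_lt, hM.r50, hM.r1] at hb
    obtain rfl : i = e := by omega
    refine ⟨?_, mark, hM.acand ▸ hC⟩
    simp only [Finset.filter_true, Finset.card_range] at ht
    omega
  · rintro ⟨i, mark, cand⟩ σ ⟨hi, hM, hC⟩ hb
    simp only at hi hM hC
    rw [Test.holds_lt, hM.r50, hM.r1] at hb
    have hM' := hM
    obtain ⟨r1, r8, r9, r50, aT, adg, amark, auo, acand⟩ := hM
    rw [run_block_cons, run_load, run_block_cons, run_load, run_block_cons, run_ite]
    constructor
    · intro h0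
      simp [r50, r8, aT, adg] at h0
      have hil : Live e T dg i := ⟨hb, h0.ne'⟩
      rw [run_block_cons, run_copy, run_block_cons, run_add, run_block_cons, run_copy]
      refine ⟨by simp [r50, r9]; omega, ?_⟩
      refine Run.block_cons (walkCircle_run (i := i) (cand := cand) (mark₀ := mark) hL hU
        ?_ hil (by simp [r50]) (by simp [r50, r9]) (by simp [r9])) ?_
      · constructor <;> simp [*]
      rintro t₁ σ₁ ⟨n, mark', hM₁, h51, h52, hw, hend, ht⟩ -
      obtain ⟨r1, r8, r9, r50, aT, adg, amark, auo, acand⟩ := hM₁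
      rw [run_block_cons, run_load, run_block_cons, run_ite]
      constructor
      · intro h1
        simp [h51, h52, amark] at h1
        rw [run_store, run_block_nil, run_block_cons, run_add, run_block_nil]
        refine ⟨by simp [r50, r9]; omega, (i + 1, mark', Function.update cand
          ((fun j => uo (T j))^[n] i) 1), ⟨hb, ?_, hC.succ hL hU hw hend ?_⟩, by simp only; omega⟩
        · constructor <;> simp [*]
        · intro c
          simp only [Function.update_apply]
          split_ifs with hc
          · simp [hc, h1]
          · simp [hc]
      · intro h1
        simp [h51, h52, amark] at h1
        rw [run_skip, run_block_nil, run_block_cons, run_add, run_block_nil]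
        refine ⟨by simp [r50, r9]; omega, (i + 1, mark', cand), ⟨hb, ?_,
          hC.succ hL hU hw hend ?_⟩, by simp only; omega⟩
        · constructor <;> simp [*]
        · intro c
          simp [h1]
    · intro h0
      simp [r50, r8, aT, adg] at h0
      rw [run_skip, run_block_cons, run_add, run_block_nil]
      refine ⟨by simp [r50, r9]; omega, (i + 1, mark, cand), ⟨hb, ?_,
        hC.skip fun h => h.2 h0⟩, by simp only; omega⟩
      constructor <;> simp [*]

end Starts

/-! ## Minimal periods of words -/

section Borders

variable {W : ℕ} {σ : Mem} {x : ℕ → ℕ}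

/-- The prefix of length `k` is a proper border of the prefix of length `i` of `x`. -/
def Border (x : ℕ → ℕ) (i k : ℕ) : Prop := k < i ∧ ∀ t < k, x t = x (i - k + t)

/-- The length of the longest proper border of the prefix of length `i`. -/
def LongestBorder (x : ℕ → ℕ) (i k : ℕ) : Prop := Border x i k ∧ ∀ k', Border x i k' → k' ≤ k

theorem Border.zero {i : ℕ} (hi : 0 < i) : Border x i 0 := ⟨hi, by simp⟩

theorem Border.succ_iff {i k : ℕ} : Border x (i + 1) (k + 1) ↔ Border x i k ∧ x k = x i := by
  constructor
  · rintro ⟨h1, h2⟩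
    have hki : k < i := by omega
    refine ⟨⟨hki, fun t ht => ?_⟩, ?_⟩
    · have := h2 t (by omega)
      rwa [show i + 1 - (k + 1) = i - k by omega] at this
    · have := h2 k (by omega)
      rwa [show i + 1 - (k + 1) + k = i by omega] at this
  · rintro ⟨⟨h1, h2⟩, h3⟩
    refine ⟨by omega, fun t ht => ?_⟩
    rw [show i + 1 - (k + 1) = i - k by omega]
    rcases Nat.lt_succ_iff_lt_or_eq.1 ht with ht | rfl
    · exact h2 t ht
    · rw [h3, Nat.sub_add_cancel h1.le]

theorem Border.trans {i k l : ℕ} (h : Border x i k) (h' : Border x k l) : Border x i l := by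
  obtain ⟨h1, h2⟩ := h
  obtain ⟨h3, h4⟩ := h'
  refine ⟨by omega, fun t ht => ?_⟩
  rw [h4 t ht, h2 _ (by omega), show i - k + (k - l + t) = i - l + t by omega]

/-- Borders of one prefix are nested. Hence all borders are reached by passing repeatedly to the
longest border. -/
theorem Border.of_lt {i k l : ℕ} (h : Border x i k) (h' : Border x i l) (hlk : l < k) :
    Border x k l := by
  obtain ⟨h1, h2⟩ := h
  obtain ⟨h3, h4⟩ := h'
  refine ⟨hlk, fun t ht => ?_⟩
  rw [h4 t ht, h2 (k - l + t) (by omega), show i - k + (k - l + t) = i - l + t by omega]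

/-- `p` is the minimal period of the prefix of length `L` of `x`. -/
structure WordPeriod (x : ℕ → ℕ) (L p : ℕ) : Prop where
  pos : 0 < p
  le : p ≤ L
  period : ∀ t, t + p < L → x (t + p) = x t
  min : ∀ n, 0 < n → (∀ t, t + n < L → x (t + n) = x t) → p ≤ n

/-- A word agrees with its shift by `n` on the overlap exactly if it has a border of length `L - n`,
so the longest border corresponds to the shortest period. -/
theorem LongestBorder.wordPeriod {L k : ℕ} (h : LongestBorder x L k) :
    WordPeriod x L (L - k) := by
  obtain ⟨⟨h1, h2⟩, h3⟩ := h
  refine ⟨by omega, by omega, fun t ht => ?_, fun n hn hp => ?_⟩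
  · rw [h2 t (by omega), add_comm]
  · by_cases hnL : n < L
    · have := h3 (L - n) ⟨by omega, fun t ht => by
        rw [show L - (L - n) + t = t + n by omega]
        exact (hp t (by omega)).symm⟩
      omega
    · omega

/-- Compute the minimal period of the word in array `25`, whose length is in register `61`. -/
def wordPeriod : Prog :=
  .block [.copy 86 9, .copy 87 8, .store 26 9 8, .loop (.lt 86 61) (.block [.load 88 25 87,
    .load 89 25 86, .ite (.eq 88 89) (.block [.add 87 87 9, .add 86 86 9, .store 26 86 87])
      (.ite (.eq 87 8) (.block [.add 86 86 9, .store 26 86 8]) (.load 87 26 87))]),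
    .load 87 26 61, .sub 62 61 87]

/-- The state of the search for borders. -/
structure BorderMem (x : ℕ → ℕ) (L i k : ℕ) (σ : Mem) : Prop where
  r8 : σ.reg 8 = 0
  r9 : σ.reg 9 = 1
  r61 : σ.reg 61 = L
  r86 : σ.reg 86 = i
  r87 : σ.reg 87 = k
  ax : σ.arr 25 = x
  le : i ≤ L
  border : Border x i k
  longest : ∀ j, 0 < j → j ≤ i → LongestBorder x j (σ.arr 26 j)
  max : ∀ l, Border x (i + 1) (l + 1) → l ≤ k

theorem wordPeriod_run {L : ℕ} (hW : L ≤ W) (hL : 0 < L) (h8 : σ.reg 8 = 0) (h9 : σ.reg 9 = 1)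
    (h61 : σ.reg 61 = L) (hx : σ.arr 25 = x) :
    Run W wordPeriod σ fun t σ' => t ≤ 24 * L + 10 ∧ WordPeriod x L (σ'.reg 62) := by
  rw [wordPeriod, run_block_cons, run_copy, run_block_cons, run_copy, run_block_cons, run_store]
  have key := Run.loop (W := W) (b := .lt 86 61) (p := .block [.load 88 25 87,
    .load 89 25 86, .ite (.eq 88 89) (.block [.add 87 87 9, .add 86 86 9, .store 26 86 87])
      (.ite (.eq 87 8) (.block [.add 86 86 9, .store 26 86 8]) (.load 87 26 87))])
    (σ := (((σ.setReg 86 (σ.reg 9)).setReg 87 ((σ.setReg 86 (σ.reg 9)).reg 8)).setArr 26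
      (((σ.setReg 86 (σ.reg 9)).setReg 87 ((σ.setReg 86 (σ.reg 9)).reg 8)).reg 9)
      (((σ.setReg 86 (σ.reg 9)).setReg 87 ((σ.setReg 86 (σ.reg 9)).reg 8)).reg 8)))
    (fun (a : ℕ × ℕ) σ => BorderMem x L a.1 a.2 σ)
    -- Advancing the prefix gains `2` and lengthens the border by at most one; falling back shortens
    -- the border. This makes the computation linear.
    (fun a => 12 * (2 * (L - a.1) + a.2)) ?_ (a := (1, 0)) ?_
  · refine Run.block_cons key ?_
    rintro t σ' ⟨⟨i, k⟩, hM, hb, ht⟩ -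
    simp only at hM ht
    rw [Test.holds_lt, hM.r86, hM.r61] at hb
    obtain rfl : i = L := by have := hM.le; omega
    rw [run_block_cons, run_load, run_block_cons, run_sub, run_block_nil]
    refine ⟨by omega, ?_⟩
    have := hM.longest i hL le_rfl
    simpa [hM.r61] using this.wordPeriod
  · rintro ⟨i, k⟩ σ hM hb
    simp only at hM
    have hM' := hM
    obtain ⟨r8, r9, r61, r86, r87, ax, hle, hbord, hlong, hmax⟩ := hM
    rw [Test.holds_lt, r86, r61] at hb
    have hki := hbord.1
    have hext : ∀ b, LongestBorder x (i + 1) b → ∀ j, 0 < j → j ≤ i + 1 →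
        LongestBorder x j (Function.update (σ.arr 26) (i + 1) b j) := by
      intro b hb' j hj hji
      rcases Nat.le_succ_iff.1 hji with h | rfl
      · rw [Function.update_of_ne (by omega)]; exact hlong j hj h
      · simpa using hb'
    rw [run_block_cons, run_load, run_block_cons, run_load, run_block_cons, run_ite]
    constructor
    · intro h1
      simp [r86, r87, ax] at h1
      rw [run_block_cons, run_add]
      refine ⟨by simp [r87, r9]; omega, ?_⟩
      rw [run_block_cons, run_add]
      refine ⟨by simp [r86, r9]; omega, ?_⟩
      rw [run_block_cons, run_store, run_block_nil, run_block_nil]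
      have hnew : Border x (i + 1) (k + 1) := Border.succ_iff.2 ⟨hbord, h1⟩
      have hnew' : LongestBorder x (i + 1) (k + 1) := ⟨hnew, fun l hl => by
        rcases l with _ | l
        · omega
        · have := hmax l hl; omega⟩
      refine ⟨(i + 1, k + 1), ⟨by simp [r8], by simp [r9], by simp [r61], by simp [r86, r9],
        by simp [r87, r9], by simp [ax], hb, hnew, ?_, ?_⟩, by simp only; omega⟩
      · simpa [r86, r87, r9] using hext _ hnew'
      · intro l hl
        exact hnew'.2 l (Border.succ_iff.1 hl).1
    · intro h1
      simp [r86, r87, ax] at h1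
      rw [run_ite]
      constructor
      · intro h2
        simp [r87, r8] at h2
        subst h2
        rw [run_block_cons, run_add]
        refine ⟨by simp [r86, r9]; omega, ?_⟩
        rw [run_block_cons, run_store, run_block_nil, run_block_nil]
        have hnew' : LongestBorder x (i + 1) 0 := ⟨Border.zero (by omega), fun l hl => by
          rcases l with _ | l
          · omega
          · have := hmax l hl
            obtain rfl : l = 0 := by omega
            exact absurd (Border.succ_iff.1 hl).2 h1⟩
        refine ⟨(i + 1, 0), ⟨by simp [r8], by simp [r9], by simp [r61], by simp [r86, r9],
          by simp [r87], by simp [ax], hb, hnew'.1, ?_, ?_⟩, by simp only; omega⟩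
        · simpa [r86, r8, r9] using hext _ hnew'
        · intro l hl
          exact hnew'.2 l (Border.succ_iff.1 hl).1
      · intro h2
        simp [r87, r8] at h2
        rw [run_load, run_block_nil]
        -- The border of length `k` cannot be extended; the next candidate is its own longest
        -- border, and no candidate in between is missed, as borders are nested.
        have hBk := hlong k (by omega) hki.le
        have hlt := hBk.1.1
        refine ⟨(i, σ.arr 26 k), ⟨by simp [r8], by simp [r9], by simp [r61], by simp [r86],
          by simp [r87], by simp [ax], hle, hbord.trans hBk.1, by simpa using hlong, ?_⟩,
          by simp only; omega⟩
        intro l hl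
        obtain ⟨h3, h4⟩ := Border.succ_iff.1 hl
        have h5 := hmax l hl
        have h6 : l ≠ k := by rintro rfl; exact h1 h4
        exact hBk.2 l (hbord.of_lt h3 (by omega))
  · refine ⟨by simp [h8], by simp [h9], by simp [h61], by simp [h9], by simp [h8], by simp [hx],
      hL, Border.zero one_pos, ?_, ?_⟩
    · intro j hj hj1
      obtain rfl : j = 1 := by simp only at hj1; omega
      simp only [Mem.arr_setArr, Mem.reg_setReg, h8, h9, reduceIte, Nat.reduceEqDiff,
        Function.update_self]
      exact ⟨Border.zero one_pos, fun l hl => by have := hl.1; omega⟩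
    · intro l hl
      have := hl.1
      simp only at this ⊢
      omega

end Borders

/-! ## Segments -/

section Segment

variable {e : ℕ} {O T dg uo G : ℕ → ℕ} {W : ℕ} {σ : Mem} {s : ℕ}

/-- `L` is the number of steps that can be made from `s` without choice, up to `e`. -/
structure SegmentLength (e : ℕ) (T dg uo : ℕ → ℕ) (s L : ℕ) : Prop where
  pos : 0 < L
  le : L ≤ e
  unique : ∀ t, t + 1 < L → dg (T ((fun j => uo (T j))^[t] s)) = 1
  last : L = e ∨ dg (T ((fun j => uo (T j))^[L - 1] s)) ≠ 1

/-- Write the labels of the segment that starts with the edge in register `60` to array `25`. -/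
def walkSegment : Prog :=
  .block [.copy 61 8, .copy 57 9, .copy 56 60, .loop (.eq 57 9) (.block [.load 58 3 56,
    .store 25 61 58, .add 61 61 9, .load 58 1 56, .load 59 18 58,
    .ite (.eq 59 9) (.load 56 23 58) (.copy 57 8),
    .ite (.lt 61 1) .skip (.copy 57 8)])]

/-- The state of a walk along a segment. -/
structure SegmentMem (e : ℕ) (T dg uo G : ℕ → ℕ) (s L g : ℕ) (σ : Mem) : Prop where
  r1 : σ.reg 1 = e
  r8 : σ.reg 8 = 0
  r9 : σ.reg 9 = 1
  r57 : σ.reg 57 = g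
  r61 : σ.reg 61 = L
  aT : σ.arr 1 = T
  aG : σ.arr 3 = G
  adg : σ.arr 18 = dg
  auo : σ.arr 23 = uo
  label : ∀ t < L, σ.arr 25 t = G ((fun j => uo (T j))^[t] s)

/-- The cap `e` on the length is needed for segments that run into a circle without branching and
would never end. -/
theorem walkSegment_run (hW : e ≤ W) (he : 0 < e) (h1 : σ.reg 1 = e) (h8 : σ.reg 8 = 0)
    (h9 : σ.reg 9 = 1) (h60 : σ.reg 60 = s) (hT : σ.arr 1 = T) (hG : σ.arr 3 = G)
    (hdg : σ.arr 18 = dg) (huo : σ.arr 23 = uo) :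
    Run W walkSegment σ fun t σ' => t ≤ 20 * e + 10 ∧ ∃ L, σ'.reg 61 = L ∧
      SegmentLength e T dg uo s L ∧
      ∀ t < L, σ'.arr 25 t = G ((fun j => uo (T j))^[t] s) := by
  rw [walkSegment, run_block_cons, run_copy, run_block_cons, run_copy, run_block_cons, run_copy]
  have key := Run.loop (W := W) (b := .eq 57 9) (p := .block [.load 58 3 56,
    .store 25 61 58, .add 61 61 9, .load 58 1 56, .load 59 18 58,
    .ite (.eq 59 9) (.load 56 23 58) (.copy 57 8),
    .ite (.lt 61 1) .skip (.copy 57 8)])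
    (σ := ((σ.setReg 61 (σ.reg 8)).setReg 57 ((σ.setReg 61 (σ.reg 8)).reg 9)).setReg 56
      (((σ.setReg 61 (σ.reg 8)).setReg 57 ((σ.setReg 61 (σ.reg 8)).reg 9)).reg 60))
    (fun (a : ℕ × ℕ) σ => SegmentMem e T dg uo G s a.1 a.2 σ ∧
      (∀ t, t + 1 < a.1 → dg (T ((fun j => uo (T j))^[t] s)) = 1) ∧
      ((a.2 = 1 ∧ a.1 < e ∧ σ.reg 56 = (fun j => uo (T j))^[a.1] s ∧
        (∀ t < a.1, dg (T ((fun j => uo (T j))^[t] s)) = 1)) ∨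
       (a.2 = 0 ∧ SegmentLength e T dg uo s a.1)))
    (fun a => 18 * (e - a.1) + a.2) ?_ (a := (0, 1)) ?_
  · refine Run.block_cons key ?_
    rintro t σ' ⟨⟨L, g⟩, ⟨hM, hu, hg⟩, hb, ht⟩ -
    simp only at hM hg ht
    rw [Test.holds_eq, hM.r57, hM.r9] at hb
    rw [run_block_nil]
    rcases hg with ⟨hg, _⟩ | ⟨-, hS⟩
    · exact absurd hg hb
    · exact ⟨by omega, L, hM.r61, hS, hM.label⟩
  · rintro ⟨L, g⟩ σ ⟨hM, hu, hg⟩ hb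
    simp only at hM hu hg
    obtain ⟨r1, r8, r9, r57, r61, aT, aG, adg, auo, hlab⟩ := hM
    rw [Test.holds_eq, r57, r9] at hb
    subst hb
    rcases hg with ⟨-, hLe, h56, hall⟩ | ⟨h, -⟩
    swap
    · omega
    have hlab' : ∀ t ≤ L, Function.update (σ.arr 25) L (G ((fun j => uo (T j))^[L] s)) t =
        G ((fun j => uo (T j))^[t] s) := by
      intro t ht
      rcases Nat.lt_or_eq_of_le ht with ht | rfl
      · rw [Function.update_of_ne (by omega)]; exact hlab t ht
      · simp
    rw [run_block_cons, run_load, run_block_cons, run_store, run_block_cons, run_add]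
    refine ⟨by simp [r61, r9]; omega, ?_⟩
    rw [run_block_cons, run_load, run_block_cons, run_load, run_block_cons, run_ite]
    constructor
    · intro h1
      simp [h56, aT, adg, r9] at h1
      rw [run_load, run_block_cons, run_ite]
      have hall' : ∀ t < L + 1, dg (T ((fun j => uo (T j))^[t] s)) = 1 := by
        intro t ht
        rcases Nat.lt_succ_iff_lt_or_eq.1 ht with ht | rfl
        · exact hall t ht
        · exact h1
      constructor
      · intro h2
        simp [r61, r9, r1] at h2
        rw [run_skip, run_block_nil]
        refine ⟨(L + 1, 1), ⟨?_, fun t ht => hall' t (by simp only at ht; omega),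
          Or.inl ⟨rfl, h2, ?_, hall'⟩⟩, by simp only; omega⟩
        · constructor <;> simp [*]
          exact hlab'
        · simp only [Function.iterate_succ_apply']
          simp [h56, aT, auo]
      · intro h2
        simp [r61, r9, r1] at h2
        rw [run_copy, run_block_nil]
        refine ⟨(L + 1, 0), ⟨?_, fun t ht => hall' t (by simp only at ht; omega),
          Or.inr ⟨rfl, by simp, hLe, fun t ht => hall' t (by simp only at ht; omega),
            Or.inl (by simp only; omega)⟩⟩, by simp only; omega⟩
        constructor <;> simp [*]
        exact hlab'
    · intro h1
      simp [h56, aT, adg, r9] at h1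
      have hS : SegmentLength e T dg uo s (L + 1) :=
        ⟨by simp, hLe, fun t ht => hall t (by omega), Or.inr (by simpa using h1)⟩
      rw [run_copy, run_block_cons, run_ite]
      constructor
      · intro h2
        rw [run_skip, run_block_nil]
        refine ⟨(L + 1, 0), ⟨?_, hS.unique, Or.inr ⟨rfl, hS⟩⟩, by simp only; omega⟩
        constructor <;> simp [*]
        exact hlab'
      · intro h2
        rw [run_copy, run_block_nil]
        refine ⟨(L + 1, 0), ⟨?_, hS.unique, Or.inr ⟨rfl, hS⟩⟩, by simp only; omega⟩
        constructor <;> simp [*]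
        exact hlab'
  · refine ⟨?_, by simp, Or.inl ⟨rfl, he, by simp [h60], by simp⟩⟩
    constructor <;> simp [*]

end Segment

/-! ## Following labels -/

section Follow

variable {e : ℕ} {O T G HO NO acc x y : ℕ → ℕ} {W lim o p i j d w dup cl run : ℕ} {σ : Mem}

/-- Search the list in register `72` for an edge with the label in register `71`. -/
def scanList : Prog :=
  .loop (.lt 8 72) (.block [.sub 72 72 9, .load 74 3 72,
    .ite (.eq 74 71) (.block [.add 73 72 9, .copy 72 8]) (.load 72 15 72)])

theorem scanList_run {l : List ℕ} {a : ℕ} (hW : ∀ k ∈ l, k + 1 ≤ W) (h8 : σ.reg 8 = 0)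
    (h9 : σ.reg 9 = 1) (h71 : σ.reg 71 = a) (h73 : σ.reg 73 = 0) (hG : σ.arr 3 = G)
    (hN : σ.arr 15 = NO) (hl : Chain NO (σ.reg 72) l) :
    Run W scanList σ fun t σ' => t ≤ 10 * l.length + 1 ∧
      ((σ'.reg 73 = 0 ∧ ∀ k ∈ l, G k ≠ a) ∨ ∃ k ∈ l, σ'.reg 73 = k + 1 ∧ G k = a) := by
  have key := Run.loop (W := W) (σ := σ) (b := .lt 8 72) (p := .block [.sub 72 72 9, .load 74 3 72,
    .ite (.eq 74 71) (.block [.add 73 72 9, .copy 72 8]) (.load 72 15 72)])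
    (fun l' σ => σ.reg 8 = 0 ∧ σ.reg 9 = 1 ∧ σ.reg 71 = a ∧ σ.arr 3 = G ∧ σ.arr 15 = NO ∧
      Chain NO (σ.reg 72) l' ∧ (∀ k ∈ l', k ∈ l) ∧
      ((σ.reg 73 = 0 ∧ ∀ k ∈ l, k ∈ l' ∨ G k ≠ a) ∨
        (l' = [] ∧ ∃ k ∈ l, σ.reg 73 = k + 1 ∧ G k = a)))
    (fun l' => 10 * l'.length) ?_ (a := l)
    ⟨h8, h9, h71, hG, hN, hl, fun k hk => hk, Or.inl ⟨h73, fun k hk => Or.inl hk⟩⟩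
  · refine key.mono ?_
    rintro t σ' ⟨l', ⟨h8, h9, h71, hG, hN, hl', hsub, hor⟩, hb, ht⟩
    rw [Test.holds_lt, h8] at hb
    refine ⟨by omega, ?_⟩
    rcases l' with _ | ⟨k, l'⟩
    · rcases hor with ⟨h1, h2⟩ | ⟨-, h⟩
      · exact Or.inl ⟨h1, fun k hk => (h2 k hk).resolve_left (by simp)⟩
      · exact Or.inr h
    · have := hl'.1
      omega
  · rintro l' σ ⟨h8, h9, h71, hG, hN, hl', hsub, hor⟩ hb
    rw [Test.holds_lt, h8] at hb
    rcases l' with _ | ⟨k, l'⟩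
    · have : σ.reg 72 = 0 := hl'
      omega
    rcases hor with ⟨h1, h2⟩ | ⟨h, -⟩
    swap
    · simp at h
    have h72 : σ.reg 72 = k + 1 := hl'.1
    have hkl := hsub k (by simp)
    rw [run_block_cons, run_sub, run_block_cons, run_load, run_block_cons, run_ite]
    constructor
    · intro hk
      simp [h72, h9, hG, h71] at hk
      rw [run_block_cons, run_add]
      refine ⟨by simpa [h72, h9] using hW k hkl, ?_⟩
      rw [run_block_cons, run_copy, run_block_nil, run_block_nil]
      refine ⟨[], ⟨by simp [h8], by simp [h9], by simp [h71], by simp [hG], by simp [hN],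
        by simp [h8, Chain], by simp, Or.inr ⟨rfl, k, hkl, by simp [h72, h9], hk⟩⟩, ?_⟩
      simp only [List.length_cons, List.length_nil]
      omega
    · intro hk
      simp [h72, h9, hG, h71] at hk
      rw [run_load, run_block_nil]
      refine ⟨l', ⟨by simp [h8], by simp [h9], by simp [h71], by simp [hG], by simp [hN],
        by simpa [h72, h9, hN] using hl'.2, fun i hi => hsub i (by simp [hi]),
        Or.inl ⟨by simp [h1], fun i hi => ?_⟩⟩, ?_⟩
      · rcases h2 i hi with h | h
        · rcases List.mem_cons.1 h with rfl | h
          · exact Or.inr hk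
          · exact Or.inl h
        · exact Or.inr h
      · simp only [List.length_cons]
        omega

/-- The memory of a walk that has made `i = p * d + j` steps along the edges `y` and has reached the
vertex `w`. -/
structure FollowMem (T G HO NO acc x : ℕ → ℕ) (lim o p i j d w dup cl run : ℕ) (y : ℕ → ℕ)
    (σ : Mem) : Prop where
  r8 : σ.reg 8 = 0
  r9 : σ.reg 9 = 1
  r62 : σ.reg 62 = p
  r63 : σ.reg 63 = i
  r64 : σ.reg 64 = j
  r65 : σ.reg 65 = d
  r66 : σ.reg 66 = w
  r67 : σ.reg 67 = run
  r68 : σ.reg 68 = dup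
  r69 : σ.reg 69 = cl
  r75 : σ.reg 75 = lim
  r76 : σ.reg 76 = o
  aT : σ.arr 1 = T
  aG : σ.arr 3 = G
  aHO : σ.arr 14 = HO
  aNO : σ.arr 15 = NO
  ax : σ.arr 25 = x
  ay : σ.arr 27 = y
  aacc : σ.arr 28 = acc

/-- Append the edge in register `73`. -/
def followEdge : Prog :=
  .block [.sub 73 73 9, .store 27 63 73, .load 66 1 73, .load 74 28 73,
    .ite (.eq 74 62) (.copy 68 9) .skip, .add 63 63 9, .add 64 64 9]

/-- Test for the end of a period of the labels, and for the end of the cycle. -/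
def followPeriod : Prog :=
  .ite (.eq 64 62) (.block [.copy 64 8, .add 65 65 9,
    .ite (.eq 66 76) (.block [.copy 69 9, .copy 67 8]) .skip]) .skip

/-- Stop a walk that is too long. -/
def followLimit : Prog := .ite (.lt 63 75) .skip (.copy 67 8)

theorem followEdge_run {k : ℕ} (hM : FollowMem T G HO NO acc x lim o p i j d w dup cl run y σ)
    (h73 : σ.reg 73 = k + 1) (hW : i + 1 ≤ W) (hW' : j + 1 ≤ W) :
    Run W followEdge σ fun t σ' => t ≤ 10 ∧ FollowMem T G HO NO acc x lim o p (i + 1) (j + 1) d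
      (T k) (if acc k = p then 1 else dup) cl run (Function.update y i k) σ' := by
  obtain ⟨r8, r9, r62, r63, r64, r65, r66, r67, r68, r69, r75, r76, aT, aG, aHO, aNO, ax, ay,
    aacc⟩ := hM
  rw [followEdge, run_block_cons, run_sub, run_block_cons, run_store, run_block_cons, run_load,
    run_block_cons, run_load, run_block_cons, run_ite]
  constructor
  · intro h
    simp [h73, r9, aacc, r62] at h
    rw [run_copy, run_block_cons, run_add]
    refine ⟨by simpa [r63, r9] using hW, ?_⟩
    rw [run_block_cons, run_add]
    refine ⟨by simpa [r64, r9] using hW', ?_⟩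
    rw [run_block_nil, if_pos h]
    refine ⟨by omega, ?_⟩
    constructor <;> simp [*]
  · intro h
    simp [h73, r9, aacc, r62] at h
    rw [run_skip, run_block_cons, run_add]
    refine ⟨by simpa [r63, r9] using hW, ?_⟩
    rw [run_block_cons, run_add]
    refine ⟨by simpa [r64, r9] using hW', ?_⟩
    rw [run_block_nil, if_neg h]
    refine ⟨by omega, ?_⟩
    constructor <;> simp [*]

theorem followPeriod_run (hM : FollowMem T G HO NO acc x lim o p i j d w dup 0 1 y σ)
    (hW : d + 1 ≤ W) :
    Run W followPeriod σ fun t σ' => t ≤ 8 ∧ FollowMem T G HO NO acc x lim o p i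
      (if j = p then 0 else j) (if j = p then d + 1 else d) w dup
      (if j = p ∧ w = o then 1 else 0) (if j = p ∧ w = o then 0 else 1) y σ' := by
  obtain ⟨r8, r9, r62, r63, r64, r65, r66, r67, r68, r69, r75, r76, aT, aG, aHO, aNO, ax, ay,
    aacc⟩ := hM
  rw [followPeriod, run_ite]
  constructor
  · intro h
    simp [r64, r62] at h
    rw [run_block_cons, run_copy, run_block_cons, run_add]
    refine ⟨by simpa [r65, r9] using hW, ?_⟩
    rw [run_block_cons, run_ite]
    constructor
    · intro h'
      simp [r66, r76] at h'
      rw [run_block_cons, run_copy, run_block_cons, run_copy, run_block_nil, run_block_nil]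
      refine ⟨by omega, ?_⟩
      constructor <;> simp [*]
    · intro h'
      simp [r66, r76] at h'
      rw [run_skip, run_block_nil]
      refine ⟨by omega, ?_⟩
      constructor <;> simp [*]
  · intro h
    simp [r64, r62] at h
    rw [run_skip]
    refine ⟨by omega, ?_⟩
    constructor <;> simp [*]

theorem followLimit_run (hM : FollowMem T G HO NO acc x lim o p i j d w dup cl run y σ) :
    Run W followLimit σ fun t σ' => t ≤ 2 ∧ FollowMem T G HO NO acc x lim o p i j d w dup cl
      (if i < lim then run else 0) y σ' := by
  obtain ⟨r8, r9, r62, r63, r64, r65, r66, r67, r68, r69, r75, r76, aT, aG, aHO, aNO, ax, ay,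
    aacc⟩ := hM
  rw [followLimit, run_ite]
  constructor
  · intro h
    simp [r63, r75] at h
    rw [run_skip]
    refine ⟨by omega, ?_⟩
    constructor <;> simp [*]
  · intro h
    rw [Test.holds_lt, r63, r75] at h
    rw [run_copy]
    refine ⟨by omega, ?_⟩
    constructor <;> simp [*]

/-- The vertex after `t` steps of the walk along `y` from the vertex `o`. -/
def vertexAt (T : ℕ → ℕ) (o : ℕ) (y : ℕ → ℕ) (t : ℕ) : ℕ := if t = 0 then o else T (y (t - 1))

theorem vertexAt_congr {y' : ℕ → ℕ} {t : ℕ} (h : ∀ u < t, y u = y' u) :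
    vertexAt T o y t = vertexAt T o y' t := by
  unfold vertexAt
  split_ifs with h0
  · rfl
  · rw [h _ (by omega)]

/-- A walk of `i` steps from `o` whose labels are read from `x` with period `p`. -/
structure Follows (e : ℕ) (O T G x : ℕ → ℕ) (p o i : ℕ) (y : ℕ → ℕ) : Prop where
  edge : ∀ t < i, y t < e ∧ O (y t) = vertexAt T o y t ∧ G (y t) = x (t % p)
  open_ : ∀ t, 0 < t → t < i → p ∣ t → vertexAt T o y t ≠ o

theorem Follows.succ {k : ℕ} (h : Follows e O T G x p o i y)
    (hi : 0 < i → p ∣ i → vertexAt T o y i ≠ o) (hk : k < e) (hO : O k = vertexAt T o y i)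
    (hG : G k = x (i % p)) : Follows e O T G x p o (i + 1) (Function.update y i k) := by
  have hc : ∀ t ≤ i, vertexAt T o (Function.update y i k) t = vertexAt T o y t := fun t ht =>
    vertexAt_congr fun u hu => Function.update_of_ne (by omega) _ _
  refine ⟨fun t ht => ?_, fun t ht hti hp => ?_⟩
  · rw [hc t (by omega)]
    rcases Nat.lt_succ_iff_lt_or_eq.1 ht with ht | rfl
    · rw [Function.update_of_ne (by omega)]
      exact h.edge t ht
    · rw [Function.update_self]
      exact ⟨hk, hO, hG⟩
  · rw [hc t (by omega)]
    rcases Nat.lt_succ_iff_lt_or_eq.1 hti with hti | rfl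
    · exact h.open_ t ht hti hp
    · exact hi ht hp

/-- The outcome of a walk. -/
inductive FollowEnd (e : ℕ) (O T G x : ℕ → ℕ) (lim p o i d : ℕ) (y : ℕ → ℕ) : ℕ → Prop
  | closed (pos : 0 < i) (eq : i = p * d) (vertex : vertexAt T o y i = o) :
      FollowEnd e O T G x lim p o i d y 1
  | failed (last : 0 < i → p ∣ i → vertexAt T o y i ≠ o)
      (halt : lim ≤ i ∨ ∀ k < e, O k = vertexAt T o y i → G k ≠ x (i % p)) :
      FollowEnd e O T G x lim p o i d y 0

/-- Follow the labels in array `25`. -/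
def followLabels : Prog :=
  .loop (.eq 67 9) (.block [.load 71 25 64, .load 72 14 66, .copy 73 8, scanList,
    .ite (.eq 73 8) (.copy 67 8) (.block [followEdge, followPeriod, followLimit])])

/-- A step scans one list of outgoing edges, of length at most `D`. The potential counts the steps
left before the limit plus the flag `run`. -/
theorem followLabels_run {D : ℕ} (hFO : Fibres e O HO NO) (hD : ∀ z, fibreCard e O z ≤ D)
    (hp : 0 < p) (hlim : 0 < lim) (hWe : e + 1 ≤ W) (hWl : lim + 1 ≤ W) (hWp : p + 1 ≤ W)
    (hM : FollowMem T G HO NO acc x lim o p 0 0 0 o 0 0 1 y σ) :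
    Run W followLabels σ fun t σ' => t ≤ (10 * D + 40) * (lim + 1) + 1 ∧
      ∃ i d dup cl y', i ≤ lim ∧ σ'.reg 63 = i ∧ σ'.reg 65 = d ∧ σ'.reg 68 = dup ∧
        σ'.reg 69 = cl ∧ σ'.arr 27 = y' ∧ Follows e O T G x p o i y' ∧
        (dup = 0 ↔ ∀ t < i, acc (y' t) ≠ p) ∧ FollowEnd e O T G x lim p o i d y' cl := by
  have key := Run.loop (W := W) (σ := σ) (b := .eq 67 9) (p := .block [.load 71 25 64,
    .load 72 14 66, .copy 73 8, scanList,
    .ite (.eq 73 8) (.copy 67 8) (.block [followEdge, followPeriod, followLimit])])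
    (fun (a : ℕ × ℕ × ℕ × ℕ × ℕ × ℕ × (ℕ → ℕ)) σ => ∃ i j d dup cl run y,
      a = (i, j, d, dup, cl, run, y) ∧ i ≤ lim ∧ i = p * d + j ∧ j < p ∧
      FollowMem T G HO NO acc x lim o p i j d (vertexAt T o y i) dup cl run y σ ∧
      Follows e O T G x p o i y ∧ (dup = 0 ↔ ∀ t < i, acc (y t) ≠ p) ∧
      ((run = 1 ∧ i < lim ∧ cl = 0 ∧ (0 < i → p ∣ i → vertexAt T o y i ≠ o)) ∨
        (run = 0 ∧ FollowEnd e O T G x lim p o i d y cl)))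
    (fun a => (10 * D + 40) * (lim - a.1 + a.2.2.2.2.2.1) ) ?_ (a := (0, 0, 0, 0, 0, 1, y))
    ⟨0, 0, 0, 0, 0, 1, y, rfl, by omega, by simp, hp, by simpa [vertexAt] using hM,
      ⟨by simp, by simp⟩, by simp, Or.inl ⟨rfl, hlim, rfl, by simp⟩⟩
  · refine key.mono ?_
    rintro t σ' ⟨_, ⟨i, j, d, dup, cl, run, y', rfl, hi, hij, hjp, hM, hF, hdup, hor⟩, hb, ht⟩
    simp only at ht
    rw [Test.holds_eq, hM.r67, hM.r9] at hb
    rcases hor with ⟨h, _⟩ | ⟨-, hend⟩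
    · exact absurd h hb
    · refine ⟨?_, i, d, dup, cl, y', hi, hM.r63, hM.r65, hM.r68, hM.r69, hM.ay, hF, hdup, hend⟩
      simp only [Nat.sub_zero] at ht
      omega
  · rintro _ σ ⟨i, j, d, dup, cl, run, y, rfl, hi, hij, hjp, hM, hF, hdup, hor⟩ hb
    rw [Test.holds_eq, hM.r67, hM.r9] at hb
    subst hb
    rcases hor with ⟨-, hilim, rfl, hne⟩ | ⟨h, -⟩
    swap
    · omega
    have hmod : i % p = j := by rw [hij, Nat.mul_add_mod, Nat.mod_eq_of_lt hjp]
    obtain ⟨l, hl, hnd, hmem⟩ := hFO (vertexAt T o y i)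
    have hlen := (length_eq_fibreCard hnd hmem).trans_le (hD _)
    have hpot : (10 * D + 40) * (lim - i + 1) =
        (10 * D + 40) * (lim - (i + 1) + 1) + (10 * D + 40) := by
      rw [← Nat.mul_succ]; congr 1; omega
    have hpot' : (10 * D + 40) * (lim - i + 1) =
        (10 * D + 40) * (lim - i + 0) + (10 * D + 40) := by
      rw [← Nat.mul_succ]
    have hpot'' : (10 * D + 40) * (lim - (i + 1) + 0) ≤ (10 * D + 40) * (lim - (i + 1) + 1) :=
      Nat.mul_le_mul_left _ (by omega)
    rw [run_block_cons, run_load, run_block_cons, run_load, run_block_cons, run_copy]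
    have hM0 := hM
    obtain ⟨r8, r9, r62, r63, r64, r65, r66, r67, r68, r69, r75, r76, aT, aG, aHO, aNO, ax, ay,
      aacc⟩ := hM
    refine Run.block_cons (scanList_run (l := l) (a := x j) (G := G) (NO := NO)
      (fun k hk => by have := ((hmem k).1 hk).1; omega)
      (by simp [r8]) (by simp [r9]) (by simp [r64, ax]) (by simp [r8]) (by simp [aG])
      (by simp [aNO]) (by simpa [aHO, r66] using hl)) ?_
    rintro t₁ σ₁ ⟨ht₁, hres⟩ hfr
    have hM₁ : FollowMem T G HO NO acc x lim o p i j d (vertexAt T o y i) dup 0 1 y σ₁ := by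
      have hr : ∀ z, z ∉ scanList.wr → z ≠ 71 → z ≠ 72 → z ≠ 73 → σ₁.reg z = σ.reg z := by
        intro z h1 h2 h3 h4
        rw [hfr.1 z h1]
        simp [h2, h3, h4]
      have ha : ∀ z, z ∉ scanList.wa → σ₁.arr z = σ.arr z := by
        intro z h1
        rw [hfr.2 z h1]
        simp
      constructor
      all_goals first
        | (rw [hr _ (by decide) (by decide) (by decide) (by decide)]; assumption)
        | (rw [ha _ (by decide)]; assumption)
    rw [run_block_cons, run_ite]
    constructor
    · intro h0
      rw [Test.holds_eq, hM₁.r8] at h0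
      rw [run_copy, run_block_nil]
      refine ⟨(i, j, d, dup, 0, 0, y), ⟨i, j, d, dup, 0, 0, y, rfl, hi, hij, hjp, ?_, hF, hdup,
        Or.inr ⟨rfl, .failed hne (Or.inr ?_)⟩⟩, ?_⟩
      · obtain ⟨r8, r9, r62, r63, r64, r65, r66, r67, r68, r69, r75, r76, aT, aG, aHO, aNO, ax, ay,
          aacc⟩ := hM₁
        constructor <;> simp [*]
      · rcases hres with ⟨-, h⟩ | ⟨k, -, h, -⟩
        · intro k hk hO
          rw [hmod]
          exact h k ((hmem k).2 ⟨hk, hO⟩)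
        · omega
      · simp only
        omega
    · intro h0
      rw [Test.holds_eq, hM₁.r8] at h0
      rcases hres with ⟨h, -⟩ | ⟨k, hkl, h73, hGk⟩
      · exact absurd h h0
      obtain ⟨hke, hOk⟩ := (hmem k).1 hkl
      have hd : d ≤ i := by
        rw [hij]
        exact (Nat.le_mul_of_pos_left d hp).trans (Nat.le_add_right _ _)
      refine Run.block_cons (followEdge_run hM₁ h73 (by omega) (by omega)) ?_
      rintro t₂ σ₂ ⟨ht₂, hM₂⟩ -
      refine Run.block_cons (followPeriod_run hM₂ (by omega)) ?_
      rintro t₃ σ₃ ⟨ht₃, hM₃⟩ -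
      refine Run.block_cons (followLimit_run hM₃) ?_
      rintro t₄ σ₄ ⟨ht₄, hM₄⟩ -
      rw [run_block_nil, run_block_nil]
      have hv : vertexAt T o (Function.update y i k) (i + 1) = T k := by simp [vertexAt]
      have hF' := hF.succ hne hke hOk (by rw [hmod, hGk])
      have hdup' : (if acc k = p then 1 else dup) = 0 ↔
          ∀ t < i + 1, acc (Function.update y i k t) ≠ p := by
        split_ifs with hacc
        · simp only [false_iff]
          intro h
          exact h i (by omega) (by simpa using hacc)
        · rw [hdup]
          constructor
          · intro h t ht
            rcases Nat.lt_succ_iff_lt_or_eq.1 ht with ht | rfl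
            · rw [Function.update_of_ne (by omega)]; exact h t ht
            · simpa using hacc
          · intro h t ht
            have := h t (by omega)
            rwa [Function.update_of_ne (by omega)] at this
      -- The position within the period is kept in a counter; the machine has no division.
      have hdvd : p ∣ i + 1 ↔ j + 1 = p := by
        rw [hij, add_assoc, Nat.dvd_add_right (Dvd.intro _ rfl)]
        constructor
        · intro h
          have := Nat.le_of_dvd (by omega) h
          omega
        · intro h
          rw [h]
      rw [← hv] at hM₄
      refine ⟨_, ⟨i + 1, _, _, _, _, _, _, rfl, by omega, ?_, ?_, hM₄, hF', hdup', ?_⟩, ?_⟩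
      · split_ifs with h1
        · rw [Nat.mul_succ]; omega
        · omega
      · split_ifs with h1
        · omega
        · omega
      · rw [hv]
        by_cases h1 : j + 1 = p ∧ T k = o
        · right
          simp only [if_pos h1, ite_self, true_and]
          rw [if_pos h1.1]
          exact .closed (by omega) (by rw [Nat.mul_succ]; omega) (hv.trans h1.2)
        · simp only [if_neg h1]
          have hlast : 0 < i + 1 → p ∣ i + 1 →
              vertexAt T o (Function.update y i k) (i + 1) ≠ o := fun _ h2 h3 =>
            h1 ⟨hdvd.1 h2, hv ▸ h3⟩
          by_cases h2 : i + 1 < lim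
          · left
            simp only [if_pos h2, true_and]
            refine ⟨h2, ?_⟩
            rw [← hv]
            exact hlast
          · right
            simp only [if_neg h2, true_and]
            exact .failed hlast (Or.inl (by omega))
      · simp only
        split_ifs <;> omega

end Follow

/-! ## Long cycles through start edges -/

section Found

variable {e : ℕ} {O T G dg uo cand x : ℕ → ℕ}

theorem exists_rotation_symm {A : Type*} {a b : ℕ → A} {k c : ℕ} (hk : 0 < k)
    (hb : ∀ i, b (i + k) = b i) (h : ∀ i, a i = b (c + i)) : ∃ c', ∀ i, b i = a (c' + i) := by
  -- The inverse rotation: `c` plus this number is the multiple `c * k` of the period.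
  refine ⟨c * k - c, fun i => ?_⟩
  have := Nat.le_mul_of_pos_right c hk
  rw [h, show c + (c * k - c + i) = i + c * k by omega, apply_add_mul hb]

/-- The labels `G` are injective on the edges with a given origin. -/
def Immersive (e : ℕ) (O G : ℕ → ℕ) : Prop := ∀ i < e, ∀ j < e, O i = O j → G i = G j → i = j

theorem Immersive.eq (hG : Immersive e O G) {F H : ℕ → ℕ} (hF : NPath e O T F)
    (hH : NPath e O T H) (h0 : O (F 0) = O (H 0)) (h : ∀ i, G (F i) = G (H i)) (i : ℕ) :
    F i = H i := by
  induction i with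
  | zero => exact hG _ (hF 0).1 _ (hH 0).1 h0 (h 0)
  | succ i ih =>
    refine hG _ (hF _).1 _ (hH _).1 ?_ (h _)
    rw [← (hF i).2, ← (hH i).2, ih]

theorem vertexAt_path {F : ℕ → ℕ} (hF : NPath e O T F) (t : ℕ) :
    vertexAt T (O (F 0)) F t = O (F t) := by
  unfold vertexAt
  split_ifs with h
  · rw [h]
  · rw [(hF _).2, Nat.sub_add_cancel (by omega)]

theorem WordPeriod.mod {L p : ℕ} (h : WordPeriod x L p) {t : ℕ} (ht : t < L) :
    x (t % p) = x t := by
  induction t using Nat.strong_induction_on with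
  | _ t ih =>
    by_cases htp : t < p
    · rw [Nat.mod_eq_of_lt htp]
    · have h1 := h.period (t - p) (by omega)
      rw [Nat.sub_add_cancel (by omega)] at h1
      rw [h1, ← ih (t - p) (by have := h.pos; omega) (by omega), ← Nat.mod_eq_sub_mod (by omega)]

/-- Every infinite path that starts with `s` is forced along the segment, as there is only one live
continuation at each of its vertices. -/
theorem SegmentLength.path_eq {L s : ℕ} (hL : LiveDeg e O T dg) (hU : LiveOut e O T dg uo)
    (h : SegmentLength e T dg uo s L) {F : ℕ → ℕ} (hF : NPath e O T F) (h0 : F 0 = s) :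
    ∀ t < L, F t = (fun j => uo (T j))^[t] s := by
  intro t
  induction t with
  | zero => intro _; exact h0
  | succ t ih =>
    intro ht
    have h1 := ih (by omega)
    rw [hU.next hL hF (by rw [h1]; exact h.unique t ht), h1, Function.iterate_succ_apply']

/-- The closed path of a cycle through `s`, whose labels have the minimal period `p` of the labels
of the segment that starts with `s`. -/
structure Closes (e : ℕ) (O T G : ℕ → ℕ) (s k p : ℕ) (Y : ℕ → ℕ) : Prop where
  path : NPath e O T Y
  zero : Y 0 = s
  pos : 0 < k
  per : per Y = k
  label : LongCycles.per (fun t => G (Y t)) = p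
  seg : ∀ H, NPath e O T H → H 0 = s → ∀ t < 2 * p, G (H t) = G (Y t)

/-- A walk that closes after full periods of the labels can be repeated forever. Its labels have no
period below `p`, since that would be a period of the segment. The closed path itself has no period
below `k`, since that would be a multiple of `p` at which the walk had closed before. -/
theorem Follows.closes (hG : Immersive e O G) (hL : LiveDeg e O T dg) (hU : LiveOut e O T dg uo)
    {s L p k d : ℕ} {y : ℕ → ℕ} (hs : s < e) (hS : SegmentLength e T dg uo s L)
    (hx : ∀ t < L, x t = G ((fun j => uo (T j))^[t] s)) (hp : WordPeriod x L p)
    (hF : Follows e O T G x p (O s) k y) (hk : 0 < k) (hkd : k = p * d)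
    (hv : vertexAt T (O s) y k = O s) (h2 : 2 * p ≤ L) :
    Closes e O T G s k p fun t => y (t % k) := by
  have hp0 := hp.pos
  have hpk : p ∣ k := ⟨d, hkd⟩
  have hlab : ∀ t, G (y (t % k)) = x (t % p) := fun t => by
    rw [(hF.edge _ (Nat.mod_lt _ hk)).2.2, Nat.mod_mod_of_dvd _ hpk]
  have hpath : NPath e O T fun t => y (t % k) := by
    intro t
    have hlt := Nat.mod_lt t hk
    refine ⟨(hF.edge _ hlt).1, ?_⟩
    simp only
    rw [← Nat.mod_add_mod]
    set u := t % k
    rcases lt_or_eq_of_le (Nat.succ_le_of_lt hlt) with h | h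
    · rw [Nat.mod_eq_of_lt h, (hF.edge _ h).2.1]
      simp [vertexAt]
    · rw [show u + 1 = k from h, Nat.mod_self, (hF.edge 0 hk).2.1]
      rw [← h] at hv
      simpa [vertexAt] using hv
  -- The walk starts only from the origin of `s`; the first label selects `s` itself.
  have h0 : y (0 % k) = s := by
    rw [Nat.zero_mod]
    obtain ⟨h1, h2, h3⟩ := hF.edge 0 hk
    refine hG _ h1 _ hs (by simpa [vertexAt] using h2) ?_
    rw [h3, Nat.zero_mod, hx 0 hS.pos]
    rfl
  have hperk : ∀ t, y ((t + k) % k) = y (t % k) := fun t => by rw [Nat.add_mod_right]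
  have hpp := per_pos (a := fun t => y (t % k)) hk hperk
  have hb : ∀ t, G (y ((t + p) % k)) = G (y (t % k)) := fun t => by
    rw [hlab, hlab, Nat.add_mod_right]
  have hlabel : per (fun t => G (y (t % k))) = p := by
    apply le_antisymm (Nat.le_of_dvd hp0 (per_dvd (a := fun t => G (y (t % k))) hb))
    apply hp.min _ (per_pos (a := fun t => G (y (t % k))) hp0 hb)
    intro t ht
    rw [← hp.mod ht, ← hp.mod (show t < L by omega), ← hlab, ← hlab]
    exact per_spec (fun t => G (y (t % k))) t
  refine ⟨hpath, h0, hk, ?_, hlabel, ?_⟩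
  · rcases lt_or_eq_of_le (Nat.le_of_dvd hk (per_dvd (a := fun t => y (t % k)) hperk)) with hlt | h
    · exfalso
      have hdvd : p ∣ per fun t => y (t % k) := by
        conv_lhs => rw [← hlabel]
        exact per_comp_dvd G
      refine hF.open_ _ hpp hlt hdvd ?_
      have h1 := vertexAt_path hpath (per fun t => y (t % k))
      have h3 := per_spec (fun t => y (t % k)) 0
      simp only [zero_add] at h3
      have h4 : vertexAt T (O s) y (per fun t => y (t % k)) =
          vertexAt T (O s) (fun t => y (t % k)) (per fun t => y (t % k)) :=
        vertexAt_congr fun u hu => by rw [Nat.mod_eq_of_lt (by omega)]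
      rw [h4]
      rw [h3, h0] at h1
      exact h1
    · exact h
  · intro H hH hH0 t ht
    rw [hlab, hp.mod (by omega), hx t (by omega), hS.path_eq hL hU hH hH0 t (by omega)]

/-- A live edge that starts a segment. -/
def Start (e : ℕ) (O T dg cand : ℕ → ℕ) (j : ℕ) : Prop :=
  Live e T dg j ∧ (2 ≤ dg (O j) ∨ cand j = 1)

/-- A long cycle, in the form of a closed path. -/
structure LongPath (e : ℕ) (O T G : ℕ → ℕ) (β : ℕ) (F : ℕ → ℕ) : Prop where
  path : NPath e O T F
  pos : 0 < per F
  long : 12 * β * per (fun t => G (F t)) ≤ per F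

/-- A long cycle with a segment that starts with its first edge and contains two periods of the
labels. -/
structure LongStart (e : ℕ) (O T G dg cand : ℕ → ℕ) (β : ℕ) (F : ℕ → ℕ) : Prop
    extends LongPath e O T G β F where
  start : Start e O T dg cand (F 0)
  run : ∀ t, 0 < t → t < 2 * per (fun t => G (F t)) → ¬ Start e O T dg cand (F t)
  short : 2 * per F ≤ 3 * e

/-- The segment shows two periods of the labels of `F`, so its minimal period is the true period of
the labels. The walk then reads the labels of `F` from the origin of `F`, traces `F`, and closes
after exactly one turn. All tests but the one for novelty therefore succeed. -/
theorem LongStart.follow (hG : Immersive e O G) (hL : LiveDeg e O T dg)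
    (hU : LiveOut e O T dg uo) {β L p i d cl : ℕ} {y F : ℕ → ℕ} (hβ : 0 < β)
    (h : LongStart e O T G dg cand β F) (hS : SegmentLength e T dg uo (F 0) L)
    (hx : ∀ t < L, x t = G ((fun j => uo (T j))^[t] (F 0))) (hp : WordPeriod x L p)
    (hF : Follows e O T G x p (O (F 0)) i y)
    (hend : FollowEnd e O T G x (2 * e) p (O (F 0)) i d y cl) :
    cl = 1 ∧ per (fun t => G (F t)) = p ∧ i = per F ∧ 12 * β ≤ d ∧ 2 * p ≤ L ∧
      ∀ t < i, y t = F t := by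
  have hpath := h.path
  have hpos := h.pos
  have hlong := h.long
  have hshort := h.short
  have hq := Nat.pos_of_dvd_of_pos (per_comp_dvd (a := F) G) hpos
  have hrun := h.run
  have hqF := per_comp_dvd (a := F) G
  have hqs := per_spec fun t => G (F t)
  set q := per fun t => G (F t) with hqdef
  have h12 : 12 * q ≤ per F := by
    refine le_trans ?_ hlong
    rw [mul_assoc]
    exact Nat.mul_le_mul_left 12 (Nat.le_mul_of_pos_left q hβ)
  have hseg := hS.path_eq hL hU hpath rfl
  -- If the segment was capped at `e`, the bounds `12 * q ≤ per F` and `2 * per F ≤ 3 * e` suffice.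
  -- Otherwise it ends before a branching vertex, and the next edge of `F` is a start edge, which is
  -- excluded within `2 * q` steps.
  have h2q : 2 * q ≤ L := by
    by_contra hlt
    have hL0 := hS.pos
    rcases hS.last with h1 | h1
    · omega
    · rw [← hseg _ (by omega), (hpath _).2, Nat.sub_add_cancel hL0] at h1
      have h3 := hL.live_path hpath L
      have h4 := hL.deg_pos h3
      exact hrun L hL0 (by omega) ⟨h3, Or.inl (by omega)⟩
  have hxF : ∀ t < L, x t = G (F t) := fun t ht => by rw [hx t ht, hseg t ht]
  have hpq : p ≤ q := hp.min q hq fun t ht => by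
    rw [hxF _ ht, hxF t (by omega)]; exact hqs t
  -- The comparison takes place at positions below `q + p ≤ 2 * q`, inside the segment, and covers a
  -- whole window of length `q`.
  have hpp : ∀ t, G (F (t + p)) = G (F t) :=
    periodic_of_window (a := fun t => G (F t)) (c := 0) hq hqs fun t ht => by
      simp only [zero_add]
      rw [← hxF _ (by omega), ← hxF _ (by omega)]
      exact hp.period t (by omega)
  have hqp : q = p := le_antisymm (Nat.le_of_dvd hp.pos (per_dvd hpp)) hpq
  have hlab : ∀ t, x (t % p) = G (F t) := fun t => by
    rw [hxF _ ((Nat.mod_lt t hp.pos).trans_le hp.le)]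
    exact apply_mod (a := fun t => G (F t)) hpp t
  have hyF : ∀ t < i, y t = F t := by
    intro t
    induction t using Nat.strong_induction_on with
    | _ t ih =>
      intro ht
      obtain ⟨h1, h2, h3⟩ := hF.edge t ht
      refine hG _ h1 _ (hpath t).1 ?_ (h3.trans (hlab t))
      rw [h2, vertexAt_congr fun u hu => ih u hu (by omega), vertexAt_path hpath]
  have hvF : ∀ t ≤ i, vertexAt T (O (F 0)) y t = O (F t) := fun t ht => by
    rw [vertexAt_congr fun u hu => hyF u (by omega), vertexAt_path hpath]
  have hFper : F (per F) = F 0 := by simpa using per_spec F 0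
  -- A walk beyond `per F` would have passed its origin at this multiple of `p` without stopping.
  have hle : i ≤ per F := by
    by_contra hlt
    refine hF.open_ _ hpos (by omega) (hqp ▸ hqF) ?_
    rw [hvF _ (by omega), hFper]
  cases hend with
  | closed hi hid hv =>
    rw [hvF i le_rfl] at hv
    have hd : per F ∣ i := by
      apply per_dvd
      intro t
      rw [add_comm]
      refine hG.eq (hpath.shift i) hpath hv (fun u => ?_) t
      rw [add_comm, hid]
      exact periodic_of_dvd (a := fun t => G (F t)) hpp (Dvd.intro _ rfl) u
    have hip : i = per F := le_antisymm hle (Nat.le_of_dvd hi hd)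
    refine ⟨rfl, hqp, hip, ?_, by omega, hyF⟩
    rw [← hip, hid, hqp, mul_comm p] at hlong
    exact Nat.le_of_mul_le_mul_right hlong hp.pos
  | failed hlast hhalt =>
    exfalso
    -- Before a full turn the walk can neither exceed the limit `2 * e`, as `2 * per F ≤ 3 * e`, nor
    -- get stuck, as `F` continues with the required label. After a full turn it has closed.
    rcases lt_or_eq_of_le hle with hlt | h1
    · rcases hhalt with h2 | h2
      · omega
      · refine h2 (F i) (hpath i).1 ?_ (hlab i).symm
        rw [hvF i le_rfl]
    · refine hlast (by omega) (h1 ▸ hqp ▸ hqF) ?_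
      rw [hvF i le_rfl, h1, hFper]

/-! ### The list of cycles found so far -/

/-- The long cycles `y 0, …, y (r - 1)` that have been found at start edges less than `i`. -/
structure Found (e : ℕ) (O T G dg cand : ℕ → ℕ) (β i r : ℕ) (y : ℕ → ℕ → ℕ) (len p acc : ℕ → ℕ) :
    Prop where
  closes : ∀ j < r, Closes e O T G (y j 0) (len j) (p j) (y j)
  long : ∀ j < r, 12 * β * p j ≤ len j
  acc_eq : ∀ j < r, acc (y j 0) = p j
  exists_of_acc : ∀ s, acc s ≠ 0 → s < i ∧ ∃ j < r, y j 0 = s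
  dist : ∀ j < r, ∀ l < r, ∀ c, (∀ t, y j t = y l (c + t)) → j = l
  complete : ∀ F, LongStart e O T G dg cand β F → F 0 < i → ∃ j < r, ∃ c, ∀ t, F t = y j (c + t)

theorem Found.zero {β : ℕ} : Found e O T G dg cand β 0 0 (fun _ _ => 0) (fun _ => 0) (fun _ => 0)
    (fun _ => 0) where
  closes := by simp
  long := by simp
  acc_eq := by simp
  exists_of_acc := by simp
  dist := by simp
  complete := by simp

variable {β i r : ℕ} {y : ℕ → ℕ → ℕ} {len p acc : ℕ → ℕ}

theorem Closes.label_pos {s k p : ℕ} {Y : ℕ → ℕ} (h : Closes e O T G s k p Y) : 0 < p := by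
  have := per_comp_dvd (a := Y) G
  rw [h.label, h.per] at this
  exact Nat.pos_of_dvd_of_pos this h.pos

/-- A closed path with labels of period at most `p` that contains the start edge of a found cycle is
a rotation of this cycle. -/
theorem Closes.eq (hG : Immersive e O G) {s k p : ℕ} {Y H : ℕ → ℕ}
    (h : Closes e O T G s k p Y) (hH : NPath e O T H) {t p' : ℕ} (ht : H t = s) (hp' : p' ≤ p)
    (hp'0 : 0 < p') (hper : ∀ u, G (H (u + p')) = G (H u)) : p' = p ∧ ∀ u, Y u = H (t + u) := by
  have hseg := h.seg _ (hH.shift t) ht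
  have hspec := per_spec fun t => G (Y t)
  rw [h.label] at hspec
  -- From `s` on, `H` shares with `Y` the first `2 * p` labels. As `p' ≤ p`, this is enough to carry
  -- the period `p'` over to one whole period of `Y`.
  have h1 : ∀ u, G (Y (u + p')) = G (Y u) :=
    periodic_of_window (a := fun t => G (Y t)) (c := 0) h.label_pos hspec fun u hu => by
      simp only [zero_add]
      rw [← hseg _ (by omega), ← hseg _ (by omega), ← add_assoc]
      exact hper _
  have h2 : p ∣ p' := by
    rw [← h.label]
    exact per_dvd h1
  obtain rfl := le_antisymm hp' (Nat.le_of_dvd hp'0 h2)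
  refine ⟨rfl, hG.eq h.path (hH.shift t) (by rw [h.zero, add_zero, ht]) fun u => ?_⟩
  have hm := Nat.mod_lt u hp'0
  have e1 := apply_mod (a := fun t => G (Y t)) hspec u
  have e2 := apply_mod (a := fun u => G (H (t + u))) (n := p') (fun u => by
    rw [← add_assoc]; exact hper _) u
  rw [← e1, ← e2]
  exact (hseg _ (by omega)).symm

/-- The found cycles are in triangular position. -/
theorem Found.independent (hG : Immersive e O G) (h : Found e O T G dg cand β i r y len p acc) :
    ∀ j < r, ∀ l < r, ∀ t, p j ≤ p l → y j t = y l 0 → j = l := by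
  intro j hj l hl t hp ht
  have hc := h.closes j hj
  have hs := per_spec fun t => G (y j t)
  rw [hc.label] at hs
  exact (h.dist l hl j hj t ((h.closes l hl).eq hG hc.path ht hp hc.label_pos hs).2).symm

theorem Found.next (h : Found e O T G dg cand β i r y len p acc)
    (hi : ∀ F, LongStart e O T G dg cand β F → F 0 = i → ∃ j < r, ∃ c, ∀ t, F t = y j (c + t)) :
    Found e O T G dg cand β (i + 1) r y len p acc := by
  refine { h with exists_of_acc := fun s hs => ?_, complete := fun F hF h0 => ?_ }
  · obtain ⟨h1, h2⟩ := h.exists_of_acc s hs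
    exact ⟨by omega, h2⟩
  · rcases Nat.lt_succ_iff_lt_or_eq.1 h0 with h0 | h0
    · exact h.complete F hF h0
    · exact hi F hF h0

/-- A long cycle that meets a found cycle with the same period of the labels has been found. -/
theorem Found.of_acc (hG : Immersive e O G) (h : Found e O T G dg cand β i r y len p acc)
    {F : ℕ → ℕ} (hF : LongPath e O T G β F) {t : ℕ}
    (ht : acc (F t) = per fun u => G (F u)) : ∃ j < r, ∃ c, ∀ t, F t = y j (c + t) := by
  have hq := Nat.pos_of_dvd_of_pos (per_comp_dvd (a := F) G) hF.pos
  obtain ⟨-, j, hj, hjt⟩ := h.exists_of_acc (F t) (by omega)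
  have hpj : p j = per fun u => G (F u) := by rw [← h.acc_eq j hj, hjt, ht]
  have h1 := ((h.closes j hj).eq hG hF.path hjt.symm hpj.ge hq
    (per_spec fun u => G (F u))).2
  obtain ⟨c, hc⟩ := exists_rotation_symm hF.pos (per_spec F) h1
  exact ⟨j, hj, c, hc⟩

/-- The array `acc` is indexed by first edges and stores label periods, so the test for novelty is
one lookup per edge of the walk. -/
theorem Found.accept (h : Found e O T G dg cand β i r y len p acc) {k q : ℕ} {Y : ℕ → ℕ}
    (hY : Closes e O T G i k q Y) (hlong : 12 * β * q ≤ k) (hdup : ∀ t < k, acc (Y t) ≠ q)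
    (hcompl : ∀ F, LongStart e O T G dg cand β F → F 0 = i → ∀ t, F t = Y t) :
    Found e O T G dg cand β (i + 1) (r + 1) (Function.update y r Y) (Function.update len r k)
      (Function.update p r q) (Function.update acc i q) := by
  have hlt : ∀ j < r, j ≠ r := fun j hj => by omega
  have hsplit : ∀ j, j < r + 1 → j < r ∨ j = r := fun j hj => by omega
  have hyk := per_spec Y
  rw [hY.per] at hyk
  -- A rotation of `Y` among the old cycles would have the same label period and its first edge on
  -- `Y`, where `hdup` forbids it.
  have hnot : ∀ j < r, ∀ c, ¬ ∀ t, y j t = Y (c + t) := by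
    intro j hj c hc
    have hcl := h.closes j hj
    have h1 : p j = q := by
      have hs := per_shift_eq (a := fun t => G (Y t)) hY.pos (fun t => by simp only [hyk]) c
      rw [hY.label] at hs
      rw [← hs, ← hcl.label]
      simp only [hc]
    have h2 := h.acc_eq j hj
    rw [hc 0, add_zero, ← apply_mod hyk c, h1] at h2
    exact hdup _ (Nat.mod_lt _ hY.pos) h2
  have hfresh : ∀ j < r, y j 0 ≠ i := by
    intro j hj heq
    have h1 := h.acc_eq j hj
    have h2 := (h.closes j hj).label_pos
    have := (h.exists_of_acc (y j 0) (by omega)).1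
    omega
  refine ⟨?_, ?_, ?_, ?_, ?_, ?_⟩
  · intro j hj
    rcases hsplit j hj with hj | rfl
    · simpa [hlt j hj] using h.closes j hj
    · simpa [hY.zero] using hY
  · intro j hj
    rcases hsplit j hj with hj | rfl
    · simpa [hlt j hj] using h.long j hj
    · simpa using hlong
  · intro j hj
    rcases hsplit j hj with hj | rfl
    · simpa [hlt j hj, hfresh j hj] using h.acc_eq j hj
    · simp [hY.zero]
  · intro s hs
    by_cases hsi : s = i
    · subst hsi
      exact ⟨by omega, r, by omega, by simp [hY.zero]⟩
    · rw [Function.update_of_ne hsi] at hs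
      obtain ⟨h1, j, hj, hjs⟩ := h.exists_of_acc s hs
      exact ⟨by omega, j, by omega, by simpa [hlt j hj] using hjs⟩
  · intro j hj l hl c hc
    rcases hsplit j hj with hj | rfl <;> rcases hsplit l hl with hl | rfl
    · simp only [Function.update_of_ne (hlt j hj), Function.update_of_ne (hlt l hl)] at hc
      exact h.dist j hj l hl c hc
    · simp only [Function.update_of_ne (hlt j hj), Function.update_self] at hc
      exact absurd hc (hnot j hj c)
    · simp only [Function.update_of_ne (hlt l hl), Function.update_self] at hc
      have hs := per_spec (y l)
      rw [(h.closes l hl).per] at hs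
      obtain ⟨c', hc'⟩ := exists_rotation_symm (h.closes l hl).pos hs hc
      exact absurd hc' (hnot l hl c')
    · rfl
  · intro F hF h0
    rcases Nat.lt_succ_iff_lt_or_eq.1 h0 with h0 | h0
    · obtain ⟨j, hj, c, hc⟩ := h.complete F hF h0
      exact ⟨j, by omega, c, fun t => by rw [hc, Function.update_of_ne (hlt j hj)]⟩
    · exact ⟨r, by omega, 0, fun t => by simpa using hcompl F hF h0 t⟩

end Found

/-! ## The search for long cycles -/

section LongCycleSearch

variable {e : ℕ} {O T G HO NO dg uo cand acc x y : ℕ → ℕ} {W D b β i k off : ℕ} {σ σ' : Mem}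

/-- The circle with the edges `y 0, …, y (k - 1)` has been written to the output, from position `off`
on. -/
def Written (O : ℕ → ℕ) (off k : ℕ) (y : ℕ → ℕ) (σ : Mem) : Prop :=
  ∀ u < k, σ.arr 10 (off + u) = off + u ∧ σ.arr 11 (off + u) = off + (u + 1) % k ∧
    σ.arr 12 (off + u) = O (y u) ∧ σ.arr 13 (off + u) = y u

/-- Output the cycle in array `27`. -/
def emitCycle : Prog :=
  .block [.store 28 60 62, .copy 80 8, .copy 81 6, .loop (.lt 80 63) (.block [.load 82 27 80,
    .load 83 0 82, .store 10 81 81, .add 84 81 9, .store 11 81 84, .store 12 81 83,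
    .store 13 81 82, .copy 81 84, .add 80 80 9]), .sub 84 81 9, .store 11 84 6, .copy 6 81,
    .copy 7 81]

theorem emitCycle_run (hW : off + k ≤ W) (hk : 0 < k) (h6 : σ.reg 6 = off) (h8 : σ.reg 8 = 0)
    (h9 : σ.reg 9 = 1) (h63 : σ.reg 63 = k) (hO : σ.arr 0 = O) (hy : σ.arr 27 = y) :
    Run W emitCycle σ fun t σ' => t ≤ 12 * k + 20 ∧ σ'.reg 6 = off + k ∧ σ'.reg 7 = off + k ∧
      σ'.arr 28 = Function.update (σ.arr 28) (σ.reg 60) (σ.reg 62) ∧ Written O off k y σ' ∧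
      ∀ z < off, ∀ a ∈ [10, 11, 12, 13], σ'.arr a z = σ.arr a z := by
  rw [emitCycle, run_block_cons, run_store, run_block_cons, run_copy, run_block_cons, run_copy]
  generalize hσ₁ : ((σ.setArr 28 (σ.reg 60) (σ.reg 62)).setReg 80
    ((σ.setArr 28 (σ.reg 60) (σ.reg 62)).reg 8)).setReg 81
    (((σ.setArr 28 (σ.reg 60) (σ.reg 62)).setReg 80
    ((σ.setArr 28 (σ.reg 60) (σ.reg 62)).reg 8)).reg 6) = σ₁
  have key := Run.loop (W := W) (σ := σ₁) (b := .lt 80 63) (p := .block [.load 82 27 80,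
    .load 83 0 82, .store 10 81 81, .add 84 81 9, .store 11 81 84, .store 12 81 83,
    .store 13 81 82, .copy 81 84, .add 80 80 9])
    (fun (u : ℕ) τ => u ≤ k ∧ τ.reg 80 = u ∧ τ.reg 81 = off + u ∧ τ.reg 6 = off ∧ τ.reg 9 = 1 ∧
      τ.reg 63 = k ∧ τ.arr 0 = O ∧ τ.arr 27 = y ∧
      τ.arr 28 = Function.update (σ.arr 28) (σ.reg 60) (σ.reg 62) ∧
      (∀ w < u, τ.arr 10 (off + w) = off + w ∧ τ.arr 11 (off + w) = off + (w + 1) ∧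
        τ.arr 12 (off + w) = O (y w) ∧ τ.arr 13 (off + w) = y w) ∧
      ∀ z < off, ∀ a ∈ [10, 11, 12, 13], τ.arr a z = σ.arr a z)
    (fun u => 12 * (k - u)) ?_ (a := 0) ?_
  · refine Run.block_cons key ?_
    rintro t τ ⟨u, ⟨hu, h80, h81, h6, h9, h63, -, -, hacc, hw, hold⟩, hb, ht⟩ -
    rw [Test.holds_lt, h80, h63] at hb
    obtain rfl : u = k := by omega
    rw [run_block_cons, run_sub, run_block_cons, run_store, run_block_cons, run_copy,
      run_block_cons, run_copy, run_block_nil]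
    refine ⟨by omega, by simp [h81], by simp [h81], by simpa using hacc, ?_, ?_⟩
    · intro w hwu
      obtain ⟨e1, e2, e3, e4⟩ := hw w hwu
      refine ⟨by simpa using e1, ?_, by simpa using e3, by simpa using e4⟩
      simp only [Mem.arr_setReg, Mem.arr_setArr, Mem.reg_setReg, reduceIte, h81, h9, h6,
        Nat.reduceEqDiff, Function.update_apply]
      -- Inside the loop every target is the next number; only the last edge of the circle is
      -- redirected afterwards to the number `off`.
      split_ifs with hlast
      · rw [show w + 1 = u by omega, Nat.mod_self, add_zero]
      · rw [e2, Nat.mod_eq_of_lt (by omega)]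
    · intro z hz a ha
      have := hold z hz a ha
      have hzu : z ≠ off + u - 1 := by omega
      simp only [List.mem_cons, List.not_mem_nil, or_false] at ha
      rcases ha with rfl | rfl | rfl | rfl <;> simpa [h81, h9, hzu] using this
  · rintro u τ ⟨hu, h80, h81, h6, h9, h63, hO, hy, hacc, hw, hold⟩ hb
    rw [Test.holds_lt, h80, h63] at hb
    rw [run_block_cons, run_load, run_block_cons, run_load, run_block_cons, run_store,
      run_block_cons, run_add]
    refine ⟨by simp [h81, h9]; omega, ?_⟩
    rw [run_block_cons, run_store, run_block_cons, run_store, run_block_cons, run_store,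
      run_block_cons, run_copy, run_block_cons, run_add]
    refine ⟨by simp [h80, h9]; omega, ?_⟩
    rw [run_block_nil]
    refine ⟨u + 1, ⟨hb, by simp [h80, h9], by simp [h81, h9]; omega, by simp [h6], by simp [h9],
      by simp [h63], by simp [hO], by simp [hy], by simp [hacc], ?_, ?_⟩, by omega⟩
    · intro w hwu
      by_cases hwu' : w = u
      · subst hwu'
        simp [h81, h9, hO, hy, h80, add_assoc]
      · have hne : off + w ≠ off + u := by omega
        simpa [h81, h9, hO, hy, h80, hwu'] using hw w (by omega)
    · intro z hz a ha
      have := hold z hz a ha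
      simp only [List.mem_cons, List.not_mem_nil, or_false] at ha
      have hzu : z ≠ off + u := by omega
      rcases ha with rfl | rfl | rfl | rfl <;> simpa [h81, hzu] using this
  · subst hσ₁
    refine ⟨by omega, by simp [h8], by simp [h6], by simp [h6], by simp [h9], by simp [h63],
      by simp [hO], by simp [hy], by simp, by simp, ?_⟩
    intro z hz a ha
    simp only [List.mem_cons, List.not_mem_nil, or_false] at ha
    rcases ha with rfl | rfl | rfl | rfl <;> simp

/-- The part of the memory that is constant during the search for long cycles. -/
structure GraphMem (e : ℕ) (O T G HO NO dg uo cand : ℕ → ℕ) (b : ℕ) (σ : Mem) : Prop where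
  r1 : σ.reg 1 = e
  r8 : σ.reg 8 = 0
  r9 : σ.reg 9 = 1
  r75 : σ.reg 75 = 2 * e
  r90 : σ.reg 90 = b
  aO : σ.arr 0 = O
  aT : σ.arr 1 = T
  aG : σ.arr 3 = G
  aHO : σ.arr 14 = HO
  aNO : σ.arr 15 = NO
  adg : σ.arr 18 = dg
  auo : σ.arr 23 = uo
  acand : σ.arr 24 = cand

theorem GraphMem.frame {p : Prog} (h : GraphMem e O T G HO NO dg uo cand b σ) (hF : Frame p σ σ')
    (hr : ∀ x ∈ [1, 8, 9, 75, 90], x ∉ p.wr) (ha : ∀ a ∈ [0, 1, 3, 14, 15, 18, 23, 24], a ∉ p.wa) :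
    GraphMem e O T G HO NO dg uo cand b σ' := by
  obtain ⟨r1, r8, r9, r75, r90, aO, aT, aG, aHO, aNO, adg, auo, acand⟩ := h
  constructor
  all_goals first
    | (rw [hF.1 _ (hr _ (by simp))]; assumption)
    | (rw [hF.2 _ (ha _ (by simp))]; assumption)

/-- The memory after the search through the start edges less than `i`. -/
def FoundMem (e : ℕ) (O T G dg cand : ℕ → ℕ) (β i : ℕ) (σ : Mem) : Prop :=
  ∃ (r : ℕ) (y : ℕ → ℕ → ℕ) (len p off : ℕ → ℕ),
    Found e O T G dg cand β i r y len p (σ.arr 28) ∧ off 0 = 0 ∧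
    (∀ j < r, off (j + 1) = off j + len j) ∧ off r ≤ r * (2 * e) ∧ σ.reg 6 = off r ∧
    σ.reg 7 = off r ∧ ∀ j < r, Written O (off j) (len j) (y j) σ

theorem Written.congr {off k : ℕ} {y : ℕ → ℕ} (h : Written O off k y σ)
    (hz : ∀ z < off + k, ∀ a ∈ [10, 11, 12, 13], σ'.arr a z = σ.arr a z) :
    Written O off k y σ' := by
  intro u hu
  rw [hz _ (by omega) 10 (by simp), hz _ (by omega) 11 (by simp), hz _ (by omega) 12 (by simp),
    hz _ (by omega) 13 (by simp)]
  exact h u hu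

/-- Cycles in triangular position. -/
def BettiBound (e : ℕ) (O T : ℕ → ℕ) (β : ℕ) : Prop :=
  ∀ (r : ℕ) (y : ℕ → ℕ → ℕ) (p : ℕ → ℕ), (∀ j < r, NPath e O T (y j) ∧ 0 < per (y j)) →
    (∀ j < r, ∀ l < r, ∀ t, p j ≤ p l → y j t = y l 0 → j = l) → r ≤ β

/-- Ordered by label period the cycles are in triangular position, with their first edges as marked
edges. This holds for all accepted cycles at any time, so it also bounds the size of the output. -/
theorem Found.le (hG : Immersive e O G) (hB : BettiBound e O T β) {r : ℕ} {y : ℕ → ℕ → ℕ}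
    {len p : ℕ → ℕ} (h : Found e O T G dg cand β i r y len p acc) : r ≤ β :=
  hB r y p (fun j hj => ⟨(h.closes j hj).path, by
    rw [(h.closes j hj).per]; exact (h.closes j hj).pos⟩) (h.independent hG)

/-- Prepare the walk along the labels in array `25`. -/
def initFollow : Prog :=
  .block [.copy 63 8, .copy 64 8, .copy 65 8, .load 66 0 60, .copy 76 66, .copy 67 9, .copy 68 8,
    .copy 69 8]

theorem initFollow_run {p s : ℕ} (hM : GraphMem e O T G HO NO dg uo cand b σ)
    (h60 : σ.reg 60 = s) (h62 : σ.reg 62 = p) :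
    Run W initFollow σ fun t σ' => t ≤ 9 ∧ FollowMem T G HO NO (σ.arr 28) (σ.arr 25) (2 * e) (O s)
      p 0 0 0 (O s) 0 0 1 (σ.arr 27) σ' := by
  obtain ⟨r1, r8, r9, r75, r90, aO, aT, aG, aHO, aNO, adg, auo, acand⟩ := hM
  simp only [initFollow, run_block_cons, run_copy, run_load, run_block_nil]
  refine ⟨by omega, ?_⟩
  constructor <;> simp [*]

/-- Output the cycle that has been found if it is long and new. -/
def acceptCycle : Prog :=
  .block [.add 77 62 62, .ite (.eq 69 9) (.ite (.lt 65 90) .skip (.ite (.lt 61 77) .skip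
    (.ite (.eq 68 8) emitCycle .skip))) .skip]

theorem acceptCycle_run {Q : ℕ → Mem → Prop} {p L d dup cl : ℕ} (hW : 2 * p ≤ W) (h8 : σ.reg 8 = 0)
    (h9 : σ.reg 9 = 1) (h61 : σ.reg 61 = L) (h62 : σ.reg 62 = p) (h65 : σ.reg 65 = d)
    (h68 : σ.reg 68 = dup) (h69 : σ.reg 69 = cl) (h90 : σ.reg 90 = b)
    (hyes : cl = 1 → b ≤ d → 2 * p ≤ L → dup = 0 → Run W emitCycle (σ.setReg 77 (2 * p)) fun t =>
      Q (t + 6))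
    (hno : ¬ (cl = 1 ∧ b ≤ d ∧ 2 * p ≤ L ∧ dup = 0) → ∀ t ≤ 7, Q t (σ.setReg 77 (2 * p))) :
    Run W acceptCycle σ Q := by
  rw [acceptCycle, run_block_cons, run_add]
  refine ⟨by rw [h62]; omega, ?_⟩
  rw [h62, ← two_mul, run_block_cons]
  simp only [run_ite, Test.holds_eq, Test.holds_lt, run_skip, run_block_nil, Mem.reg_setReg,
    reduceIte, Nat.reduceEqDiff, h8, h9, h61, h65, h68, h69, h90]
  refine ⟨fun h1 => ⟨fun h2 => hno (by omega) _ (by omega), fun h2 =>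
    ⟨fun h3 => hno (by omega) _ (by omega), fun h3 => ⟨fun h4 => ?_, fun h4 =>
      hno (by omega) _ (by omega)⟩⟩⟩, fun h1 => hno (by omega) _ (by omega)⟩
  refine (hyes h1 (by omega) (by omega) h4).mono fun t σ' h => ?_
  convert h using 1
  omega

/-- Search for a long cycle that starts with the edge in register `60`. -/
def processStart : Prog :=
  .block [walkSegment, wordPeriod, initFollow, followLabels, acceptCycle]

theorem processStart_run (hG : Immersive e O G) (hL : LiveDeg e O T dg)
    (hU : LiveOut e O T dg uo) (hFO : Fibres e O HO NO) (hD : ∀ z, fibreCard e O z ≤ D)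
    (hB : BettiBound e O T β) (hβ : 0 < β) (hi : i < e) (hWe : 2 * e + 1 ≤ W)
    (hWβ : (β + 1) * (2 * e) ≤ W) (hM : GraphMem e O T G HO NO dg uo cand (12 * β) σ)
    (h60 : σ.reg 60 = i) (hf : FoundMem e O T G dg cand β i σ) :
    Run W processStart σ fun t σ' => t ≤ (10 * D + 40) * (2 * e + 1) + 70 * e + 100 ∧
      FoundMem e O T G dg cand β (i + 1) σ' := by
  refine Run.block_cons (walkSegment_run (s := i) (by omega) (by omega) hM.r1 hM.r8 hM.r9 h60
    hM.aT hM.aG hM.adg hM.auo) ?_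
  rintro t₁ σ₁ ⟨ht₁, L, h61, hS, hx⟩ hfr₁
  have hM₁ := hM.frame hfr₁ (by decide) (by decide)
  have hSL := hS.le
  refine Run.block_cons (wordPeriod_run (L := L) (by omega) hS.pos hM₁.r8 hM₁.r9 h61 rfl) ?_
  rintro t₂ σ₂ ⟨ht₂, hp⟩ hfr₂
  have hM₂ := hM₁.frame hfr₂ (by decide) (by decide)
  have h60₂ : σ₂.reg 60 = i := by
    rw [hfr₂.1 60 (by decide), hfr₁.1 60 (by decide), h60]
  have hpL := hp.le
  refine Run.block_cons (initFollow_run hM₂ h60₂ rfl) ?_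
  rintro t₃ σ₃ ⟨ht₃, hM₃⟩ hfr₃
  rw [hfr₂.2 25 (by decide), hfr₂.2 28 (by decide), hfr₁.2 28 (by decide)] at hM₃
  refine Run.block_cons (followLabels_run hFO hD hp.pos (by omega) (by omega) hWe (by omega)
    hM₃) ?_
  rintro t₄ σ₄ ⟨ht₄, k, d, dup, cl, y, hk, h63, h65, h68, h69, hy, hF, hdup, hend⟩ hfr₄
  have hM₄ := (hM₂.frame hfr₃ (by decide) (by decide)).frame hfr₄ (by decide) (by decide)
  have h60₄ : σ₄.reg 60 = i := by rw [hfr₄.1 60 (by decide), hfr₃.1 60 (by decide), h60₂]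
  have h61₄ : σ₄.reg 61 = L := by
    rw [hfr₄.1 61 (by decide), hfr₃.1 61 (by decide), hfr₂.1 61 (by decide), h61]
  have h62₄ : σ₄.reg 62 = σ₂.reg 62 := by
    rw [hfr₄.1 62 (by decide), hfr₃.1 62 (by decide)]
  have hold : ∀ a ∈ [10, 11, 12, 13, 28], σ₄.arr a = σ.arr a := by
    intro a ha
    simp only [List.mem_cons, List.not_mem_nil, or_false] at ha
    rw [hfr₄.2 a, hfr₃.2 a, hfr₂.2 a, hfr₁.2 a]
    all_goals rcases ha with rfl | rfl | rfl | rfl | rfl <;> decide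
  have h6 : σ₄.reg 6 = σ.reg 6 := by
    rw [hfr₄.1 6 (by decide), hfr₃.1 6 (by decide), hfr₂.1 6 (by decide), hfr₁.1 6 (by decide)]
  have h7 : σ₄.reg 7 = σ.reg 7 := by
    rw [hfr₄.1 7 (by decide), hfr₃.1 7 (by decide), hfr₂.1 7 (by decide), hfr₁.1 7 (by decide)]
  set p := σ₂.reg 62 with hpdef
  obtain ⟨r, ys, len, ps, off, hfound, hoff0, hoff, hoffle, hr6, hr7, hwr⟩ := hf
  have hrβ := hfound.le hG hB
  -- All cycles to be found at this start edge have the same labels and are traced by this one walk,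
  -- so a single attempt per start edge is complete.
  have hfollow : ∀ F, LongStart e O T G dg cand β F → F 0 = i → cl = 1 ∧
      per (fun t => G (F t)) = p ∧ k = per F ∧ 12 * β ≤ d ∧ 2 * p ≤ L ∧ ∀ t < k, y t = F t := by
    rintro F hF' rfl
    exact hF'.follow hG hL hU hβ hS hx hp hF hend
  refine Run.block_cons (Q' := fun t σ' => t ≤ 24 * e + 30 ∧
    FoundMem e O T G dg cand β (i + 1) σ') ?_ ?_
  swap
  · rintro t₅ σ₅ ⟨ht₅, h⟩ -
    rw [run_block_nil]
    exact ⟨by omega, h⟩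
  refine acceptCycle_run (by omega) hM₄.r8 hM₄.r9 h61₄ h62₄ h65 h68 h69 hM₄.r90 ?_ ?_
  · intro hcl hbd h2p hdup0
    subst hcl
    rcases hend with ⟨hk0, hkd, hv⟩
    have hcl := hF.closes hG hL hU hi hS hx hp hk0 hkd hv h2p
    -- At most `β` cycles have been written before, each of at most `2 * e` edges, and one more fits
    -- into the word size.
    have hoffk : off r + k ≤ (β + 1) * (2 * e) := by
      have : r * (2 * e) ≤ β * (2 * e) := Nat.mul_le_mul_right _ hrβ
      rw [Nat.succ_mul]
      omega
    refine Run.mono (emitCycle_run (off := off r) (k := k) (O := O) (y := y) (by omega) hk0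
      (by simp [h6, hr6]) (by simp [hM₄.r8]) (by simp [hM₄.r9]) (by simp [h63]) (by simp [hM₄.aO])
      (by simp [hy])) ?_
    rintro t₅ σ₅ ⟨ht₅, h6₅, h7₅, hacc₅, hw₅, hold₅⟩
    refine ⟨by omega, r + 1, Function.update ys r fun t => y (t % k), Function.update len r k,
      Function.update ps r p, Function.update off (r + 1) (off r + k), ?_, ?_, ?_, ?_, ?_, ?_, ?_⟩
    · rw [hacc₅]
      simp only [Mem.arr_setReg, Mem.reg_setReg, Nat.reduceEqDiff, reduceIte, h60₄, h62₄]
      rw [hold 28 (by simp)]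
      refine hfound.accept hcl ?_ ?_ ?_
      · rw [hkd, mul_comm p]
        exact Nat.mul_le_mul_right _ hbd
      · intro t ht
        rw [Nat.mod_eq_of_lt ht]
        exact hdup.1 hdup0 t ht
      · intro F hF' h0 t
        obtain ⟨-, -, hkF, -, -, hyF⟩ := hfollow F hF' h0
        rw [hyF _ (Nat.mod_lt _ hk0), hkF, apply_mod (per_spec F)]
    · rw [Function.update_of_ne (by omega), hoff0]
    · intro j hj
      rcases Nat.lt_succ_iff_lt_or_eq.1 hj with hj | rfl
      · rw [Function.update_of_ne (by omega), Function.update_of_ne (by omega),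
          Function.update_of_ne (by omega), hoff j hj]
      · rw [Function.update_self, Function.update_self, Function.update_of_ne (by omega)]
    · rw [Function.update_self, Nat.succ_mul]
      omega
    · rw [Function.update_self, h6₅]
    · rw [Function.update_self, h7₅]
    · intro j hj
      rcases Nat.lt_succ_iff_lt_or_eq.1 hj with hj | rfl
      · rw [Function.update_of_ne (by omega), Function.update_of_ne (by omega),
          Function.update_of_ne (by omega)]
        have hle := off_le off len hoff hj le_rfl
        refine (hwr j hj).congr fun z hz a ha => ?_
        rw [hold₅ z (by omega) a ha, Mem.arr_setReg, hold a (by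
          simp only [List.mem_cons, List.not_mem_nil, or_false] at ha ⊢
          omega)]
      · rw [Function.update_self, Function.update_self, Function.update_of_ne (by omega)]
        intro u hu
        simp only [Nat.mod_eq_of_lt hu]
        exact hw₅ u hu
  · intro hno t ht
    refine ⟨by omega, r, ys, len, ps, off, ?_, hoff0, hoff, hoffle, by simp [h6, hr6],
      by simp [h7, hr7], ?_⟩
    · rw [Mem.arr_setReg, hold 28 (by simp)]
      refine hfound.next fun F hF' h0 => ?_
      obtain ⟨h1, h2, hkF, h3, h4, hyF⟩ := hfollow F hF' h0
      -- A long cycle passes all other tests, so its rejection means that it meets a found cycle of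
      -- the same label period, and then it is that cycle.
      have hdup1 : ¬ dup = 0 := fun h => hno ⟨h1, h3, h4, h⟩
      rw [hdup] at hdup1
      push Not at hdup1
      obtain ⟨u, hu, hacc⟩ := hdup1
      exact hfound.of_acc hG hF'.toLongPath (t := u) (by rw [← hyF u hu, hacc, h2])
    · intro j hj
      refine (hwr j hj).congr fun z hz a ha => ?_
      rw [Mem.arr_setReg, hold a (by
        simp only [List.mem_cons, List.not_mem_nil, or_false] at ha ⊢
        omega)]

/-- Test whether the edge in register `60` is a start edge. -/
def testStart : Prog :=
  .block [.copy 94 8, .load 91 1 60, .load 91 18 91, .ite (.lt 8 91) (.block [.load 91 0 60,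
    .load 91 18 91, .ite (.lt 9 91) (.copy 94 9) .skip, .load 92 24 60,
    .ite (.eq 92 9) (.copy 94 9) .skip]) .skip]

theorem testStart_run (hM : GraphMem e O T G HO NO dg uo cand b σ) (h60 : σ.reg 60 = i)
    (hi : i < e) :
    Run W testStart σ fun t σ' => t ≤ 20 ∧ (σ'.reg 94 = 1 ↔ Start e O T dg cand i) := by
  obtain ⟨r1, r8, r9, r75, r90, aO, aT, aG, aHO, aNO, adg, auo, acand⟩ := hM
  rw [testStart, run_block_cons, run_copy, run_block_cons, run_load, run_block_cons, run_load,
    run_block_cons, run_ite]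
  constructor
  · intro h0
    simp [h60, aT, adg, r8] at h0
    have hl : Live e T dg i := ⟨hi, h0.ne'⟩
    rw [run_block_cons, run_load, run_block_cons, run_load, run_block_cons, run_ite]
    constructor
    · intro h1
      simp [h60, aO, adg, r9] at h1
      rw [run_copy, run_block_cons, run_load, run_block_cons, run_ite]
      constructor
      · intro h2
        rw [run_copy, run_block_nil, run_block_nil]
        exact ⟨by omega, by simp [r9, Start, hl]; omega⟩
      · intro h2
        rw [run_skip, run_block_nil, run_block_nil]
        exact ⟨by omega, by simp [r9, Start, hl]; omega⟩
    · intro h1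
      simp [h60, aO, adg, r9] at h1
      rw [run_skip, run_block_cons, run_load, run_block_cons, run_ite]
      constructor
      · intro h2
        simp [h60, acand, r9] at h2
        rw [run_copy, run_block_nil, run_block_nil]
        exact ⟨by omega, by simp [r9, Start, hl, h2]⟩
      · intro h2
        simp [h60, acand, r9] at h2
        rw [run_skip, run_block_nil, run_block_nil]
        exact ⟨by omega, by simp [r8, Start, hl, h2]; omega⟩
  · intro h0
    simp [h60, aT, adg, r8] at h0
    rw [run_skip, run_block_nil]
    exact ⟨by omega, by simp [r8, Start, Live, h0]⟩

/-- Search for long cycles at all start edges. -/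
def findCycles : Prog :=
  .loop (.lt 60 1) (.block [testStart, .ite (.eq 94 9) processStart .skip, .add 60 60 9])

theorem FoundMem.frame {p : Prog} (h : FoundMem e O T G dg cand β i σ) (hF : Frame p σ σ')
    (hr : ∀ x ∈ [6, 7], x ∉ p.wr) (ha : ∀ a ∈ [10, 11, 12, 13, 28], a ∉ p.wa) :
    FoundMem e O T G dg cand β i σ' := by
  obtain ⟨r, y, len, p, off, h1, h2, h3, h4, h5, h6, h7⟩ := h
  refine ⟨r, y, len, p, off, by rwa [hF.2 28 (ha _ (by simp))], h2, h3, h4,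
    by rwa [hF.1 6 (hr _ (by simp))], by rwa [hF.1 7 (hr _ (by simp))], fun j hj =>
    (h7 j hj).congr fun z _ a haa => by rw [hF.2 a (ha a (by
      simp only [List.mem_cons, List.not_mem_nil, or_false] at haa ⊢
      omega))]⟩

-- Testing an edge has constant cost, and only the at most `3 β` start edges trigger a walk; the
-- potential counts the start edges that are still to come.
open Classical in
theorem findCycles_run (hG : Immersive e O G) (hL : LiveDeg e O T dg)
    (hU : LiveOut e O T dg uo) (hFO : Fibres e O HO NO) (hD : ∀ z, fibreCard e O z ≤ D)
    (hB : BettiBound e O T β)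
    (hS : ((Finset.range e).filter (Start e O T dg cand)).card ≤ 3 * β) (hWe : 2 * e + 1 ≤ W)
    (hWβ : (β + 1) * (2 * e) ≤ W) (hM : GraphMem e O T G HO NO dg uo cand (12 * β) σ)
    (h60 : σ.reg 60 = 0) (hf : FoundMem e O T G dg cand β 0 σ) :
    Run W findCycles σ fun t σ' =>
      t ≤ 30 * e + 3 * β * ((10 * D + 40) * (2 * e + 1) + 70 * e + 100) + 1 ∧
      FoundMem e O T G dg cand β e σ' := by
  set K := (10 * D + 40) * (2 * e + 1) + 70 * e + 100 with hK
  have key := Run.loop (W := W) (σ := σ) (b := .lt 60 1)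
    (p := .block [testStart, .ite (.eq 94 9) processStart .skip, .add 60 60 9])
    (fun i σ => i ≤ e ∧ σ.reg 60 = i ∧ GraphMem e O T G HO NO dg uo cand (12 * β) σ ∧
      FoundMem e O T G dg cand β i σ)
    (fun i => 30 * (e - i) +
      ((Finset.Ico i e).filter (Start e O T dg cand)).card * K) ?_ (a := 0)
    ⟨by omega, h60, hM, hf⟩
  · refine key.mono ?_
    rintro t σ' ⟨i, ⟨hi, h60, hM, hf⟩, hb, ht⟩
    rw [Test.holds_lt, h60, hM.r1] at hb
    obtain rfl : i = e := by omega
    refine ⟨?_, hf⟩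
    rw [← Finset.range_eq_Ico] at ht
    have := Nat.mul_le_mul_right K hS
    omega
  · rintro i σ ⟨hi, h60, hM, hf⟩ hb
    rw [Test.holds_lt, h60, hM.r1] at hb
    refine Run.block_cons (testStart_run hM h60 hb) ?_
    rintro t₁ σ₁ ⟨ht₁, h94⟩ hfr₁
    have hM₁ := hM.frame hfr₁ (by decide) (by decide)
    have hf₁ := hf.frame hfr₁ (by decide) (by decide)
    have h60₁ : σ₁.reg 60 = i := by rw [hfr₁.1 60 (by decide), h60]
    have hins : Finset.Ico i e = insert i (Finset.Ico (i + 1) e) := by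
      ext z; simp only [Finset.mem_Ico, Finset.mem_insert]; omega
    rw [hins, Finset.filter_insert, run_block_cons, run_ite]
    constructor
    · intro hs
      rw [Test.holds_eq, hM₁.r9, h94] at hs
      rw [if_pos hs, Finset.card_insert_of_notMem (by simp)]
      -- The existence of a start edge forces `β > 0`, by the bound on their number.
      have hβ : 0 < β := by
        have := Finset.card_pos.2 ⟨i, Finset.mem_filter.2 ⟨Finset.mem_range.2 hb, hs⟩⟩
        omega
      refine Run.mono (Run.frame (processStart_run hG hL hU hFO hD hB hβ hb hWe hWβ hM₁ h60₁
        hf₁)) ?_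
      rintro t₂ σ₂ ⟨⟨ht₂, hf₂⟩, hfr₂⟩
      have hM₂ := hM₁.frame hfr₂ (by decide) (by decide)
      have h60₂ : σ₂.reg 60 = i := by rw [hfr₂.1 60 (by decide), h60₁]
      rw [run_block_cons, run_add]
      refine ⟨by rw [h60₂, hM₂.r9]; omega, ?_⟩
      rw [run_block_nil]
      refine ⟨i + 1, ⟨hb, by simp [h60₂, hM₂.r9], ?_, ?_⟩, ?_⟩
      · obtain ⟨r1, r8, r9, r75, r90, aO, aT, aG, aHO, aNO, adg, auo, acand⟩ := hM₂
        constructor <;> simp [*]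
      · obtain ⟨r, y, len, p, off, h1, h2, h3, h4, h5, h6, h7⟩ := hf₂
        exact ⟨r, y, len, p, off, h1, h2, h3, h4, by simpa using h5, by simpa using h6, h7⟩
      · rw [add_mul _ 1 K, one_mul]
        omega
    · intro hs
      rw [Test.holds_eq, hM₁.r9, h94] at hs
      rw [if_neg hs, run_skip, run_block_cons, run_add]
      refine ⟨by rw [h60₁, hM₁.r9]; omega, ?_⟩
      rw [run_block_nil]
      refine ⟨i + 1, ⟨hb, by simp [h60₁, hM₁.r9], ?_, ?_⟩, by omega⟩
      · obtain ⟨r1, r8, r9, r75, r90, aO, aT, aG, aHO, aNO, adg, auo, acand⟩ := hM₁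
        constructor <;> simp [*]
      · obtain ⟨r, y, len, p, off, h1, h2, h3, h4, h5, h6, h7⟩ := hf₁
        refine ⟨r, y, len, p, off, h1.next ?_, h2, h3, h4, by simpa using h5, by simpa using h6,
          h7⟩
        rintro F hF rfl
        exact absurd hF.start hs

end LongCycleSearch

/-! ## Graphs as tables -/

section Tables

variable {v e v' e' : ℕ} {Γ : DGraph (Fin v) (Fin e)} {Δ : DGraph (Fin v') (Fin e')}

theorem table_val {p q : ℕ} (f : Fin p → Fin q) (i : Fin p) : table f i = f i := by
  simp [table]

theorem table_of_lt {p q : ℕ} (f : Fin p → Fin q) {i : ℕ} (h : i < p) : table f i = f ⟨i, h⟩ := by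
  simp [table, h]

theorem table_lt {p q : ℕ} (f : Fin p → Fin q) {i : ℕ} (h : i < p) : table f i < q := by
  rw [table_of_lt f h]; exact (f ⟨i, h⟩).2

theorem per_comp_injective {A B : Type*} {a : ℕ → A} {g : A → B} (hg : Function.Injective g) :
    per (fun i => g (a i)) = per a :=
  Nat.dvd_antisymm (per_comp_dvd g) (per_dvd fun i => hg (per_spec (fun i => g (a i)) i))

theorem IsPath.nPath {F : ℕ → Fin e} (h : IsPath Γ F) :
    NPath e (table Γ.o) (table Γ.t) fun i => F i := fun i =>
  ⟨(F i).2, by rw [table_val, table_val, h i]⟩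

/-- A path in the table of a graph, as a path in the graph. -/
def NPath.lift {O T F : ℕ → ℕ} (h : NPath e O T F) : ℕ → Fin e := fun i => ⟨F i, (h i).1⟩

theorem NPath.isPath {F : ℕ → ℕ} (h : NPath e (table Γ.o) (table Γ.t) F) : IsPath Γ h.lift := by
  intro i
  exact Fin.ext ((table_of_lt _ (h i).1).symm.trans
    ((h i).2.trans (table_of_lt _ (h (i + 1)).1)))

theorem NPath.per_lift {O T F : ℕ → ℕ} (h : NPath e O T F) : per h.lift = per F :=
  (per_comp_injective (a := h.lift) Fin.val_injective).symm

theorem per_label (f : Fin e → Fin e') (F : ℕ → Fin e) :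
    per (fun i => table f (F i)) = per (fun i => f (F i)) := by
  simp only [table_val]
  exact per_comp_injective (a := fun i => f (F i)) Fin.val_injective

theorem Hom.IsForwardsImmersion.immersive {γ : Hom Γ Δ} (h : γ.IsForwardsImmersion) :
    Immersive e (table Γ.o) (table γ.onE) := by
  intro i hi j hj hO hG
  rw [table_of_lt _ hi, table_of_lt _ hj] at hO hG
  exact congrArg Fin.val (h _ (Fin.ext hO) rfl (Fin.ext hG))

theorem card_le_betti_of_nPath {ι : Type*} [Fintype ι] (F : ι → ℕ → ℕ) (p : ι → ℕ)
    (hF : ∀ i, NPath e (table Γ.o) (table Γ.t) (F i)) (hper : ∀ i, 0 < per (F i))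
    (hmiss : ∀ i j t, p i ≤ p j → F i t = F j 0 → i = j) : Fintype.card ι ≤ Γ.betti := by
  refine Γ.card_le_betti (fun i => (hF i).lift) (fun i => per (F i)) p (fun i => (hF i).isPath)
    (fun i t => ?_) hper fun i j t hp h => hmiss i j t hp (congrArg Fin.val h)
  exact Fin.ext (per_spec (F i) t)

theorem bettiBound : BettiBound e (table Γ.o) (table Γ.t) Γ.betti := by
  intro r y p hy h
  have := card_le_betti_of_nPath (Γ := Γ) (fun j : Fin r => y j) (fun j => p j)
    (fun j => (hy j j.2).1) (fun j => (hy j j.2).2)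
    fun i j t hp ht => Fin.ext (h i i.2 j j.2 t hp ht)
  simpa using this

theorem card_filter_range {P : ℕ → Prop} [DecidablePred P] :
    ((Finset.range e).filter P).card = (Finset.univ.filter fun i : Fin e => P i).card := by
  rw [← Finset.card_map Fin.valEmbedding]
  congr 1
  ext j
  simp only [Finset.mem_filter, Finset.mem_range, Finset.mem_map, Finset.mem_univ, true_and,
    Fin.valEmbedding_apply]
  exact ⟨fun h => ⟨⟨j, h.1⟩, h.2, rfl⟩, by rintro ⟨i, h, rfl⟩; exact ⟨i.2, h⟩⟩

theorem fibreCard_table_le (x : ℕ) :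
    fibreCard e (table Γ.o) x ≤ Γ.betti + Γ.boundary.ncard + 1 := by
  rw [fibreCard, card_filter_range]
  simp only [table_val]
  by_cases hx : x < v
  · refine le_trans (Finset.card_le_card ?_) (Γ.outdegree_le ⟨x, hx⟩)
    intro j
    simp [Fin.ext_iff]
  · rw [Finset.card_eq_zero.2]
    · omega
    · ext j
      have := (Γ.o j).2
      simp only [Finset.mem_filter, Finset.mem_univ, true_and, Finset.notMem_empty, iff_false]
      omega

/-- With all vertices labelled, edges do not change the label, and vertices with equal labels are
joined by edges, hence homologous; this is the input for Euler's formula. -/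
theorem Search.betti_eq {c q : ℕ} {lab Q : ℕ → ℕ}
    (h : Search v e (table Γ.o) (table Γ.t) c q q lab Q) (hlab : ∀ x < v, lab x ≠ 0) :
    Γ.betti + v = e + c := by
  have hpos : ∀ x < v, 0 < lab x := fun x hx => Nat.pos_of_ne_zero (hlab x hx)
  -- Connections are recorded between natural numbers, so the class of a vertex is extended by zero
  -- to all of `ℕ`.
  let f : ℕ → (Fin v →₀ ℚ) := fun a => if h : a < v then Finsupp.single ⟨a, h⟩ 1 else 0
  have hf : ∀ a b, Relation.EqvGen (fun a b => ∃ j < e, a = table Γ.o j ∧ b = table Γ.t j) a b →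
      f a - f b ∈ LinearMap.range Γ.chainBoundary := by
    intro a b hab
    induction hab with
    | rel a b hab =>
      obtain ⟨j, hj, rfl, rfl⟩ := hab
      refine ⟨- Finsupp.single ⟨j, hj⟩ 1, ?_⟩
      rw [map_neg, Γ.chainBoundary_single, table_of_lt _ hj, table_of_lt _ hj]
      simp [f]
    | refl a => simp
    | symm a b _ ih => rw [← neg_sub]; exact neg_mem ih
    | trans a b c _ _ ih1 ih2 => simpa using add_mem ih1 ih2
  have key := Γ.betti_eq (c := c)
    -- Labels in memory begin with `1`, as `0` stands for vertices not yet found.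
    (fun x => ⟨lab x - 1, by have := h.lab_le x; have := hpos x x.2; omega⟩) ?_ ?_ ?_
  · simpa using key
  · intro k
    obtain ⟨x, hx, hk⟩ := h.surj (k + 1) (by omega) (by omega)
    exact ⟨⟨x, hx⟩, Fin.ext (by simp [hk])⟩
  · intro j
    obtain ⟨i, hi, hiQ⟩ := (h.found (Γ.o j)).1 (hlab _ (Γ.o j).2)
    have := h.edge j j.2 i hi (Or.inl (by rw [table_val]; exact hiQ))
    rw [table_val, table_val] at this
    simp [this]
  · intro x w hxw
    have h1 := hpos x x.2
    have h2 := hpos w w.2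
    rw [Fin.mk.injEq] at hxw
    have := hf x w (h.conn x w h1.ne' (by omega))
    simpa [f] using this

variable {dg uo mark cand : ℕ → ℕ}

-- The live edges form a subgraph without sinks, in which at most `2 β₁` edges leave branching
-- vertices. The candidates lie on circles with different marks, hence disjoint and independent in
-- homology, which adds at most `β₁`.
open Classical in
theorem card_start_le (hL : LiveDeg e (table Γ.o) (table Γ.t) dg)
    (hU : LiveOut e (table Γ.o) (table Γ.t) dg uo)
    (hC : Circles e (table Γ.o) (table Γ.t) dg uo e mark cand) :
    ((Finset.range e).filter (Start e (table Γ.o) (table Γ.t) dg cand)).card ≤ 3 * Γ.betti := by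
  let L : Finset (Fin e) := Finset.univ.filter fun j => dg (table Γ.t j) ≠ 0
  have hdeg : ∀ j : Fin e, dg (table Γ.o j) = (L.filter fun i => Γ.o i = Γ.o j).card := by
    intro j
    rw [hL.deg, card_filter_range, Finset.filter_filter]
    congr 1
    ext i
    simp only [Finset.mem_filter, Finset.mem_univ, true_and, table_val, Fin.ext_iff]
    exact and_comm
  have h1 := Γ.card_branch_le L fun j hj => by
    obtain ⟨i, hi, hij⟩ := hL.exists_next (j := j) ⟨j.2, by simpa [L] using hj⟩
    refine ⟨⟨i, hi.1⟩, by simpa [L] using hi.2, Fin.ext ?_⟩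
    rwa [table_of_lt _ hi.1, table_val] at hij
  have hnl : ∀ c, cand c = 1 → ∀ t,
      Live e (table Γ.t) dg ((fun j => uo (table Γ.t j))^[t] c) := by
    intro c hc t
    obtain ⟨k, hk, hkc, hm⟩ := hC.cycle c hc
    exact (hC.mark_live _ (by rw [hm]; exact hC.cand_mark c hc)).1
  have h2 : Fintype.card {c : Fin e // cand c = 1} ≤ Γ.betti := by
    refine card_le_betti_of_nPath (fun c t => (fun j => uo (table Γ.t j))^[t] c) (fun _ => 0)
      ?_ ?_ ?_
    · intro c t
      have hl := hnl c c.2 t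
      refine ⟨hl.1, ?_⟩
      simp only [Function.iterate_succ_apply']
      exact (hU.live_next hL hl).2.symm
    · intro c
      obtain ⟨k, hk, hkc, -⟩ := hC.cycle c c.2
      refine per_pos hk fun t => ?_
      rw [Function.iterate_add_apply, hkc]
    · intro c c' t _ ht
      simp only [Function.iterate_zero, id_eq] at ht
      obtain ⟨k, hk, hkc, hm⟩ := hC.cycle c c.2
      have := hm t
      rw [ht] at this
      exact Subtype.ext (Fin.ext (hC.unique _ _ c.2 c'.2 this.symm))
  rw [Fintype.card_subtype] at h2
  rw [card_filter_range]
  refine le_trans (Finset.card_le_card (t := (L.filter fun j =>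
    2 ≤ (L.filter fun i => Γ.o i = Γ.o j).card) ∪ Finset.univ.filter fun c : Fin e =>
    cand c = 1) ?_) ((Finset.card_union_le _ _).trans (by omega))
  intro j hj
  obtain ⟨hl, hs⟩ := (Finset.mem_filter.1 hj).2
  rw [Finset.mem_union, Finset.mem_filter, ← hdeg]
  rcases hs with hs | hs
  · exact Or.inl ⟨by simpa [L] using hl.2, hs⟩
  · exact Or.inr (by simpa using hs)

open Classical in
/-- Every long cycle can be rotated so that it starts with a start edge that is followed by a long
segment. -/
theorem LongPath.exists_longStart {γ : Hom Γ Δ} (hγ : γ.IsForwardsImmersion)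
    (hL : LiveDeg e (table Γ.o) (table Γ.t) dg)
    (hU : LiveOut e (table Γ.o) (table Γ.t) dg uo)
    (hC : Circles e (table Γ.o) (table Γ.t) dg uo e mark cand) {F : ℕ → ℕ}
    (hF : LongPath e (table Γ.o) (table Γ.t) (table γ.onE) Γ.betti F) :
    ∃ c, LongStart e (table Γ.o) (table Γ.t) (table γ.onE) dg cand Γ.betti
      fun t => F (c + t) := by
  have hp := hF.path
  let S : Finset (Fin e) := Finset.univ.filter fun j => Start e (table Γ.o) (table Γ.t) dg cand j
  have hS : ∀ i, hp.lift i ∈ S ↔ Start e (table Γ.o) (table Γ.t) dg cand (F i) := fun i => by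
    simp [S, NPath.lift]
  have hlab : per (fun i => γ.onE (hp.lift i)) = per fun i => table γ.onE (F i) :=
    (per_label γ.onE hp.lift).symm
  have hlive := hL.live_path hp
  have h1 : ∀ i, ¬ Start e (table Γ.o) (table Γ.t) dg cand (F i) → dg (table Γ.o (F i)) = 1 := by
    intro i hi
    have := hL.deg_pos (hlive i)
    have : ¬ 2 ≤ dg (table Γ.o (F i)) := fun h => hi ⟨hlive i, Or.inl h⟩
    omega
  have huniq : ∀ i j, hp.lift i ∉ S → Γ.o (hp.lift j) = Γ.o (hp.lift i) →
      hp.lift j = hp.lift i := by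
    intro i j hi hij
    rw [hS] at hi
    refine Fin.ext (hL.unique (hlive j) (hlive i) ?_ ((h1 i hi).trans_lt one_lt_two))
    rw [table_val, table_val, hij]
  have hcard : S.card ≤ 3 * Γ.betti := by
    have := card_start_le hL hU hC
    rwa [card_filter_range] at this
  -- A path that meets no start edge passes no branching vertex. Its first edge was marked by the
  -- search for circles, so a candidate lies on it after all.
  have hmeet : ∃ i, hp.lift i ∈ S := by
    by_contra hno
    push Not at hno
    have hno' : ∀ i, ¬ Start e (table Γ.o) (table Γ.t) dg cand (F i) := fun i h =>
      hno i ((hS i).2 h)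
    have hone : ∀ t, dg (table Γ.t (F t)) = 1 := fun t => by
      rw [(hp t).2]; exact h1 _ (hno' (t + 1))
    obtain ⟨t, ht⟩ := hC.orbit F hp hone ⟨0, hC.marked _ (hp 0).1 (hlive 0) (hone 0)⟩
    exact hno' t ⟨hlive t, Or.inr ht⟩
  obtain ⟨⟨c, hc, hrun⟩, hshort⟩ := exists_long_run hγ hp.isPath (by rw [hp.per_lift]; exact hF.pos)
    S huniq hcard hmeet (by rw [hlab, hp.per_lift]; exact hF.long)
  have hper := per_shift_eq hF.pos (per_spec F) c
  have hq := Nat.pos_of_dvd_of_pos (per_comp_dvd (a := F) (table γ.onE)) hF.pos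
  have hperl := per_shift_eq (a := fun i => table γ.onE (F i)) hq (per_spec fun i => table γ.onE (F i)) c
  rw [hlab] at hrun
  rw [hp.per_lift, Fintype.card_fin] at hshort
  exact ⟨c, ⟨⟨hp.shift c, by rw [hper]; exact hF.pos, by rw [hper, hperl]; exact hF.long⟩,
    (hS c).1 hc, fun t ht ht2 h => hrun t ht (by rw [hperl] at ht2; exact ht2) ((hS _).2 h),
    by rw [hper]; exact hshort⟩⟩

theorem FoundMem.outputs {γ : Hom Γ Δ} (hγ : γ.IsForwardsImmersion) (he : 0 < e)
    (hL : LiveDeg e (table Γ.o) (table Γ.t) dg)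
    (hU : LiveOut e (table Γ.o) (table Γ.t) dg uo)
    (hC : Circles e (table Γ.o) (table Γ.t) dg uo e mark cand) {σ : Mem}
    (h : FoundMem e (table Γ.o) (table Γ.t) (table γ.onE) dg cand Γ.betti e σ) :
    ∃ (p q : ℕ) (S : DGraph (Fin p) (Fin q)) (s : Hom S Γ), Outputs σ s ∧ IsLongCycles γ s := by
  obtain ⟨r, y, len, p, off, hf, h0, hoff, -, h6, h7, hw⟩ := h
  -- The reduction mod `e` only makes the definition total; it changes nothing for `j < r`.
  let Y : ℕ → ℕ → Fin e := fun j t => ⟨y j t % e, Nat.mod_lt _ he⟩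
  have hY : ∀ j < r, ∀ t, (Y j t : ℕ) = y j t := fun j hj t =>
    Nat.mod_eq_of_lt ((hf.closes j hj).path t).1
  have hYy : ∀ j (hj : j < r), Y j = (hf.closes j hj).path.lift := fun j hj => by
    funext t
    exact Fin.ext (hY j hj t)
  have hper : ∀ j < r, per (Y j) = len j := fun j hj => by
    rw [hYy j hj, NPath.per_lift, (hf.closes j hj).per]
  have hlong : ∀ j < r, IsLong γ (Y j) := by
    intro j hj
    have hc := hf.closes j hj
    refine ⟨hYy j hj ▸ hc.path.isPath, by rw [hper j hj]; exact hc.pos, ?_⟩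
    rw [← per_label, hper j hj]
    simp only [hY j hj]
    rw [hc.label]
    exact hf.long j hj
  have hdist : ∀ i < r, ∀ j < r, ∀ c, (∀ t, Y i t = Y j (c + t)) → i = j := by
    intro i hi j hj c hc
    refine hf.dist i hi j hj c fun t => ?_
    rw [← hY i hi, ← hY j hj, hc]
  have hcompl : ∀ F, IsLong γ F → ∃ j < r, ∃ c, ∀ t, F t = Y j (c + t) := by
    intro F hF
    have hlp : LongPath e (table Γ.o) (table Γ.t) (table γ.onE) Γ.betti fun i => F i :=
      ⟨hF.isPath.nPath, by rw [per_comp_injective Fin.val_injective]; exact hF.per_pos, by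
        rw [per_label, per_comp_injective Fin.val_injective]; exact hF.long⟩
    obtain ⟨c, hc⟩ := hlp.exists_longStart hγ hL hU hC
    obtain ⟨j, hj, c', hc'⟩ := hf.complete _ hc (hlp.path _).1
    -- Completeness yields the rotation of `F` that begins with its start edge; rotating back
    -- recovers `F` itself.
    obtain ⟨d, hd⟩ := exists_rotation_symm (a := fun t => (F (c + t) : ℕ))
      (b := fun t => (F t : ℕ)) hlp.pos
      (per_spec fun t => (F t : ℕ)) fun _ => rfl
    refine ⟨j, hj, c' + d, fun t => Fin.ext ?_⟩
    rw [hY j hj, hd, hc', add_assoc]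
  obtain ⟨S, s, hs, hout⟩ := exists_isLongCycles γ Y off len h0 hoff hper
    (hf.le hγ.immersive bettiBound) hlong hdist
    hcompl
  refine ⟨_, _, S, s, ⟨h6, h7, ?_, ?_, ?_, ?_⟩, hs⟩ <;> intro i <;>
    obtain ⟨j, u, hj, hu, hi, hSo, hSt, hsV, hsE⟩ := hout i <;>
    obtain ⟨e1, e2, e3, e4⟩ := hw j hj u hu
  · rw [hSo, hi, e1]
  · rw [hSt, hi, e2]
  · rw [hsV, hi, e3, ← hY j hj, table_val]
  · rw [hsE, hi, e4, hY j hj]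

/-- A graph without edges has no long cycles. -/
theorem exists_isLongCycles_of_isEmpty {V E V' E' : Type*} [IsEmpty E] {Γ : DGraph V E}
    {Δ : DGraph V' E'} (γ : Hom Γ Δ) :
    ∃ (S : DGraph (Fin 0) (Fin 0)) (s : Hom S Γ), IsLongCycles γ s := by
  refine ⟨⟨id, id⟩, ⟨finZeroElim, finZeroElim, finZeroElim, finZeroElim⟩, 0, finZeroElim,
    ⟨fun x => x.1, fun x => x.1, fun x => x.1.elim0, fun x => x.1.elim0⟩, by omega,
    finZeroElim, ⟨?_, ?_⟩, finZeroElim, finZeroElim, ?_⟩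
  · exact ⟨fun x => x.1.elim0, finZeroElim⟩
  · exact ⟨fun x => x.1.elim0, finZeroElim⟩
  · intro k _ f
    exact isEmptyElim (f.onE 0)

end Tables

/-! ## The algorithm -/

/-- The input registers and arrays that the algorithm uses, and registers and arrays that are still
zero. -/
structure Initial (v e : ℕ) (O T G : ℕ → ℕ) (R A : List ℕ) (σ : Mem) : Prop where
  r0 : σ.reg 0 = v
  r1 : σ.reg 1 = e
  aO : σ.arr 0 = O
  aT : σ.arr 1 = T
  aG : σ.arr 3 = G
  reg : ∀ x ∈ R, σ.reg x = 0
  arr : ∀ a ∈ A, σ.arr a = fun _ => 0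

theorem Initial.frame {v e : ℕ} {O T G : ℕ → ℕ} {R A R' A' : List ℕ} {σ σ' : Mem} {p : Prog}
    (h : Initial v e O T G R A σ) (hF : Frame p σ σ') (hr : ∀ x ∈ [0, 1], x ∉ p.wr)
    (ha : ∀ a ∈ [0, 1, 3], a ∉ p.wa) (hR : ∀ x ∈ R', x ∈ R ∧ x ∉ p.wr)
    (hA : ∀ a ∈ A', a ∈ A ∧ a ∉ p.wa) : Initial v e O T G R' A' σ' where
  r0 := by rw [hF.1 0 (hr 0 (by simp)), h.r0]
  r1 := by rw [hF.1 1 (hr 1 (by simp)), h.r1]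
  aO := by rw [hF.2 0 (ha 0 (by simp)), h.aO]
  aT := by rw [hF.2 1 (ha 1 (by simp)), h.aT]
  aG := by rw [hF.2 3 (ha 3 (by simp)), h.aG]
  reg := fun x hx => by rw [hF.1 x (hR x hx).2, h.reg x (hR x hx).1]
  arr := fun a haa => by rw [hF.2 a (hA a haa).2, h.arr a (hA a haa).1]

/-- Compute twice the number of edges, and twelve times the first Betti number. -/
def computeBounds : Prog :=
  .block [.add 75 1 1, .add 90 1 21, .sub 90 90 0, .add 90 90 90, .add 95 90 90, .add 90 95 95,
    .add 90 90 95]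

theorem computeBounds_run {W v e c β : ℕ} {σ : Mem} (h0 : σ.reg 0 = v) (h1 : σ.reg 1 = e)
    (h21 : σ.reg 21 = c) (hβ : β + v = e + c) (hW : 2 * e ≤ W) (hW' : e + c ≤ W)
    (hWβ : 12 * β ≤ W) :
    Run W computeBounds σ fun t σ' => t ≤ 8 ∧ σ'.reg 75 = 2 * e ∧ σ'.reg 90 = 12 * β := by
  simp [computeBounds, h0, h1, h21]
  omega

/-- Search a graph with edges. -/
def mainLoop : Prog :=
  .block [.const 9 1, buildLists, components, computeBounds, prune, chooseOut, findCircles,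
    findCycles]

/-- The computation of the long cycles. -/
def longCycles : Prog := .ite (.lt 8 1) mainLoop .skip

section Main

variable {v e v' e' : ℕ} {Γ : DGraph (Fin v) (Fin e)} {Δ : DGraph (Fin v') (Fin e')}

/-- Registers `8` and `9` hold the constants `0` and `1` throughout. Each phase relies on zeros in
its own registers and arrays; `Initial` carries the cells that no earlier phase has touched, and its
lists shrink from phase to phase. -/
theorem mainLoop_run {γ : Hom Γ Δ} (hγ : γ.IsForwardsImmersion) (he : 0 < e) {W D : ℕ} {σ : Mem}
    (hD : ∀ x, fibreCard e (table Γ.o) x ≤ D) (hW : 12 * (e + v) + 1 ≤ W)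
    (hW' : (Γ.betti + 1) * (2 * e) ≤ W)
    (hI : Initial v e (table Γ.o) (table Γ.t) (table γ.onE)
      [6, 7, 8, 10, 21, 22, 23, 29, 30, 32, 33, 40, 50, 60] [14, 16, 18, 19, 22, 24, 28] σ) :
    Run W mainLoop σ fun t σ' => t ≤ 170 * e + 70 * v +
        3 * Γ.betti * ((10 * D + 40) * (2 * e + 1) + 70 * e + 100) + 30 ∧
      ∃ (p q : ℕ) (S : DGraph (Fin p) (Fin q)) (s : Hom S Γ),
        Outputs σ' s ∧ IsLongCycles γ s := by
  have hO : ∀ j < e, table Γ.o j < v := fun j hj => table_lt _ hj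
  have hT : ∀ j < e, table Γ.t j < v := fun j hj => table_lt _ hj
  refine Run.block_cons (Q' := fun t τ => t = 1 ∧ τ.reg 9 = 1)
    (run_const.2 ⟨by omega, rfl, by simp⟩) ?_
  rintro _ σ₁ ⟨rfl, h9⟩ hfr
  have hI₁ := hI.frame hfr (by decide) (by decide)
    (R' := [6, 7, 8, 10, 21, 22, 23, 29, 30, 32, 33, 40, 50, 60])
    (A' := [14, 16, 18, 19, 22, 24, 28]) (by decide) (by decide)
  clear hfr
  refine Run.block_cons (buildLists_run (by omega) hI₁.r1 h9 (hI₁.reg _ (by simp)) hI₁.aO hI₁.aT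
    (hI₁.arr _ (by simp)) (hI₁.arr _ (by simp)) (hI₁.arr _ (by simp))) ?_
  rintro t₂ σ₂ ⟨ht₂, hFO, hFI, h18⟩ hfr
  have hI₂ := hI₁.frame hfr (by decide) (by decide)
    (R' := [6, 7, 8, 21, 22, 23, 29, 30, 32, 33, 40, 50, 60])
    (A' := [19, 22, 24, 28]) (by decide) (by decide)
  have h9₂ : σ₂.reg 9 = 1 := by rw [hfr.1 9 (by decide), h9]
  clear hfr
  refine Run.block_cons (components_run (by omega) hO hT hFO hFI (Q := σ₂.arr 20)
    ⟨hI₂.r0, hI₂.reg _ (by simp), h9₂, hI₂.reg _ (by simp), hI₂.reg _ (by simp),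
      hI₂.reg _ (by simp), hI₂.aO, hI₂.aT, rfl, rfl, rfl, rfl, hI₂.arr _ (by simp), rfl⟩
    (hI₂.reg _ (by simp))) ?_
  rintro t₃ σ₃ ⟨ht₃, c, q, lab, Q', h21, hcv, hS, hlab⟩ hfr
  have hI₃ := hI₂.frame hfr (by decide) (by decide)
    (R' := [6, 7, 8, 30, 32, 33, 40, 50, 60]) (A' := [22, 24, 28]) (by decide) (by decide)
  have h9₃ : σ₃.reg 9 = 1 := by rw [hfr.1 9 (by decide), h9₂]
  rw [← hfr.2 14 (by decide), ← hfr.2 15 (by decide)] at hFO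
  rw [← hfr.2 16 (by decide), ← hfr.2 17 (by decide)] at hFI
  rw [← hfr.2 18 (by decide)] at h18
  clear hfr
  have hβ := hS.betti_eq hlab
  refine Run.block_cons (computeBounds_run hI₃.r0 hI₃.r1 h21 hβ (by omega) (by omega)
    (by omega)) ?_
  rintro t₄ σ₄ ⟨ht₄, h75, h90⟩ hfr
  have hI₄ := hI₃.frame hfr (by decide) (by decide)
    (R' := [6, 7, 8, 30, 32, 33, 40, 50, 60]) (A' := [22, 24, 28]) (by decide) (by decide)
  have h9₄ : σ₄.reg 9 = 1 := by rw [hfr.1 9 (by decide), h9₃]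
  rw [← hfr.2 14 (by decide), ← hfr.2 15 (by decide)] at hFO
  rw [← hfr.2 16 (by decide), ← hfr.2 17 (by decide)] at hFI
  rw [← hfr.2 18 (by decide)] at h18
  clear hfr
  refine Run.block_cons (prune_run (by omega) hO hT hFI (Q := σ₄.arr 21)
    ⟨hI₄.r0, hI₄.reg _ (by simp), h9₄, hI₄.reg _ (by simp), hI₄.reg _ (by simp), hI₄.aO, rfl, rfl,
      h18, rfl⟩ (hI₄.reg _ (by simp))) ?_
  rintro t₅ σ₅ ⟨ht₅, hL⟩ hfr
  have hI₅ := hI₄.frame hfr (by decide) (by decide)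
    (R' := [6, 7, 8, 40, 50, 60]) (A' := [22, 24, 28]) (by decide) (by decide)
  have h9₅ : σ₅.reg 9 = 1 := by rw [hfr.1 9 (by decide), h9₄]
  rw [← hfr.2 14 (by decide), ← hfr.2 15 (by decide)] at hFO
  rw [← hfr.1 75 (by decide)] at h75
  rw [← hfr.1 90 (by decide)] at h90
  clear hfr
  refine Run.block_cons (chooseOut_run (by omega) hI₅.r1 (hI₅.reg _ (by simp)) h9₅
    (hI₅.reg _ (by simp)) hI₅.aO hI₅.aT rfl) ?_
  rintro t₆ σ₆ ⟨ht₆, hU⟩ hfr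
  have hI₆ := hI₅.frame hfr (by decide) (by decide)
    (R' := [6, 7, 8, 50, 60]) (A' := [22, 24, 28]) (by decide) (by decide)
  have h9₆ : σ₆.reg 9 = 1 := by rw [hfr.1 9 (by decide), h9₅]
  rw [← hfr.2 14 (by decide), ← hfr.2 15 (by decide)] at hFO
  rw [← hfr.2 18 (by decide)] at hL hU
  rw [← hfr.1 75 (by decide)] at h75
  rw [← hfr.1 90 (by decide)] at h90
  clear hfr
  refine Run.block_cons (findCircles_run (by omega) hL hU ⟨hI₆.r1, hI₆.reg _ (by simp), h9₆,
    hI₆.reg _ (by simp), hI₆.aT, rfl, hI₆.arr _ (by simp), rfl, hI₆.arr _ (by simp)⟩) ?_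
  rintro t₇ σ₇ ⟨ht₇, mark, hC⟩ hfr
  have hI₇ := hI₆.frame hfr (by decide) (by decide)
    (R' := [6, 7, 8, 60]) (A' := [28]) (by decide) (by decide)
  have h9₇ : σ₇.reg 9 = 1 := by rw [hfr.1 9 (by decide), h9₆]
  rw [← hfr.2 14 (by decide), ← hfr.2 15 (by decide)] at hFO
  rw [← hfr.2 18 (by decide)] at hL hU hC
  rw [← hfr.2 23 (by decide)] at hU hC
  rw [← hfr.1 75 (by decide)] at h75
  rw [← hfr.1 90 (by decide)] at h90
  clear hfr
  refine Run.block_cons (findCycles_run hγ.immersive hL hU hFO hD bettiBound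
    (card_start_le hL hU hC) (by omega) hW' ⟨hI₇.r1, hI₇.reg _ (by simp), h9₇, h75, h90, hI₇.aO,
      hI₇.aT, hI₇.aG, rfl, rfl, rfl, rfl, rfl⟩ (hI₇.reg _ (by simp)) ?_) ?_
  · refine ⟨0, fun _ _ => 0, fun _ => 0, fun _ => 0, fun _ => 0, ?_, rfl, by simp, by simp,
      hI₇.reg _ (by simp), hI₇.reg _ (by simp), by simp⟩
    rw [hI₇.arr 28 (by simp)]
    exact Found.zero
  · rintro t₈ σ₈ ⟨ht₈, hf⟩ -
    rw [run_block_nil]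
    exact ⟨by omega, hf.outputs hγ he hL hU hC⟩

/-- One walk costs `O(m * e)`, since `β + b` bounds the outdegrees up to one, and there are `3 * β`
walks. Positivity of `m` and `e` absorbs the linear terms. -/
theorem time_le {e v β b m n : ℕ} (he : 0 < e) (hv : v ≤ e + b) (hpos : 0 < β + b)
    (hm : β + b ≤ m) (hn : e ≤ n) :
    170 * e + 70 * v + 3 * β * ((10 * (β + b + 1) + 40) * (2 * e + 1) + 70 * e + 100) + 31 ≤
      2000 * (m ^ 2 * n + 1) := by
  have h1 : (10 * (β + b + 1) + 40) * (2 * e + 1) + 70 * e + 100 ≤ 350 * (m * e) := by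
    nlinarith [Nat.mul_le_mul hm he, Nat.mul_le_mul hm (le_refl e), Nat.mul_le_mul hpos he,
      Nat.mul_le_mul (hpos.trans_le hm) (le_refl e), Nat.mul_le_mul (hpos.trans_le hm) he]
  have h2 : 3 * β * ((10 * (β + b + 1) + 40) * (2 * e + 1) + 70 * e + 100) ≤
      3 * m * (350 * (m * e)) := Nat.mul_le_mul (by omega) h1
  have h3 : 3 * m * (350 * (m * e)) = 1050 * (m ^ 2 * e) := by ring
  have h4 : m ^ 2 * e ≤ m ^ 2 * n := Nat.mul_le_mul_left _ hn
  have h5 : e ≤ m ^ 2 * e := Nat.le_mul_of_pos_left _ (pow_pos (hpos.trans_le hm) 2)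
  have h6 : m ≤ m ^ 2 * e := by
    calc m ≤ m ^ 2 := Nat.le_self_pow two_ne_zero m
      _ ≤ m ^ 2 * e := Nat.le_mul_of_pos_right _ he
  omega

theorem word_le {N C W : ℕ} (hC : 8 ≤ C) (hW : W = (N + 2) ^ C) : 64 * (N + 2) ^ 2 ≤ W := by
  calc 64 * (N + 2) ^ 2 = 2 ^ 6 * (N + 2) ^ 2 := by norm_num
    _ ≤ (N + 2) ^ 6 * (N + 2) ^ 2 := by gcongr; omega
    _ = (N + 2) ^ 8 := by rw [← pow_add]
    _ ≤ W := by rw [hW]; exact Nat.pow_le_pow_right (by omega) hC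

end Main

end LongCycles

/-! ### The main theorem -/

theorem mainTheorem8 :
    ∃ (P : LongCycles.Prog) (C : ℕ),
      ∀ (v e v' e' v'' e'' : ℕ) (Γ : LongCycles.DGraph (Fin v) (Fin e))
        (Λ : LongCycles.DGraph (Fin v') (Fin e')) (Δ : LongCycles.DGraph (Fin v'') (Fin e''))
        (γ : LongCycles.Hom Γ Δ) (lam : LongCycles.Hom Λ Δ),
        γ.IsForwardsImmersion → lam.IsForwardsImmersion →
        ∀ m n N W : ℕ,
          m = (Γ.betti + Γ.boundary.ncard) + (Λ.betti + Λ.boundary.ncard) →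
          n = e + e' →
          N = v + e + v' + e' + v'' + e'' →
          W = (N + 2) ^ C →
          ∃ (T : ℕ) (σ : LongCycles.Mem),
            LongCycles.Exec W P (LongCycles.input γ lam) T σ ∧
            T ≤ C * (m ^ 2 * n + 1) ∧
            ∃ (p q : ℕ) (S : LongCycles.DGraph (Fin p) (Fin q)) (s : LongCycles.Hom S Γ),
              LongCycles.Outputs σ s ∧ LongCycles.IsLongCycles γ s := by
  -- The constant serves both as factor of the time bound and as exponent of the word size; for the
  -- latter `8` would do, by `word_le`.
  refine ⟨LongCycles.longCycles, 2000, ?_⟩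
  intro v e v' e' v'' e'' Γ Λ Δ γ lam hγ _ m n N W hm hn hN hW
  suffices h : LongCycles.Run W LongCycles.longCycles (LongCycles.input γ lam) fun T σ =>
      T ≤ 2000 * (m ^ 2 * n + 1) ∧
      ∃ (p q : ℕ) (S : LongCycles.DGraph (Fin p) (Fin q)) (s : LongCycles.Hom S Γ),
        LongCycles.Outputs σ s ∧ LongCycles.IsLongCycles γ s by
    obtain ⟨T, σ, h1, h2, h3⟩ := h
    exact ⟨T, σ, h1, h2, h3⟩
  have hW8 := LongCycles.word_le (by norm_num) hW
  clear hW
  rw [LongCycles.longCycles, LongCycles.run_ite]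
  constructor
  · intro he
    have he : 0 < e := he
    have hv : Nonempty (Fin v) := ⟨Γ.o ⟨0, he⟩⟩
    have h1 := Γ.card_vertices_le
    have h2 := Γ.betti_add_boundary_pos
    -- The cycle space lies in the chain space. This bounds the size `2 * e * β` of the output
    -- quadratically in `N`, within the word size.
    have hβ : Γ.betti ≤ e := by
      have := LinearMap.finrank_le_finrank_of_injective (Submodule.injective_subtype
        (LinearMap.ker Γ.chainBoundary))
      rw [Module.finrank_finsupp_self, Fintype.card_fin] at this
      exact this
    rw [Fintype.card_fin, Fintype.card_fin] at h1
    have heN : e + v ≤ N := by omega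
    refine (LongCycles.mainLoop_run hγ he (W := W) LongCycles.fibreCard_table_le ?_ ?_ ?_).mono ?_
    · nlinarith
    · calc (Γ.betti + 1) * (2 * e) ≤ (N + 2) * (2 * (N + 2)) := by gcongr <;> omega
        _ ≤ W := by nlinarith
    · refine ⟨rfl, rfl, rfl, rfl, rfl, ?_, ?_⟩
      · intro x hx
        fin_cases hx <;> rfl
      · intro a ha
        fin_cases ha <;> rfl
    · rintro T σ ⟨hT, h⟩
      refine ⟨?_, h⟩
      have := LongCycles.time_le he h1 h2 (m := m) (n := n) (by omega) (by omega)
      omega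
  · intro he
    have he : ¬ 0 < e := he
    -- Without edges there are no cycles, and the untouched zero memory already encodes the empty
    -- graph.
    obtain rfl : e = 0 := by omega
    rw [LongCycles.run_skip]
    refine ⟨by omega, 0, 0, ?_⟩
    obtain ⟨S, s, hs⟩ := LongCycles.exists_isLongCycles_of_isEmpty γ
    exact ⟨S, s, ⟨rfl, rfl, fun i => i.elim0, fun i => i.elim0, fun i => i.elim0,
      fun i => i.elim0⟩, hs⟩
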